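/- Let $n, m$ and $n_1,\dots,n_m$ be non-negative integers and let $(\mathbf B,\mathbf c)$ be a non-degenerate Brascamp--Lieb datum: $\mathbf B=(B_j)_{j=1}^m$ consists of surjective linear maps $B_j:\mathbb R^n\to\mathbb R^{n_j}$ with $\bigcap_{j=1}^m\ker B_j=\{0\}$, and $\mathbf c=(c_j)_{j=1}^m$ of exponents $c_j>0$. Let $\mathbf G=(G_j)_{j=1}^m$, where each $G_j$ is a self-adjoint positive definite linear transformation of $\mathbb R^{n_j}$. For a self-adjoint positive definite transformation $A$ of a Euclidean space put $g_A(x)=(\det A)^{1/2}e^{-\pi\langle x,Ax\rangle}$. Let $T(G_j)$ be the set of all functions $g_{G_j}*\mu$ on $\mathbb R^{n_j}$, where $\mu$ is a positive finite Borel measure on $\mathbb R^{n_j}$ with non-zero mass. For functions $f_j:\mathbb R^{n_j}\to[0,\infty)$ with $\int f_j\in(0,\infty)$, and measurable $f_*:\mathbb R^n\to[0,\infty]$, consider the condition $$f_*\Big(\sum_{j=1}^m c_jB_j^*x_j\Big)\ \ge\ \prod_{j=1}^m f_j(x_j)^{c_j}\qquad\text{for all }(x_1,\dots,x_m)\in\prod_{j=1}^m\mathbb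 R^{n_j}, \tag{$*$}$$ and the Barthe functional $$\mathrm R(\mathbf B,\mathbf c;(f_j)_{j=1}^m,f_*)=\frac{\int_{\mathbb R^n}f_*}{\prod_{j=1}^m\big(\int_{\mathbb R^{n_j}}f_j\big)^{c_j}} .$$ Let $\mathrm R(\mathbf B,\mathbf c,\mathbf G)$ be the infimum of this functional over all $f_j\in T(G_j)$ $(1\le j\le m)$ and all measurable $f_*:\mathbb R^n\to[0,\infty]$ with $\int f_*<\infty$ satisfying $(*)$; equivalently, the largest constant $C$ such that $\int_{\mathbb R^n}f_*\ge C\prod_{j=1}^m(\int_{\mathbb R^{n_j}}f_j)^{c_j}$ for all such inputs. Then the infimum may be taken over centred gaussian inputs only: $$\mathrm R(\mathbf B,\mathbf c,\mathbf G)=\inf\ \mathrm R\big(\mathbf B,\mathbf c;(g_{A_j})_{j=1}^m,\alpha\, g_{A_*}\big),$$ where the infimum is over all self-adjoint positive definite $A_j$ on $\mathbb R^{n_j}$ with $A_j\le G_j$ $(1\le j\le m)$, all self-adjoint positive definite $A_*$ on $\mathbb R^n$ and all $\alpha>0$ such that $f_j=g_{A_j}$, $f_*=\alpha\, g_{A_*}$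 satisfy $(*)$. -/

import Mathlib

open MeasureTheory
open scoped ENNReal

noncomputable section

/-- `S₊(ℝⁿ)`: the self-adjoint, positive definite linear transformations of `ℝⁿ`. -/
def SPlus (n : ℕ) : Set (EuclideanSpace ℝ (Fin n) →ₗ[ℝ] EuclideanSpace ℝ (Fin n)) :=
  {A | A.IsSymmetric ∧ ∀ x, x ≠ 0 → 0 < inner ℝ x (A x)}

/-- The normalised centred gaussian `g_A(x) = (det A)^{1/2} exp(-π ⟨x, A x⟩)`. -/
def gaussian {n : ℕ} (A : EuclideanSpace ℝ (Fin n) →ₗ[ℝ] EuclideanSpace ℝ (Fin n))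
    (x : EuclideanSpace ℝ (Fin n)) : ℝ≥0∞ :=
  ENNReal.ofReal (Real.sqrt (LinearMap.det A) * Real.exp (-Real.pi * inner ℝ x (A x)))

/-- The class `T(G)` of type `G` functions: all `g_G * μ`, with `μ` a positive finite Borel
measure of non-zero mass. -/
def typeClass {n : ℕ} (G : EuclideanSpace ℝ (Fin n) →ₗ[ℝ] EuclideanSpace ℝ (Fin n)) :
    Set (EuclideanSpace ℝ (Fin n) → ℝ≥0∞) :=
  {f | ∃ μ : Measure (EuclideanSpace ℝ (Fin n)), IsFiniteMeasure μ ∧ μ ≠ 0 ∧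
    ∀ x, f x = ∫⁻ y, gaussian G (x - y) ∂μ}

/-- The class `T(∞)` of all (Lebesgue measurable) functions `ℝⁿ → [0,∞]` of finite integral. -/
def typeInfty (n : ℕ) : Set (EuclideanSpace ℝ (Fin n) → ℝ≥0∞) :=
  {f | AEMeasurable f volume ∧ ∫⁻ x, f x < ∞}

/-- A non-degenerate Brascamp–Lieb datum `(B, c)`: positive exponents, each `B_j` surjective, and
the kernels of the `B_j` intersect only in `0`. -/
structure NondegenerateDatum {m n : ℕ} {d : Fin m → ℕ}
    (B : ∀ j, EuclideanSpace ℝ (Fin n) →ₗ[ℝ] EuclideanSpace ℝ (Fin (d j)))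
    (c : Fin m → ℝ) : Prop where
  exponent_pos : ∀ j, 0 < c j
  surjective : ∀ j, Function.Surjective (B j)
  ker_inf : ⨅ j, LinearMap.ker (B j) = ⊥

/-- `f_*(∑ c_j B_j^* x_j) ≥ ∏ f_j(x_j)^{c_j}` for all `(x_1, …, x_m)`. -/
def BartheCondition {m n : ℕ} {d : Fin m → ℕ}
    (B : ∀ j, EuclideanSpace ℝ (Fin n) →ₗ[ℝ] EuclideanSpace ℝ (Fin (d j)))
    (c : Fin m → ℝ) (f : ∀ j, EuclideanSpace ℝ (Fin (d j)) → ℝ≥0∞)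
    (fstar : EuclideanSpace ℝ (Fin n) → ℝ≥0∞) : Prop :=
  ∀ x : ∀ j, EuclideanSpace ℝ (Fin (d j)),
    ∏ j, f j (x j) ^ c j ≤ fstar (∑ j, c j • LinearMap.adjoint (B j) (x j))

/-- The Barthe functional `∫ f_* / ∏ (∫ f_j)^{c_j}`. -/
def bartheFunctional {m n : ℕ} {d : Fin m → ℕ} (c : Fin m → ℝ)
    (f : ∀ j, EuclideanSpace ℝ (Fin (d j)) → ℝ≥0∞)
    (fstar : EuclideanSpace ℝ (Fin n) → ℝ≥0∞) : ℝ≥0∞ :=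
  (∫⁻ z, fstar z) / ∏ j, (∫⁻ x, f j x) ^ c j

/-- `R(B, c, G)`: the infimum of the Barthe functional over the inputs with `f_j ∈ T(G_j)` and
`f_* ∈ T(∞)` satisfying the sup-convolution condition. -/
def regularizedBartheConst {m n : ℕ} {d : Fin m → ℕ}
    (B : ∀ j, EuclideanSpace ℝ (Fin n) →ₗ[ℝ] EuclideanSpace ℝ (Fin (d j))) (c : Fin m → ℝ)
    (G : ∀ j, EuclideanSpace ℝ (Fin (d j)) →ₗ[ℝ] EuclideanSpace ℝ (Fin (d j))) : ℝ≥0∞ :=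
  sInf {r | ∃ (f : ∀ j, EuclideanSpace ℝ (Fin (d j)) → ℝ≥0∞)
      (fstar : EuclideanSpace ℝ (Fin n) → ℝ≥0∞),
    (∀ j, f j ∈ typeClass (G j)) ∧ fstar ∈ typeInfty n ∧ BartheCondition B c f fstar ∧
      r = bartheFunctional c f fstar}

/-- The infimum of the Barthe functional over the gaussian inputs `f_j = g_{A_j}`,
`f_* = α g_{A_*}` satisfying the sup-convolution condition, where `A_j > 0`, `A_j ≤ G_j`
(that is, `G_j - A_j` is positive semi-definite), `A_* > 0` and `α > 0`. -/
def gaussianBartheConst {m n : ℕ} {d : Fin m → ℕ}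
    (B : ∀ j, EuclideanSpace ℝ (Fin n) →ₗ[ℝ] EuclideanSpace ℝ (Fin (d j))) (c : Fin m → ℝ)
    (G : ∀ j, EuclideanSpace ℝ (Fin (d j)) →ₗ[ℝ] EuclideanSpace ℝ (Fin (d j))) : ℝ≥0∞ :=
  sInf {r | ∃ (A : ∀ j, EuclideanSpace ℝ (Fin (d j)) →ₗ[ℝ] EuclideanSpace ℝ (Fin (d j)))
      (Astar : EuclideanSpace ℝ (Fin n) →ₗ[ℝ] EuclideanSpace ℝ (Fin n)) (α : ℝ),
    (∀ j, A j ∈ SPlus (d j) ∧ (G j - A j).IsPositive) ∧ Astar ∈ SPlus n ∧ 0 < α ∧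
      BartheCondition B c (fun j => gaussian (A j))
        (fun z => ENNReal.ofReal α * gaussian Astar z) ∧
      r = bartheFunctional c (fun j => gaussian (A j))
        (fun z => ENNReal.ofReal α * gaussian Astar z)}

end

open ProbabilityTheory Filter
open scoped Real RealInnerProductSpace Topology

noncomputable section

/-! One inequality is approximation. If `A < G`, then `g_A` is `g_G` convolved with the gaussian of
covariance `A⁻¹ - G⁻¹` (`gaussian_mem_typeClass`), hence of type `G`. The case `A ≤ G` follows by
replacing `A` with `r A` and letting `r ↑ 1` (`regularizedBartheConst_le_gaussianBartheConst`).

For the converse let `C` be the gaussian constant, which may be assumed positive. Write `A_j = (Q_j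
Q_j^*)⁻¹`, so that `A_j ≤ G_j` becomes `Q_j^* G_j Q_j ≥ 1`. With the best `A_*`, the gaussian value
is `det(∑ c_j B_j^* Q_j Q_j^* B_j)^{1/2} ∏ |det Q_j|^{-c_j}`. At a minimiser, a linear change of
variables gives maps `U_j` with `∑ c_j U_j^* U_j = 1`. Since stretching `Q_j` keeps it admissible,
stationarity gives `U_j U_j^* ≥ 1`. Along eigenvectors of `Q_j^* G_j Q_j` whose eigenvalue exceeds
`1` the constraint is slack, shrinking is allowed too, and `‖U_j^* e_i‖ ≤ 1`. The infimum need not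
be attained, so a small Hilbert–Schmidt penalty is added; this weakens the first condition to `c_j
U_j U_j^* ≥ c_j - τ` with `τ` as small as desired (`exists_normal_position`).

In normal position the inequality is proved by heat flow, following Borell. Let `v_j(t, ·)` be `μ_j`
smoothed by axis-parallel gaussians of widths `l_i + t`, where `1 / l_i` are the eigenvalues of
`Q_j^* G_j Q_j`. Up to a correction depending on `t` only, `Φ_j = c_j log v_j` satisfies `∂_t Φ ≤
(1/4π) tr(U^* ∇²Φ U) + sup_p (⟪∇Φ, p⟫ - c_j π |p|²)`; the almost-lower bound on `U_j U_j^*` is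
exactly what controls the covariance term in `∇² log v_j`. Translating the noise by `∑ c_j U_j^*
p_j` costs at most `π ∑ c_j |p_j|²`, because `∑ c_j U_j^* U_j = 1`, and this is the kinetic term
gained. Hence the sup-convolution condition persists when `F` evolves by the heat equation
(`le_heat_of_driftStep`). The argument is run in discrete time: `DriftStep` is the inequality over a
time `s` with error `O(s^{3/2})`, `heat_step` combines the `m` inputs by Cameron–Martin and Jensen,
and the accumulated error vanishes as `s → 0`.

At time `T` the heat evolution of `F` at `0` is at most `T^{-n/2} ∫ F`, while the left side behaves
like `T^{-n/2} ∏ μ_j(ℝ^{d_j})^{c_j}` since `∑ c_j tr(U_j U_j^*) = n`. The correction at time `0` has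
the right sign because `‖U_j^* e_i‖ ≤ 1` wherever `l_i < 1`. So `T → ∞` gives
`barthe_of_normal_position`, with loss `exp(-π τ κ ∑ d_j)` for measures supported where `⟪y, G_j y⟫
≤ κ`. This `κ` does not depend on the chosen near-minimiser, so `τ → 0` removes the loss
(`barthe_of_bounded_support`), and exhausting each `μ_j` by balls finishes the proof. -/

/-- Euclidean `n`-space. -/
abbrev Euc (n : ℕ) := EuclideanSpace ℝ (Fin n)

/-! ### The gaussian measure with density `exp(-π|w|²)` and its moments -/

/-- The gaussian probability measure with density `exp (-π ‖w‖²)`. -/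
def piGaussian (n : ℕ) : Measure (Euc n) :=
  volume.withDensity fun w => ENNReal.ofReal (rexp (-π * ‖w‖ ^ 2))

theorem lintegral_piGaussian {n : ℕ} (f : Euc n → ℝ≥0∞) :
    ∫⁻ w, f w ∂piGaussian n = ∫⁻ w, ENNReal.ofReal (rexp (-π * ‖w‖ ^ 2)) * f w := by
  rw [piGaussian, lintegral_withDensity_eq_lintegral_mul_non_measurable _ (by fun_prop)]
  · rfl
  · filter_upwards with w using ENNReal.ofReal_lt_top

theorem charFun_piGaussian {n : ℕ} (t : Euc n) :
    charFun (piGaussian n) t = Complex.exp (-(‖t‖ ^ 2 / (4 * π) : ℝ)) := by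
  rw [charFun_apply, piGaussian, integral_withDensity_eq_integral_toReal_smul (by fun_prop)
    (by filter_upwards with w using ENNReal.ofReal_lt_top)]
  have h := GaussianFourier.integral_cexp_neg_mul_sq_norm_add (V := Euc n) (b := (π : ℂ))
    (by simpa using Real.pi_pos) Complex.I t
  have hpi : (π : ℂ) ≠ 0 := by exact_mod_cast Real.pi_ne_zero
  rw [div_self hpi, Complex.one_cpow, one_mul] at h
  convert h using 1
  · congr 1
    ext w
    rw [ENNReal.toReal_ofReal (Real.exp_pos _).le, Complex.real_smul, Complex.ofReal_exp,
      ← Complex.exp_add, real_inner_comm]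
    congr 1
    push_cast
    ring
  · congr 1
    push_cast
    rw [Complex.I_sq]
    ring

instance instIsProbabilityMeasurePiGaussian (n : ℕ) : IsProbabilityMeasure (piGaussian n) := by
  constructor
  rw [← setLIntegral_one, Measure.restrict_univ, lintegral_piGaussian]
  simp only [mul_one]
  have h := GaussianFourier.integral_rexp_neg_mul_sq_norm (V := Euc n) Real.pi_pos
  rw [div_self Real.pi_ne_zero, Real.one_rpow] at h
  rw [← ofReal_integral_eq_lintegral_ofReal, h, ENNReal.ofReal_one]
  · by_contra hc
    rw [integral_undef hc] at h
    norm_num at h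
  · filter_upwards with w using (Real.exp_pos _).le

/-- Both sides have the same characteristic function. All moments below are read off from the
standard gaussian through this scaling, so the covariance is `1 / (2π)`. -/
theorem piGaussian_eq_map_stdGaussian (n : ℕ) :
    piGaussian n = (stdGaussian (Euc n)).map ((√(2 * π))⁻¹ • ·) := by
  have : IsProbabilityMeasure ((stdGaussian (Euc n)).map ((√(2 * π))⁻¹ • ·)) :=
    Measure.isProbabilityMeasure_map (by fun_prop)
  apply Measure.ext_of_charFun
  ext t
  rw [charFun_piGaussian, charFun_map_smul, charFun_stdGaussian]
  congr 1
  rw [norm_smul, Real.norm_of_nonneg (by positivity), ← Complex.ofReal_pow, mul_pow, inv_pow,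
    Real.sq_sqrt (by positivity)]
  push_cast
  have hpi : (π : ℂ) ≠ 0 := by exact_mod_cast Real.pi_ne_zero
  field_simp
  norm_num

theorem integrable_norm_pow_piGaussian (n k : ℕ) :
    Integrable (fun w => ‖w‖ ^ k) (piGaussian n) := by
  rw [piGaussian_eq_map_stdGaussian, integrable_map_measure (by fun_prop) (by fun_prop)]
  have h := (IsGaussian.memLp_id (stdGaussian (Euc n)) k (by simp)).integrable_norm_pow'
  simp only [id] at h
  refine (h.const_mul (((√(2 * π))⁻¹) ^ k)).congr ?_
  filter_upwards with w
  simp [norm_smul, mul_pow, abs_of_nonneg (Real.sqrt_nonneg _)]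

theorem integrable_inner_piGaussian {n : ℕ} (a : Euc n) :
    Integrable (fun w => ⟪a, w⟫) (piGaussian n) := by
  refine ((integrable_norm_pow_piGaussian n 1).const_mul ‖a‖).mono' (by fun_prop) ?_
  filter_upwards with w
  simpa using norm_inner_le_norm (𝕜 := ℝ) a w

theorem integral_inner_piGaussian {n : ℕ} (a : Euc n) :
    ∫ w, ⟪a, w⟫ ∂piGaussian n = 0 := by
  rw [piGaussian_eq_map_stdGaussian, integral_map (by fun_prop) (by fun_prop)]
  simp only [inner_smul_right, integral_const_mul]
  have := integral_strongDual_stdGaussian (innerSL ℝ a)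
  simp only [innerSL_apply_apply] at this
  rw [this, mul_zero]

theorem integral_inner_sq_piGaussian {n : ℕ} (a : Euc n) :
    ∫ w, ⟪a, w⟫ ^ 2 ∂piGaussian n = ‖a‖ ^ 2 / (2 * π) := by
  rw [piGaussian_eq_map_stdGaussian, integral_map (by fun_prop) (by fun_prop)]
  simp only [inner_smul_right, mul_pow, integral_const_mul]
  have h1 := variance_dual_stdGaussian (innerSL ℝ a)
  have h2 := integral_strongDual_stdGaussian (innerSL ℝ a)
  rw [variance_of_integral_eq_zero (by fun_prop) h2] at h1
  simp only [innerSL_apply_apply, innerSL_apply_norm] at h1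
  rw [h1, inv_pow, Real.sq_sqrt (by positivity)]
  field_simp

theorem integrable_inner_mul_inner_piGaussian {n : ℕ} (a b : Euc n) :
    Integrable (fun w => ⟪a, w⟫ * ⟪b, w⟫) (piGaussian n) := by
  refine ((integrable_norm_pow_piGaussian n 2).const_mul (‖a‖ * ‖b‖)).mono' (by fun_prop) ?_
  filter_upwards with w
  rw [norm_mul]
  calc ‖⟪a, w⟫‖ * ‖⟪b, w⟫‖ ≤ (‖a‖ * ‖w‖) * (‖b‖ * ‖w‖) := by
        gcongr <;> exact norm_inner_le_norm (𝕜 := ℝ) _ _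
    _ = _ := by ring

theorem integral_inner_mul_inner_piGaussian {n : ℕ} (a b : Euc n) :
    ∫ w, ⟪a, w⟫ * ⟪b, w⟫ ∂piGaussian n = ⟪a, b⟫ / (2 * π) := by
  have h : ∀ w : Euc n, ⟪a, w⟫ * ⟪b, w⟫ =
      (⟪a + b, w⟫ ^ 2 - ⟪a - b, w⟫ ^ 2) / 4 := fun w => by
    rw [inner_add_left, inner_sub_left]; ring
  have hi : ∀ c : Euc n, Integrable (fun w => ⟪c, w⟫ ^ 2) (piGaussian n) := fun c => by
    simpa only [sq] using integrable_inner_mul_inner_piGaussian c c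
  simp_rw [h]
  rw [integral_div, integral_sub (hi _) (hi _), integral_inner_sq_piGaussian,
    integral_inner_sq_piGaussian, norm_add_sq_real, norm_sub_sq_real]
  ring

/-! ### The heat semigroup -/

/-- Heat evolution of a function at time `t`. -/
def heat {n : ℕ} (t : ℝ) (F : Euc n → ℝ≥0∞) (z : Euc n) : ℝ≥0∞ :=
  ∫⁻ w, F (z + √t • w) ∂piGaussian n

theorem heat_zero {n : ℕ} (F : Euc n → ℝ≥0∞) (z : Euc n) : heat 0 F z = F z := by
  simp [heat]

/-- Variances of independent gaussians add; this is the semigroup law behind `heat_add`. -/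
theorem map_smul_conv_piGaussian {n : ℕ} {s t : ℝ} (hs : 0 ≤ s) (ht : 0 ≤ t) :
    ((piGaussian n).map (√s • ·)).conv ((piGaussian n).map (√t • ·)) =
      (piGaussian n).map (√(s + t) • ·) := by
  have (r : ℝ) : IsProbabilityMeasure ((piGaussian n).map (r • ·)) :=
    Measure.isProbabilityMeasure_map (by fun_prop)
  apply Measure.ext_of_charFun
  ext ξ
  rw [charFun_conv, charFun_map_smul, charFun_map_smul, charFun_map_smul, charFun_piGaussian,
    charFun_piGaussian, charFun_piGaussian, ← Complex.exp_add]
  congr 1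
  rw [← Complex.ofReal_neg, ← Complex.ofReal_neg, ← Complex.ofReal_neg, ← Complex.ofReal_add]
  congr 1
  simp only [norm_smul, mul_pow, Real.norm_eq_abs, sq_abs]
  rw [Real.sq_sqrt hs, Real.sq_sqrt ht, Real.sq_sqrt (add_nonneg hs ht)]
  ring

theorem heat_add {n : ℕ} {F : Euc n → ℝ≥0∞} (hF : Measurable F) {s t : ℝ} (hs : 0 ≤ s)
    (ht : 0 ≤ t) (z : Euc n) : heat (s + t) F z = heat s (heat t F) z := by
  have hG : Measurable fun w => F (z + w) := by fun_prop
  have h1 : heat (s + t) F z =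
      ∫⁻ w, F (z + w) ∂((piGaussian n).map (√(s + t) • ·)) := by
    rw [lintegral_map hG (by fun_prop), heat]
  have (r : ℝ) : IsProbabilityMeasure ((piGaussian n).map (r • ·)) :=
    Measure.isProbabilityMeasure_map (by fun_prop)
  rw [h1, ← map_smul_conv_piGaussian hs ht, Measure.lintegral_conv hG,
    lintegral_map (by fun_prop) (by fun_prop)]
  unfold heat
  congr 1
  ext w
  rw [lintegral_map (by fun_prop) (by fun_prop)]
  simp only [add_assoc]

theorem lintegral_comp_linear {n : ℕ} (F : Euc n → ℝ≥0∞) (N : Euc n ≃ₗ[ℝ] Euc n) :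
    ∫⁻ x, F (N x) = ENNReal.ofReal |(LinearMap.det (N : Euc n →ₗ[ℝ] Euc n))⁻¹| * ∫⁻ x, F x := by
  let e : Euc n ≃ᵐ Euc n := N.toContinuousLinearEquiv.toHomeomorph.toMeasurableEquiv
  have h := Measure.map_linearMap_addHaar_eq_smul_addHaar (volume : Measure (Euc n))
    (f := (N : Euc n →ₗ[ℝ] Euc n)) (LinearEquiv.isUnit_det' N).ne_zero
  have h2 : ∫⁻ x, F (N x) = ∫⁻ x, F x ∂(Measure.map (e : Euc n → Euc n) volume) :=
    (lintegral_map_equiv F e).symm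
  rw [h2]
  change ∫⁻ x, F x ∂(Measure.map ((N : Euc n →ₗ[ℝ] Euc n)) volume) = _
  rw [h, lintegral_smul_measure, smul_eq_mul]

theorem lintegral_comp_smul {n : ℕ} (F : Euc n → ℝ≥0∞) {r : ℝ} (hr : 0 < r) :
    ∫⁻ x, F (r • x) = ENNReal.ofReal ((r ^ n)⁻¹) * ∫⁻ x, F x := by
  have := lintegral_comp_linear F (LinearEquiv.smulOfNeZero ℝ (Euc n) r hr.ne')
  simp only [LinearEquiv.smulOfNeZero_apply] at this
  rw [this]
  congr 2
  have h : ((LinearEquiv.smulOfNeZero ℝ (Euc n) r hr.ne' : Euc n ≃ₗ[ℝ] Euc n) :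
      Euc n →ₗ[ℝ] Euc n) = r • LinearMap.id := by ext; simp
  rw [h, LinearMap.det_smul]
  simp [abs_of_pos hr]

/-- The heat kernel at time `t` is bounded by `t^{-n/2}`. This is how `∫ F` is recovered from the
flow as `t → ∞`. -/
theorem heat_apply_zero_le {n : ℕ} (F : Euc n → ℝ≥0∞) {t : ℝ} (ht : 0 < t) :
    heat t F 0 ≤ ENNReal.ofReal ((√t ^ n)⁻¹) * ∫⁻ x, F x := by
  rw [heat, lintegral_piGaussian, ← lintegral_comp_smul F (Real.sqrt_pos.2 ht)]
  refine lintegral_mono fun w => ?_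
  rw [zero_add]
  refine (mul_le_mul_left (b := ENNReal.ofReal _) (c := 1) ?_ _).trans_eq (one_mul _)
  rw [← ENNReal.ofReal_one]
  exact ENNReal.ofReal_le_ofReal (Real.exp_le_one_iff.2 (by nlinarith [Real.pi_pos, sq_nonneg ‖w‖]))

/-! ### Cameron–Martin, Jensen, and a second-order bound for `log ∫ exp` -/

/-- Cameron–Martin formula. -/
theorem lintegral_piGaussian_translate {n : ℕ} (f : Euc n → ℝ≥0∞) (b : Euc n) :
    ∫⁻ w, f w ∂piGaussian n =
      ∫⁻ w, ENNReal.ofReal (rexp (-2 * π * ⟪b, w⟫ - π * ‖b‖ ^ 2)) * f (w + b) ∂piGaussian n := by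
  rw [lintegral_piGaussian, lintegral_piGaussian,
    ← lintegral_add_right_eq_self (fun w => ENNReal.ofReal (rexp (-π * ‖w‖ ^ 2)) * f w) b]
  refine lintegral_congr fun w => ?_
  rw [← mul_assoc, ← ENNReal.ofReal_mul (Real.exp_pos _).le, ← Real.exp_add, norm_add_sq_real,
    real_inner_comm]
  congr 4
  ring

/-- Jensen for `exp`, from the tangent line at the mean `m`. Only `φ` need be integrable, so the
right side may be infinite; the tangent line is truncated at `0` to pass to the lower integral. -/
theorem ofReal_exp_integral_le_lintegral {α : Type*} [MeasurableSpace α] {ν : Measure α}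
    [IsProbabilityMeasure ν] {φ : α → ℝ} (hφ : Integrable φ ν) :
    ENNReal.ofReal (rexp (∫ a, φ a ∂ν)) ≤ ∫⁻ a, ENNReal.ofReal (rexp (φ a)) ∂ν := by
  set m := ∫ a, φ a ∂ν with hm
  have hs : Integrable (fun a => φ a - m) ν := hφ.sub (integrable_const m)
  have hi : Integrable (fun a => rexp m * (1 + (φ a - m))) ν :=
    ((integrable_const 1).add hs).const_mul _
  have h1 : ∫ a, rexp m * (1 + (φ a - m)) ∂ν = rexp m := by
    rw [integral_const_mul, integral_add (integrable_const 1) hs,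
      integral_sub hφ (integrable_const m)]
    simp [← hm]
  calc ENNReal.ofReal (rexp m) = ENNReal.ofReal (∫ a, rexp m * (1 + (φ a - m)) ∂ν) := by rw [h1]
    _ ≤ ENNReal.ofReal (∫ a, max (rexp m * (1 + (φ a - m))) 0 ∂ν) :=
        ENNReal.ofReal_le_ofReal (integral_mono hi hi.pos_part fun a => le_max_left _ _)
    _ = ∫⁻ a, ENNReal.ofReal (max (rexp m * (1 + (φ a - m))) 0) ∂ν :=
        ofReal_integral_eq_lintegral_ofReal hi.pos_part
          (by filter_upwards with a using le_max_right _ _)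
    _ ≤ _ := by
        refine lintegral_mono fun a => ENNReal.ofReal_le_ofReal (max_le ?_ (Real.exp_pos _).le)
        calc rexp m * (1 + (φ a - m)) ≤ rexp m * rexp (φ a - m) := by
              gcongr
              linarith [Real.add_one_le_exp (φ a - m)]
          _ = rexp (φ a) := by rw [← Real.exp_add]; congr 1; ring

/-- A Taylor polynomial of odd degree lies below `exp` on the whole line; on the negative side this
is integrated twice from `1 + y ≤ exp y`. -/
theorem one_add_add_sq_add_cube_le_exp (x : ℝ) : 1 + x + x ^ 2 / 2 + x ^ 3 / 6 ≤ rexp x := by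
  rcases le_total 0 x with hx | hx
  · have := Real.sum_le_exp_of_nonneg hx 4
    simp only [Finset.sum_range_succ, Finset.sum_range_zero, Nat.factorial] at this
    norm_num at this
    linarith
  · have hanti : AntitoneOn (fun y : ℝ => rexp y - (1 + y + y ^ 2 / 2 + y ^ 3 / 6)) (Set.Iic 0) := by
      refine antitoneOn_of_hasDerivWithinAt_nonpos (convex_Iic 0) (by fun_prop)
        (f' := fun y => rexp y - (1 + y + y ^ 2 / 2)) ?_ ?_
      · intro y _
        have h : HasDerivAt (fun y : ℝ => rexp y - (1 + y + y ^ 2 / 2 + y ^ 3 / 6))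
            (rexp y - (0 + 1 + (2 * y ^ 1 * 1) / 2 + (3 * y ^ 2 * 1) / 6)) y :=
          (Real.hasDerivAt_exp y).sub ((((hasDerivAt_const y 1).add (hasDerivAt_id y)).add
            (((hasDerivAt_id y).pow 2).div_const 2)).add (((hasDerivAt_id y).pow 3).div_const 6))
        exact (h.congr_deriv (by ring)).hasDerivWithinAt
      · intro y hy
        rw [interior_Iic] at hy
        have hmono : MonotoneOn (fun y : ℝ => rexp y - (1 + y + y ^ 2 / 2)) (Set.Iic 0) := by
          refine monotoneOn_of_hasDerivWithinAt_nonneg (convex_Iic 0) (by fun_prop)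
            (f' := fun y => rexp y - (1 + y)) ?_ ?_
          · intro y _
            have h : HasDerivAt (fun y : ℝ => rexp y - (1 + y + y ^ 2 / 2))
                (rexp y - (0 + 1 + (2 * y ^ 1 * 1) / 2)) y :=
              (Real.hasDerivAt_exp y).sub (((hasDerivAt_const y 1).add (hasDerivAt_id y)).add
                (((hasDerivAt_id y).pow 2).div_const 2))
            exact (h.congr_deriv (by ring)).hasDerivWithinAt
          · intro y _
            linarith [Real.add_one_le_exp y]
        have := hmono (Set.mem_Iic.2 (le_of_lt hy)) (Set.mem_Iic.2 le_rfl) (le_of_lt hy)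
        simpa using this
    have := hanti (Set.mem_Iic.2 hx) (Set.mem_Iic.2 le_rfl) hx
    simp only [Real.exp_zero] at this
    linarith

/-- Second order lower bound for the cumulant generating function of a bounded centred random
variable. -/
theorem half_integral_sq_sub_le_log_integral_exp {Ω : Type*} [MeasurableSpace Ω] {ν : Measure Ω}
    [IsProbabilityMeasure ν] {Y : Ω → ℝ} (hY : AEStronglyMeasurable Y ν) (hY0 : ∫ ω, Y ω ∂ν = 0)
    {a b : ℝ} (ha : 0 ≤ a) (hb : 0 ≤ b) (hbd : ∀ᵐ ω ∂ν, |Y ω| ≤ a + b) :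
    (∫ ω, Y ω ^ 2 ∂ν) / 2 - 4 * (a ^ 3 + b ^ 2) ≤ Real.log (∫ ω, rexp (Y ω) ∂ν) := by
  set o := a + b with ho
  have ho0 : 0 ≤ o := by positivity
  have hint : Integrable Y ν := Integrable.of_bound hY o (by simpa using hbd)
  have hint2 : Integrable (fun ω => Y ω ^ 2) ν := by
    refine Integrable.of_bound (hY.pow 2) (o ^ 2) ?_
    filter_upwards [hbd] with ω h
    rw [Real.norm_eq_abs, abs_pow]
    gcongr
  have hint3 : Integrable (fun ω => Y ω ^ 3) ν := by
    refine Integrable.of_bound (hY.pow 3) (o ^ 3) ?_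
    filter_upwards [hbd] with ω h
    rw [Real.norm_eq_abs, abs_pow]
    gcongr
  have hinte : Integrable (fun ω => rexp (Y ω)) ν := by
    refine Integrable.of_bound (Real.continuous_exp.comp_aestronglyMeasurable hY) (rexp o) ?_
    filter_upwards [hbd] with ω h
    rw [Real.norm_of_nonneg (Real.exp_pos _).le]
    exact Real.exp_le_exp.2 ((le_abs_self _).trans h)
  set V := ∫ ω, Y ω ^ 2 ∂ν with hV
  have hV0 : 0 ≤ V := integral_nonneg fun ω => sq_nonneg _
  have hVo : V ≤ o ^ 2 := by
    calc V ≤ ∫ ω, o ^ 2 ∂ν := by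
          refine integral_mono_ae hint2 (integrable_const _) ?_
          filter_upwards [hbd] with ω h
          rw [← sq_abs]
          gcongr
      _ = o ^ 2 := by simp
  have h1 : 1 ≤ ∫ ω, rexp (Y ω) ∂ν := by
    calc (1 : ℝ) = ∫ ω, (1 + Y ω) ∂ν := by
          rw [integral_add (integrable_const _) hint, hY0]; simp
      _ ≤ _ := integral_mono ((integrable_const _).add hint) hinte fun ω => by
          simpa [add_comm] using Real.add_one_le_exp (Y ω)
  have h3 : -(o * V) ≤ ∫ ω, Y ω ^ 3 ∂ν := by
    calc -(o * V) = ∫ ω, -(o * Y ω ^ 2) ∂ν := by rw [integral_neg, integral_const_mul]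
      _ ≤ _ := by
          refine integral_mono_ae (hint2.const_mul o).neg hint3 ?_
          filter_upwards [hbd] with ω h
          have := (abs_le.1 h).1
          nlinarith [sq_nonneg (Y ω)]
  have hi1 : Integrable (fun ω => 1 + Y ω) ν := (integrable_const _).add hint
  have hi2 : Integrable (fun ω => 1 + Y ω + Y ω ^ 2 / 2) ν := hi1.add (hint2.div_const 2)
  have h2 : 1 + V / 2 - o * V / 6 ≤ ∫ ω, rexp (Y ω) ∂ν := by
    calc 1 + V / 2 - o * V / 6 ≤ 1 + V / 2 + (∫ ω, Y ω ^ 3 ∂ν) / 6 := by linarith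
      _ = ∫ ω, (1 + Y ω + Y ω ^ 2 / 2 + Y ω ^ 3 / 6) ∂ν := by
          rw [integral_add hi2 (hint3.div_const 6), integral_add hi1 (hint2.div_const 2),
            integral_add (integrable_const _) hint, hY0, integral_div, integral_div]
          simp [hV]
      _ ≤ _ := integral_mono (hi2.add (hint3.div_const 6)) hinte fun ω => one_add_add_sq_add_cube_le_exp (Y ω)
  -- In the application `a` bounds a part of order `√s` and `b` a part of order `s`, so `a³ + b²` is
  -- of order `s^{3/2}` or smaller. For `o ≤ 1` use `log (1 + q) ≥ q - q²/2`. For `o ≥ 1` the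
  -- logarithm is nonnegative by `h1`, and `V / 2 ≤ o² / 2` is already covered by the error term.
  rcases le_total o 1 with h | h
  · set q := V / 2 - o * V / 6 with hq
    have hq0 : 0 ≤ q := by nlinarith
    have hqV : q ≤ V / 2 := by nlinarith
    have hlog : q - q ^ 2 / 2 ≤ Real.log (∫ ω, rexp (Y ω) ∂ν) := by
      have h4 : Real.log (1 + q) ≤ Real.log (∫ ω, rexp (Y ω) ∂ν) :=
        Real.log_le_log (by linarith) (by linarith)
      refine le_trans ?_ h4
      have := Real.le_log_one_add_of_nonneg hq0
      refine le_trans ?_ this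
      rw [le_div_iff₀ (by linarith)]
      nlinarith [mul_nonneg hq0 hq0, mul_nonneg hq0 (mul_nonneg hq0 hq0)]
    have hq2 : q ^ 2 ≤ o ^ 3 / 4 := by
      calc q ^ 2 ≤ (o ^ 2 / 2) ^ 2 := by gcongr; linarith
        _ = o ^ 3 * o / 4 := by ring
        _ ≤ o ^ 3 * 1 / 4 := by gcongr
        _ = o ^ 3 / 4 := by ring
    have hoV : o * V ≤ o ^ 3 := by nlinarith
    have hab : o ^ 3 ≤ 4 * (a ^ 3 + b ^ 2) := by
      have hb1 : b ^ 3 ≤ b ^ 2 := by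
        have : b ≤ 1 := by linarith
        nlinarith [sq_nonneg b]
      have : (a + b) ^ 3 ≤ 4 * (a ^ 3 + b ^ 3) := by
        nlinarith [mul_nonneg (add_nonneg ha hb) (sq_nonneg (a - b))]
      linarith
    linarith
  · have hab : o ^ 2 ≤ 8 * (a ^ 3 + b ^ 2) := by
      rcases le_total a (1 / 2) with h' | h'
      · have : a ≤ b := by linarith
        have : 0 ≤ a ^ 3 := by positivity
        nlinarith
      · nlinarith [sq_nonneg (a - b), mul_nonneg (sq_nonneg a) (sub_nonneg.2 h')]
    have := Real.log_nonneg h1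
    linarith

/-! ### Potentials of axis-parallel gaussian kernels and their expansion over one time step -/

/-- The exponent of an axis-parallel gaussian kernel at time `t`. -/
def heatExponent {d : ℕ} (l : Fin d → ℝ) (t : ℝ) (x y : Euc d) : ℝ :=
  -π * ∑ i, (x i - y i) ^ 2 / (l i + t)

/-- Unnormalised heat evolution of a measure under axis-parallel gaussian kernels. -/
def heatPotential {d : ℕ} (l : Fin d → ℝ) (μ : Measure (Euc d)) (t : ℝ) (x : Euc d) : ℝ :=
  ∫ y, rexp (heatExponent l t x y) ∂μ

theorem continuous_heatExponent {d : ℕ} (l : Fin d → ℝ) (t : ℝ) (x : Euc d) :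
    Continuous (heatExponent l t x) := by
  unfold heatExponent; fun_prop

theorem heatExponent_nonpos {d : ℕ} {l : Fin d → ℝ} (hl : ∀ i, 0 < l i) {t : ℝ} (ht : 0 ≤ t)
    (x y : Euc d) : heatExponent l t x y ≤ 0 := by
  have : 0 ≤ ∑ i, (x i - y i) ^ 2 / (l i + t) :=
    Finset.sum_nonneg fun i _ => div_nonneg (sq_nonneg _) (by linarith [hl i])
  unfold heatExponent
  nlinarith [Real.pi_pos]

theorem integrable_exp_heatExponent {d : ℕ} {l : Fin d → ℝ} (hl : ∀ i, 0 < l i) {t : ℝ}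
    (ht : 0 ≤ t) (μ : Measure (Euc d)) [IsFiniteMeasure μ] (x : Euc d) :
    Integrable (fun y => rexp (heatExponent l t x y)) μ := by
  refine Integrable.of_bound
    (Real.continuous_exp.comp (continuous_heatExponent l t x)).aestronglyMeasurable 1 ?_
  filter_upwards with y
  rw [Real.norm_of_nonneg (Real.exp_pos _).le]
  exact Real.exp_le_one_iff.2 (heatExponent_nonpos hl ht x y)

theorem heatPotential_pos {d : ℕ} {l : Fin d → ℝ} (hl : ∀ i, 0 < l i) {t : ℝ}
    (ht : 0 ≤ t) (μ : Measure (Euc d)) [IsFiniteMeasure μ] [NeZero μ] (x : Euc d) :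
    0 < heatPotential l μ t x :=
  integral_exp_pos (integrable_exp_heatExponent hl ht μ x)

/-- Second order expansion of `log ∫ exp g` for the difference `g` of two gaussian exponents,
against a probability measure with bounded support. -/
theorem log_integral_exp_heatExponent_sub {d : ℕ} {l : Fin d → ℝ} (hl : ∀ i, 0 < l i)
    {D A : ℝ} (hD : 0 ≤ D) (hA : ∀ i, (l i)⁻¹ ≤ A) (hA0 : 0 ≤ A) {ν : Measure (Euc d)}
    [IsProbabilityMeasure ν] (hν : ∀ᵐ y ∂ν, ∀ i, |y i| ≤ D) {t s : ℝ} (ht : 0 ≤ t) (hs : 0 < s)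
    (x : Euc d) :
    ∃ p b : Euc d, ∃ K : Fin d → Fin d → ℝ,
      (∀ i, |p i| ≤ A * (|x i| + D)) ∧
      (∀ β : Fin d → Fin d → ℝ, (∀ ξ : Fin d → ℝ, 0 ≤ ∑ i, ∑ k, β i k * (ξ i * ξ k)) →
        0 ≤ ∑ i, ∑ k, β i k * K i k) ∧
      (∀ i, K i i ≤ (∫ y, y i ^ 2 ∂ν) / (l i + t) ^ 2) ∧
      ∀ δ : Euc d,
        π * s * ‖p‖ ^ 2 + ⟪b, δ⟫ - π * ∑ i, δ i ^ 2 / (l i + t)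
          + 2 * π ^ 2 * ∑ i, ∑ k, K i k * (δ i * δ k) - π * s * ∑ i, K i i
          - π * A * s ^ 2 * ‖p‖ ^ 2
          - 4 * ((4 * π * A * D * d * ‖δ‖) ^ 3 + (8 * π * A ^ 2 * D ^ 2 * d * s) ^ 2) ≤
        Real.log (∫ y, rexp (heatExponent l t (x + δ + s • p) y
          - heatExponent l (t + s) x y) ∂ν) := by
  have hcoord : ∀ i, Integrable (fun y : Euc d => y i) ν := fun i =>
    Integrable.of_bound (by fun_prop) D (by filter_upwards [hν] with y h using h i)
  set a : Fin d → ℝ := fun i => (l i + t)⁻¹ with ha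
  set a' : Fin d → ℝ := fun i => (l i + (t + s))⁻¹ with ha'
  have hla : ∀ i, 0 < l i + t := fun i => by linarith [hl i]
  have hla' : ∀ i, 0 < l i + (t + s) := fun i => by linarith [hl i]
  have ha0 : ∀ i, 0 < a i := fun i => inv_pos.2 (hla i)
  have ha0' : ∀ i, 0 < a' i := fun i => inv_pos.2 (hla' i)
  have haA : ∀ i, a i ≤ A := fun i => (inv_anti₀ (hl i) (by linarith)).trans (hA i)
  have haa : ∀ i, a' i ≤ a i := fun i => inv_anti₀ (hla i) (by linarith)
  have hsub : ∀ i, a i - a' i = s * a i * a' i := fun i => by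
    have := (hla i).ne'
    have := (hla' i).ne'
    simp only [ha, ha']
    field_simp
    ring
  set m : Fin d → ℝ := fun i => ∫ y, y i ∂ν with hm
  have hmD : ∀ i, |m i| ≤ D := fun i => by
    have := norm_integral_le_of_norm_le_const (μ := ν) (f := fun y : Euc d => y i) (C := D)
      (by filter_upwards [hν] with y h using h i)
    simpa using this
  set η : Fin d → Euc d → ℝ := fun i y => y i - m i with hη
  have hηm : ∀ i, Continuous (η i) := fun i => by simp only [hη]; fun_prop
  have hηD : ∀ᵐ y ∂ν, ∀ i, |η i y| ≤ 2 * D := by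
    filter_upwards [hν] with y h i
    have h1 := abs_le.1 (h i)
    have h2 := abs_le.1 (hmD i)
    exact abs_le.2 ⟨by simp only [hη]; linarith, by simp only [hη]; linarith⟩
  have hηi : ∀ i, Integrable (η i) ν := fun i => (hcoord i).sub (integrable_const _)
  have hη0 : ∀ i, ∫ y, η i y ∂ν = 0 := fun i => by
    simp only [hη]
    rw [integral_sub (hcoord i) (integrable_const _)]
    simp [hm]
  have hηη : ∀ i k, Integrable (fun y => η i y * η k y) ν := fun i k => by
    refine Integrable.of_bound ((hηm i).mul (hηm k)).aestronglyMeasurable (2 * D * (2 * D)) ?_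
    filter_upwards [hηD] with y h
    rw [norm_mul]
    exact mul_le_mul (h i) (h k) (abs_nonneg _) (by positivity)
  set w : Fin d → ℝ := fun i => ∫ y, η i y * η i y ∂ν with hw
  have hw0 : ∀ i, 0 ≤ w i := fun i => integral_nonneg fun y => mul_self_nonneg _
  have hwD : ∀ i, w i ≤ 4 * D ^ 2 := fun i => by
    calc w i ≤ ∫ _, 4 * D ^ 2 ∂ν := by
          refine integral_mono_ae (hηη i i) (integrable_const _) ?_
          filter_upwards [hηD] with y h
          have := abs_le.1 (h i)
          nlinarith
      _ = _ := by simp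
  set p : Euc d := WithLp.toLp 2 fun i => -(a' i * (x i - m i)) with hp
  have hpi : ∀ i, p i = -(a' i * (x i - m i)) := fun i => rfl
  -- The centred quadratic part of the exponent difference; it is of order `s` because `a - a' = s a
  -- a'`.
  set r : Euc d → ℝ := fun y => -π * s * ∑ i, a i * a' i * (η i y * η i y - w i) with hr
  have hrc : Continuous r := by simp only [hr]; fun_prop
  have hrD : ∀ᵐ y ∂ν, |r y| ≤ 8 * π * A ^ 2 * D ^ 2 * d * s := by
    filter_upwards [hηD] with y h
    simp only [hr]
    rw [abs_mul, abs_mul, abs_neg, abs_of_pos Real.pi_pos, abs_of_pos hs]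
    have : |∑ i, a i * a' i * (η i y * η i y - w i)| ≤ ∑ _i : Fin d, A ^ 2 * (8 * D ^ 2) := by
      refine (Finset.abs_sum_le_sum_abs _ _).trans (Finset.sum_le_sum fun i _ => ?_)
      rw [abs_mul, abs_mul, abs_of_pos (ha0 i), abs_of_pos (ha0' i)]
      have h1 : a i * a' i ≤ A ^ 2 := by
        rw [sq]
        exact mul_le_mul (haA i) ((haa i).trans (haA i)) (ha0' i).le hA0
      have h2 : |η i y * η i y - w i| ≤ 8 * D ^ 2 := by
        have := abs_le.1 (h i)
        have h3 : η i y * η i y ≤ 4 * D ^ 2 := by nlinarith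
        exact abs_le.2 ⟨by nlinarith [mul_self_nonneg (η i y), hwD i],
          by nlinarith [hw0 i]⟩
      exact mul_le_mul h1 h2 (abs_nonneg _) (by positivity)
    simp only [Finset.sum_const, Finset.card_univ, Fintype.card_fin, nsmul_eq_mul] at this
    calc π * s * |∑ i, a i * a' i * (η i y * η i y - w i)|
        ≤ π * s * (d * (A ^ 2 * (8 * D ^ 2))) := by gcongr
      _ = _ := by ring
  have hri : Integrable r ν := Integrable.of_bound hrc.aestronglyMeasurable _ hrD
  have hr0 : ∫ y, r y ∂ν = 0 := by
    simp only [hr]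
    rw [integral_const_mul, integral_finsetSum]
    · rw [Finset.sum_eq_zero, mul_zero]
      intro i _
      rw [integral_const_mul, integral_sub (hηη i i) (integrable_const _)]
      simp [hw]
    · intro i _
      exact ((hηη i i).sub (integrable_const _)).const_mul _
  have hηr : ∀ i, Integrable (fun y => η i y * r y) ν := fun i => by
    refine Integrable.of_bound ((hηm i).mul hrc).aestronglyMeasurable
      (2 * D * (8 * π * A ^ 2 * D ^ 2 * d * s)) ?_
    filter_upwards [hηD, hrD] with y h h'
    rw [norm_mul]
    exact mul_le_mul (h i) h' (abs_nonneg _) (by positivity)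
  -- `b` collects everything linear in `δ`, including the covariance of the linear part with `r`.
  -- Its value is irrelevant later, since linear terms average to zero over the noise. `K` is the
  -- covariance of `a η`, the part of `∇² log v / 4π²` that is positive semidefinite.
  refine ⟨p, WithLp.toLp 2 fun i => -2 * π * a i * (x i - m i) - 2 * π * a i * s * p i
    + 2 * π * a i * ∫ y, η i y * r y ∂ν, fun i k => a i * a k * ∫ y, η i y * η k y ∂ν,
    fun i => ?_, fun β hβ => ?_, fun i => ?_, fun δ => ?_⟩
  · rw [hpi, abs_neg, abs_mul, abs_of_pos (ha0' i)]
    refine mul_le_mul ((haa i).trans (haA i)) ?_ (abs_nonneg _) hA0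
    exact (abs_sub _ _).trans (by linarith [hmD i])
  · have : ∑ i, ∑ k, β i k * (a i * a k * ∫ y, η i y * η k y ∂ν) =
        ∫ y, ∑ i, ∑ k, β i k * ((a i * η i y) * (a k * η k y)) ∂ν := by
      rw [integral_finsetSum]
      · refine Finset.sum_congr rfl fun i _ => ?_
        rw [integral_finsetSum]
        · refine Finset.sum_congr rfl fun k _ => ?_
          rw [← integral_const_mul, ← integral_const_mul]
          congr 1; ext y; ring
        · intro k _
          refine ((hηη i k).const_mul (β i k * (a i * a k))).congr ?_
          filter_upwards with y; ring
      · intro i _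
        refine integrable_finsetSum _ fun k _ => ?_
        refine ((hηη i k).const_mul (β i k * (a i * a k))).congr ?_
        filter_upwards with y; ring
    rw [this]
    exact integral_nonneg fun y => hβ fun i => a i * η i y
  · have h2 : Integrable (fun y : Euc d => y i ^ 2) ν := by
      refine Integrable.of_bound (by fun_prop) (D ^ 2) ?_
      filter_upwards [hν] with y h
      rw [Real.norm_eq_abs, abs_pow]
      exact pow_le_pow_left₀ (abs_nonneg _) (h i) 2
    have h1 : w i = ∫ y, y i ^ 2 ∂ν - m i ^ 2 := by
      have : ∀ y : Euc d, η i y * η i y = y i ^ 2 - 2 * m i * η i y - m i ^ 2 := fun y => by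
        simp only [hη]; ring
      simp only [hw]
      simp_rw [this]
      have h3 : Integrable (fun y : Euc d => y i ^ 2 - 2 * m i * η i y) ν :=
        h2.sub ((hηi i).const_mul _)
      rw [integral_sub h3 (integrable_const _),
        integral_sub h2 ((hηi i).const_mul _), integral_const_mul, hη0]
      simp
    change a i * a i * w i ≤ _
    rw [h1, div_eq_mul_inv, ← inv_pow]
    change a i * a i * _ ≤ _ * a i ^ 2
    nlinarith [sq_nonneg (m i), sq_nonneg (a i * m i)]
  -- The exponent difference is a constant `k0` plus the centred variable `ell + r`, where `ell` is
  -- linear in `δ`. The second-order lower bound is applied to `ell + r`; in its variance `ell²`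
  -- gives the `K` term, the cross term goes into `b`, and `r² ≥ 0` is dropped.
  · set ell : Euc d → ℝ := fun y => ∑ i, 2 * π * a i * δ i * η i y with hell
    have hellc : Continuous ell := by simp only [hell]; fun_prop
    have hell0 : ∫ y, ell y ∂ν = 0 := by
      simp only [hell]
      rw [integral_finsetSum _ fun i _ => (hηi i).const_mul _]
      simp [integral_const_mul, hη0]
    have hellD : ∀ᵐ y ∂ν, |ell y| ≤ 4 * π * A * D * d * ‖δ‖ := by
      filter_upwards [hηD] with y h
      have : |ell y| ≤ ∑ _i : Fin d, 2 * π * A * ‖δ‖ * (2 * D) := by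
        refine (Finset.abs_sum_le_sum_abs _ _).trans (Finset.sum_le_sum fun i _ => ?_)
        rw [abs_mul, abs_mul, abs_mul, abs_of_pos (by positivity : 0 < 2 * π), abs_of_pos (ha0 i)]
        have h1 : |δ i| ≤ ‖δ‖ := PiLp.norm_apply_le δ i
        have h2 := h i
        have h3 := haA i
        have h4 := (ha0 i).le
        gcongr
      simp only [Finset.sum_const, Finset.card_univ, Fintype.card_fin, nsmul_eq_mul] at this
      linarith
    have helli : Integrable ell ν := Integrable.of_bound hellc.aestronglyMeasurable _ hellD
    set k0 : ℝ := ∑ i, (-π * a i * ((x i + δ i + s * p i - m i) ^ 2 + w i)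
      + π * a' i * ((x i - m i) ^ 2 + w i)) with hk0
    have hg : ∀ y, heatExponent l t (x + δ + s • p) y - heatExponent l (t + s) x y =
        k0 + (ell y + r y) := fun y => by
      simp only [heatExponent, hk0, hell, hr, Finset.mul_sum, ← Finset.sum_sub_distrib,
        ← Finset.sum_add_distrib]
      refine Finset.sum_congr rfl fun i _ => ?_
      simp only [PiLp.add_apply, PiLp.smul_apply, smul_eq_mul, div_eq_mul_inv]
      change -π * ((x i + δ i + s * p i - y i) ^ 2 * a i) - -π * ((x i - y i) ^ 2 * a' i) = _
      have hy : y i = m i + η i y := by simp only [hη]; ring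
      rw [hy]
      have h1 := hsub i
      have h2 : a i = a' i + s * a i * a' i := by linarith
      have h3 := hpi i
      rw [h3]
      linear_combination π * (η i y * η i y - w i + 2 * (m i - x i) * η i y) * (-1) * h1
    have hY := half_integral_sq_sub_le_log_integral_exp (ν := ν) (Y := fun y => ell y + r y)
      (hellc.add hrc).aestronglyMeasurable
      (by rw [integral_add helli hri, hell0, hr0, add_zero])
      (a := 4 * π * A * D * d * ‖δ‖) (b := 8 * π * A ^ 2 * D ^ 2 * d * s)
      (by have := Real.pi_pos; positivity) (by have := Real.pi_pos; positivity)
      (by filter_upwards [hellD, hrD] with y h h' using (abs_add_le _ _).trans (add_le_add h h'))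
    have hrr : Integrable (fun y => r y ^ 2) ν := by
      refine Integrable.of_bound (hrc.pow 2).aestronglyMeasurable
        ((8 * π * A ^ 2 * D ^ 2 * d * s) ^ 2) ?_
      filter_upwards [hrD] with y h
      rw [Real.norm_eq_abs, abs_pow]
      exact pow_le_pow_left₀ (abs_nonneg _) h 2
    have hsq : ∑ i, ∑ k, 4 * π ^ 2 * (a i * a k * (∫ y, η i y * η k y ∂ν)) * (δ i * δ k)
        + 2 * ∑ i, 2 * π * a i * δ i * ∫ y, η i y * r y ∂ν ≤ ∫ y, (ell y + r y) ^ 2 ∂ν := by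
      have e1 : ∀ y, (ell y + r y) ^ 2 =
          (∑ i, ∑ k, 4 * π ^ 2 * (a i * a k) * (δ i * δ k) * (η i y * η k y)
          + 2 * ∑ i, 2 * π * a i * δ i * (η i y * r y)) + r y ^ 2 := fun y => by
        have : ell y ^ 2 = ∑ i, ∑ k, 4 * π ^ 2 * (a i * a k) * (δ i * δ k) * (η i y * η k y) := by
          simp only [hell, sq (∑ i, _), Finset.sum_mul_sum]
          refine Finset.sum_congr rfl fun i _ => Finset.sum_congr rfl fun k _ => by ring
        rw [← this]
        have : ∑ i, 2 * π * a i * δ i * (η i y * r y) = ell y * r y := by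
          simp only [hell, Finset.sum_mul]
          refine Finset.sum_congr rfl fun i _ => by ring
        rw [this]; ring
      have i1 : Integrable (fun y => ∑ i, ∑ k, 4 * π ^ 2 * (a i * a k) * (δ i * δ k) *
          (η i y * η k y)) ν :=
        integrable_finsetSum _ fun i _ => integrable_finsetSum _ fun k _ => (hηη i k).const_mul _
      have i2 : Integrable (fun y => 2 * ∑ i, 2 * π * a i * δ i * (η i y * r y)) ν :=
        (integrable_finsetSum _ fun i _ => (hηr i).const_mul _).const_mul _
      have i3 : Integrable (fun y => ∑ i, ∑ k, 4 * π ^ 2 * (a i * a k) * (δ i * δ k) *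
          (η i y * η k y) + 2 * ∑ i, 2 * π * a i * δ i * (η i y * r y)) ν := i1.add i2
      simp_rw [e1]
      rw [integral_add i3 hrr, integral_add i1 i2, integral_const_mul, integral_finsetSum _
        fun i _ => integrable_finsetSum _ fun k _ => (hηη i k).const_mul _, integral_finsetSum _
        fun i _ => (hηr i).const_mul _]
      simp_rw [integral_finsetSum Finset.univ fun k _ => (hηη _ k).const_mul _,
        integral_const_mul]
      have : 0 ≤ ∫ y, r y ^ 2 ∂ν := integral_nonneg fun y => sq_nonneg _
      refine le_trans (le_of_eq ?_) (le_add_of_nonneg_right this)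
      congr 1
      refine Finset.sum_congr rfl fun i _ => Finset.sum_congr rfl fun k _ => by ring
    have hpos : 0 < ∫ y, rexp (ell y + r y) ∂ν := by
      refine integral_exp_pos ?_
      refine Integrable.of_bound (Real.continuous_exp.comp (hellc.add hrc)).aestronglyMeasurable
        (rexp (4 * π * A * D * d * ‖δ‖ + 8 * π * A ^ 2 * D ^ 2 * d * s)) ?_
      filter_upwards [hellD, hrD] with y h h'
      rw [Real.norm_of_nonneg (Real.exp_pos _).le]
      exact Real.exp_le_exp.2 ((le_abs_self _).trans ((abs_add_le _ _).trans (add_le_add h h')))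
    have hlog : Real.log (∫ y, rexp (heatExponent l t (x + δ + s • p) y
          - heatExponent l (t + s) x y) ∂ν) = k0 + Real.log (∫ y, rexp (ell y + r y) ∂ν) := by
      simp_rw [hg, Real.exp_add k0, integral_const_mul]
      rw [Real.log_mul (Real.exp_pos _).ne' hpos.ne', Real.log_exp]
    rw [hlog]
    have hmain : π * s * ‖p‖ ^ 2 + ∑ i, (-2 * π * a i * (x i - m i) - 2 * π * a i * s * p i) * δ i
        - π * ∑ i, δ i ^ 2 / (l i + t) - π * s * ∑ i, a i * a i * w i
        - π * A * s ^ 2 * ‖p‖ ^ 2 ≤ k0 := by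
      rw [EuclideanSpace.real_norm_sq_eq]
      simp only [hk0, Finset.mul_sum, ← Finset.sum_sub_distrib, ← Finset.sum_add_distrib]
      refine Finset.sum_le_sum fun i _ => ?_
      have e : δ i ^ 2 / (l i + t) = δ i ^ 2 * a i := by rw [div_eq_mul_inv]
      rw [e]
      have h1 : 0 ≤ π * s * (a i - a' i) * a' i * (x i - m i) ^ 2 := by
        have := sub_nonneg.2 (haa i)
        have := ha0' i
        have := Real.pi_pos
        positivity
      have h2 : 0 ≤ π * s ^ 2 * (A - a i) * p i ^ 2 := by
        have := sub_nonneg.2 (haA i)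
        have := Real.pi_pos
        positivity
      have h3 : 0 ≤ π * s * a i * (a i - a' i) * w i := by
        have := sub_nonneg.2 (haa i)
        have := ha0 i
        have := Real.pi_pos
        have := hw0 i
        positivity
      have h4 := hpi i
      have h5 := hsub i
      have : (-π * a i * ((x i + δ i + s * p i - m i) ^ 2 + w i)
          + π * a' i * ((x i - m i) ^ 2 + w i)) -
          (π * s * p i ^ 2 + (-2 * π * a i * (x i - m i) - 2 * π * a i * s * p i) * δ i
            - π * (δ i ^ 2 * a i) - π * s * (a i * a i * w i) - π * A * s ^ 2 * p i ^ 2) =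
          π * s * (a i - a' i) * a' i * (x i - m i) ^ 2 + π * s ^ 2 * (A - a i) * p i ^ 2
            + π * s * a i * (a i - a' i) * w i := by
        rw [h4]
        linear_combination (-π * ((x i - m i) ^ 2 + w i)) * h5
      linarith
    have hb : ⟪WithLp.toLp 2 fun i => -2 * π * a i * (x i - m i) - 2 * π * a i * s * p i
        + 2 * π * a i * ∫ y, η i y * r y ∂ν, δ⟫ =
        ∑ i, (-2 * π * a i * (x i - m i) - 2 * π * a i * s * p i) * δ i +
          ∑ i, 2 * π * a i * δ i * ∫ y, η i y * r y ∂ν := by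
      rw [PiLp.inner_apply, ← Finset.sum_add_distrib]
      refine Finset.sum_congr rfl fun i _ => ?_
      simp only [RCLike.inner_apply, conj_trivial]
      ring
    have hK : 2 * π ^ 2 * ∑ i, ∑ k, a i * a k * (∫ y, η i y * η k y ∂ν) * (δ i * δ k) =
        (∑ i, ∑ k, 4 * π ^ 2 * (a i * a k * (∫ y, η i y * η k y ∂ν)) * (δ i * δ k)) / 2 := by
      simp only [Finset.mul_sum, Finset.sum_div]
      refine Finset.sum_congr rfl fun i _ => Finset.sum_congr rfl fun k _ => by ring
    rw [hb, hK]
    linarith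

theorem norm_le_sum_abs {d : ℕ} (p : Euc d) : ‖p‖ ≤ ∑ i, |p i| := by
  rw [EuclideanSpace.norm_eq]
  refine Real.sqrt_le_iff.2 ⟨Finset.sum_nonneg fun i _ => abs_nonneg _, ?_⟩
  simp only [Real.norm_eq_abs]
  exact Finset.sum_sq_le_sq_sum_of_nonneg fun i _ => abs_nonneg _

theorem one_add_sq_le (r : ℝ) : (1 + r) ^ 2 ≤ 2 * (1 + r ^ 2) := by nlinarith [sq_nonneg (1 - r)]

/-- The ratio of the potentials at times `t` and `t + s` is an exponential moment under the measure
tilted at time `t + s`, to which the previous expansion applies. The constant `C` may depend badly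
on `l`, since it only multiplies errors that vanish with the step size. The bound on `K i i` is kept
sharp: integrated over all `t ≥ 0` it gives `κ` in each direction, whatever `l` is. -/
theorem log_heatPotential_step {d : ℕ} {l : Fin d → ℝ} (hl : ∀ i, 0 < l i) {κ : ℝ}
    (μ : Measure (Euc d)) [IsFiniteMeasure μ] [NeZero μ]
    (hμ : ∀ᵐ y ∂μ, ∀ i, y i ^ 2 ≤ κ * l i) :
    ∃ C : ℝ, 0 ≤ C ∧ ∀ t s : ℝ, 0 ≤ t → 0 < s → ∀ x : Euc d,
      ∃ p b : Euc d, ∃ K : Fin d → Fin d → ℝ,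
      ‖p‖ ≤ C * (1 + ‖x‖) ∧
      (∀ β : Fin d → Fin d → ℝ, (∀ ξ : Fin d → ℝ, 0 ≤ ∑ i, ∑ k, β i k * (ξ i * ξ k)) →
        0 ≤ ∑ i, ∑ k, β i k * K i k) ∧
      (∀ i, K i i ≤ κ * l i / (l i + t) ^ 2) ∧
      ∀ δ : Euc d,
        Real.log (heatPotential l μ (t + s) x) + π * s * ‖p‖ ^ 2 + ⟪b, δ⟫
          - π * ∑ i, δ i ^ 2 / (l i + t) + 2 * π ^ 2 * ∑ i, ∑ k, K i k * (δ i * δ k)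
          - π * s * ∑ i, K i i - C * (‖δ‖ ^ 3 + s ^ 2 * (1 + ‖x‖ ^ 2)) ≤
        Real.log (heatPotential l μ t (x + δ + s • p)) := by
  obtain ⟨D, hD0, hD⟩ : ∃ D : ℝ, 0 ≤ D ∧ ∀ i, √(κ * l i) ≤ D :=
    ⟨∑ i, √(κ * l i), Finset.sum_nonneg fun i _ => Real.sqrt_nonneg _, fun i =>
      Finset.single_le_sum (f := fun i => √(κ * l i)) (fun i _ => Real.sqrt_nonneg _)
        (Finset.mem_univ i)⟩
  obtain ⟨A, hA0, hA⟩ : ∃ A : ℝ, 0 ≤ A ∧ ∀ i, (l i)⁻¹ ≤ A :=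
    ⟨∑ i, (l i)⁻¹, Finset.sum_nonneg fun i _ => (inv_pos.2 (hl i)).le, fun i =>
      Finset.single_le_sum (f := fun i => (l i)⁻¹) (fun i _ => (inv_pos.2 (hl i)).le)
        (Finset.mem_univ i)⟩
  have hpi := Real.pi_pos
  set P : ℝ := A * d * (1 + D) with hP
  have hP0 : 0 ≤ P := by positivity
  set C1 : ℝ := 4 * (4 * π * A * D * d) ^ 3 with hC1
  set C2 : ℝ := 4 * (8 * π * A ^ 2 * D ^ 2 * d) ^ 2 + 2 * π * A * P ^ 2 with hC2
  have hC10 : 0 ≤ C1 := by positivity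
  have hC20 : 0 ≤ C2 := by positivity
  refine ⟨P + C1 + C2, by positivity, fun t s ht hs x => ?_⟩
  have hts : 0 ≤ t + s := by linarith
  have hint := integrable_exp_heatExponent hl hts μ x
  have hprob : IsProbabilityMeasure (μ.tilted (heatExponent l (t + s) x)) :=
    isProbabilityMeasure_tilted hint
  have hac := tilted_absolutelyContinuous μ (heatExponent l (t + s) x)
  have hν : ∀ᵐ y ∂(μ.tilted (heatExponent l (t + s) x)), ∀ i, y i ^ 2 ≤ κ * l i := hac.ae_le hμ
  have hν' : ∀ᵐ y ∂(μ.tilted (heatExponent l (t + s) x)), ∀ i, |y i| ≤ D := by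
    filter_upwards [hν] with y h i
    exact (Real.abs_le_sqrt (h i)).trans (hD i)
  obtain ⟨p, b, K, hp, hK, hKd, hmain⟩ :=
    log_integral_exp_heatExponent_sub hl hD0 hA hA0 hν' ht hs x
  have hpn : ‖p‖ ≤ P * (1 + ‖x‖) := by
    refine (norm_le_sum_abs p).trans ?_
    calc ∑ i, |p i| ≤ ∑ _i : Fin d, A * (‖x‖ + D) := by
          refine Finset.sum_le_sum fun i _ => (hp i).trans ?_
          gcongr
          exact PiLp.norm_apply_le x i
      _ = d * (A * (‖x‖ + D)) := by simp
      _ ≤ d * (A * ((1 + D) * (1 + ‖x‖))) := by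
          gcongr
          nlinarith [norm_nonneg x]
      _ = _ := by rw [hP]; ring
  have hpn2 : ‖p‖ ^ 2 ≤ 2 * P ^ 2 * (1 + ‖x‖ ^ 2) := by
    calc ‖p‖ ^ 2 ≤ (P * (1 + ‖x‖)) ^ 2 := by gcongr
      _ = P ^ 2 * (1 + ‖x‖) ^ 2 := by ring
      _ ≤ P ^ 2 * (2 * (1 + ‖x‖ ^ 2)) := by gcongr; exact one_add_sq_le _
      _ = _ := by ring
  refine ⟨p, b, K, ?_, hK, fun i => (hKd i).trans ?_, fun δ => ?_⟩
  · refine hpn.trans ?_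
    gcongr
    linarith
  · gcongr
    calc ∫ y, y i ^ 2 ∂(μ.tilted (heatExponent l (t + s) x))
        ≤ ∫ _, κ * l i ∂(μ.tilted (heatExponent l (t + s) x)) := by
          refine integral_mono_of_nonneg (by filter_upwards with y using sq_nonneg _)
            (integrable_const _) ?_
          filter_upwards [hν] with y h using h i
      _ = κ * l i := by simp
  · have hv1 := heatPotential_pos hl hts μ x
    have hv2 := heatPotential_pos hl ht μ (x + δ + s • p)
    have hlog : Real.log (∫ y, rexp (heatExponent l t (x + δ + s • p) y
          - heatExponent l (t + s) x y) ∂(μ.tilted (heatExponent l (t + s) x))) =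
        Real.log (heatPotential l μ t (x + δ + s • p))
          - Real.log (heatPotential l μ (t + s) x) := by
      rw [integral_exp_tilted]
      simp only [Pi.add_apply, add_sub_cancel]
      exact Real.log_div hv2.ne' hv1.ne'
    have h := hmain δ
    rw [hlog] at h
    have e1 : 4 * ((4 * π * A * D * d * ‖δ‖) ^ 3 + (8 * π * A ^ 2 * D ^ 2 * d * s) ^ 2)
        + π * A * s ^ 2 * ‖p‖ ^ 2 ≤
        (P + C1 + C2) * (‖δ‖ ^ 3 + s ^ 2 * (1 + ‖x‖ ^ 2)) := by
      have h1 : π * A * s ^ 2 * ‖p‖ ^ 2 ≤ π * A * s ^ 2 * (2 * P ^ 2 * (1 + ‖x‖ ^ 2)) := by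
        gcongr
      have h2 : (4 * (8 * π * A ^ 2 * D ^ 2 * d) ^ 2) * s ^ 2 * 1 ≤
          (4 * (8 * π * A ^ 2 * D ^ 2 * d) ^ 2) * s ^ 2 * (1 + ‖x‖ ^ 2) := by
        gcongr
        nlinarith [sq_nonneg ‖x‖]
      have h3 : 0 ≤ (P + C2) * ‖δ‖ ^ 3 := by positivity
      have h4 : 0 ≤ (P + C1) * (s ^ 2 * (1 + ‖x‖ ^ 2)) := by positivity
      have e : (P + C1 + C2) * (‖δ‖ ^ 3 + s ^ 2 * (1 + ‖x‖ ^ 2)) =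
        C1 * ‖δ‖ ^ 3 + (P + C2) * ‖δ‖ ^ 3 + (P + C1) * (s ^ 2 * (1 + ‖x‖ ^ 2))
          + C2 * (s ^ 2 * (1 + ‖x‖ ^ 2)) := by ring
      have e5 : 4 * ((4 * π * A * D * d * ‖δ‖) ^ 3 + (8 * π * A ^ 2 * D ^ 2 * d * s) ^ 2) =
          C1 * ‖δ‖ ^ 3 + (4 * (8 * π * A ^ 2 * D ^ 2 * d) ^ 2) * s ^ 2 * 1 := by rw [hC1]; ring
      have e6 : C2 * (s ^ 2 * (1 + ‖x‖ ^ 2)) =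
          (4 * (8 * π * A ^ 2 * D ^ 2 * d) ^ 2) * s ^ 2 * (1 + ‖x‖ ^ 2)
            + π * A * s ^ 2 * (2 * P ^ 2 * (1 + ‖x‖ ^ 2)) := by rw [hC2]; ring
      rw [e, e5, e6]
      linarith only [h1, h2, h3, h4]
    linarith only [h, e1]

theorem adjoint_apply_coord {n d : ℕ} (U : Euc n →ₗ[ℝ] Euc d) (w : Euc n) (i : Fin d) :
    U w i = ⟪LinearMap.adjoint U (EuclideanSpace.single i 1), w⟫ := by
  rw [LinearMap.adjoint_inner_left, EuclideanSpace.inner_single_left]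
  simp

theorem adjoint_eq_sum {n d : ℕ} (U : Euc n →ₗ[ℝ] Euc d) (ξ : Fin d → ℝ) :
    LinearMap.adjoint U (WithLp.toLp 2 ξ) =
      ∑ i, ξ i • LinearMap.adjoint U (EuclideanSpace.single i 1) := by
  have : WithLp.toLp 2 ξ = ∑ i, ξ i • (EuclideanSpace.single i 1 : Euc d) := by
    ext k
    simp [Finset.sum_apply, Pi.single_apply]
  rw [this, map_sum]
  simp

/-! ### The one-step drift inequality for corrected log-potentials -/

/-- A one-step inequality for the evolution of a log-density `Φ` in the direction `U`: the drift
`p` gains the kinetic energy `c π s ‖p‖²`. -/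
def DriftStep {n d : ℕ} (c : ℝ) (U : Euc n →ₗ[ℝ] Euc d) (Φ : ℝ → Euc d → ℝ) : Prop :=
  ∃ C : ℝ, 0 ≤ C ∧ ∀ t s : ℝ, 0 ≤ t → 0 < s → s ≤ 1 → ∀ x : Euc d,
    ∃ p : Euc d, ∃ L : Euc n → ℝ, ‖p‖ ≤ C * (1 + ‖x‖) ∧ Integrable L (piGaussian n) ∧
      (∀ w, L w ≤ Φ t (x + √s • U w + s • p)) ∧
      Φ (t + s) x + c * π * s * ‖p‖ ^ 2 - C * (s * √s) * (1 + ‖x‖ ^ 2) ≤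
        ∫ w, L w ∂piGaussian n

/-- The normalising term which compensates the evolution of `log (heatPotential l μ t x)`. -/
def heatCorrection {n d : ℕ} (l : Fin d → ℝ) (c ε : ℝ) (U : Euc n →ₗ[ℝ] Euc d) (t : ℝ) : ℝ :=
  ∑ i, (c / 2 * ‖LinearMap.adjoint U (EuclideanSpace.single i 1)‖ ^ 2 * Real.log (l i + t)
    - ε * (l i / (l i + t)))

/-- The left side is `s` times the time derivative of the correction at `t`. The logarithm pays for
the concave part `-1 / (l_i + t)` of the Hessian, and the `ε` term for the defect `τ` in `U U^* ≥
1`. -/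
theorem heatCorrection_sub {n d : ℕ} {l : Fin d → ℝ} (hl : ∀ i, 0 < l i) {c ε : ℝ} (hc : 0 ≤ c)
    (hε : 0 ≤ ε) (U : Euc n →ₗ[ℝ] Euc d) :
    ∃ C : ℝ, 0 ≤ C ∧ ∀ t s : ℝ, 0 ≤ t → 0 < s →
      s / 2 * c * ∑ i, ‖LinearMap.adjoint U (EuclideanSpace.single i 1)‖ ^ 2 / (l i + t)
        + ε * s * ∑ i, l i / (l i + t) ^ 2 ≤
      heatCorrection l c ε U (t + s) - heatCorrection l c ε U t + C * s ^ 2 := by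
  set u : Fin d → ℝ := fun i => ‖LinearMap.adjoint U (EuclideanSpace.single i 1)‖ ^ 2 with hu
  have hu0 : ∀ i, 0 ≤ u i := fun i => sq_nonneg _
  refine ⟨∑ i, (c / 2 * u i * (l i)⁻¹ ^ 2 + ε * (l i)⁻¹ ^ 2),
    Finset.sum_nonneg fun i _ => by have := hu0 i; positivity, fun t s ht hs => ?_⟩
  simp only [heatCorrection, ← Finset.sum_sub_distrib, Finset.mul_sum, Finset.sum_mul,
    ← Finset.sum_add_distrib]
  refine Finset.sum_le_sum fun i _ => ?_
  have h0 := hl i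
  have hb : 0 < l i + t := by linarith
  have hb' : 0 < l i + (t + s) := by linarith
  have hainv : (l i + t)⁻¹ ≤ (l i)⁻¹ := inv_anti₀ h0 (by linarith)
  have hainv0 : 0 < (l i + t)⁻¹ := inv_pos.2 hb
  have h1 : s * (l i + t)⁻¹ - s ^ 2 * (l i)⁻¹ ^ 2 ≤ Real.log (l i + (t + s)) - Real.log (l i + t) := by
    rw [← Real.log_div hb'.ne' hb.ne']
    have : (l i + (t + s)) / (l i + t) = 1 + s * (l i + t)⁻¹ := by field_simp; ring
    rw [this]
    have hq : 0 ≤ s * (l i + t)⁻¹ := by positivity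
    refine le_trans ?_ (Real.le_log_one_add_of_nonneg hq)
    rw [le_div_iff₀ (by linarith)]
    set q := s * (l i + t)⁻¹ with hqd
    have : q ^ 2 ≤ s ^ 2 * (l i)⁻¹ ^ 2 := by
      rw [hqd, mul_pow]
      gcongr
    nlinarith
  have h2 : s * (l i / (l i + t) ^ 2) - s ^ 2 * (l i)⁻¹ ^ 2 ≤
      l i / (l i + t) - l i / (l i + (t + s)) := by
    have e : l i / (l i + t) - l i / (l i + (t + s)) =
        s * (l i / (l i + t) ^ 2) - s ^ 2 * ((l i + t)⁻¹ ^ 2 * (l i / (l i + (t + s)))) := by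
      field_simp
      ring
    rw [e]
    have : (l i + t)⁻¹ ^ 2 * (l i / (l i + (t + s))) ≤ (l i)⁻¹ ^ 2 * 1 := by
      gcongr
      rw [div_le_one hb']
      linarith
    nlinarith [sq_nonneg s]
  have h3 := mul_le_mul_of_nonneg_left h1 (show 0 ≤ c / 2 * u i by have := hu0 i; positivity)
  have h4 := mul_le_mul_of_nonneg_left h2 hε
  change s / 2 * c * (u i / (l i + t)) + _ ≤ c / 2 * u i * _ - _ - (c / 2 * u i * _ - _) + _
  rw [div_eq_mul_inv (u i)]
  linarith

/-- The spatial increment is `δ = √s U w`; averaging over `w` removes the linear term and turns the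
quadratic ones into traces. What remains beyond the correction is `π s (c tr(U U^* K) - c tr K)`, at
least `-π s τ tr K` by `hU`, and `tr K ≤ κ ∑ l_i / (l_i + t)²` matches the derivative of the `ε`
term with `ε = π τ κ`. -/
theorem driftStep_log_heatPotential {n d : ℕ} {l : Fin d → ℝ} (hl : ∀ i, 0 < l i) {κ : ℝ}
    (hκ : 0 ≤ κ) (μ : Measure (Euc d)) [IsFiniteMeasure μ] [NeZero μ]
    (hμ : ∀ᵐ y ∂μ, ∀ i, y i ^ 2 ≤ κ * l i) {c τ : ℝ} (hc : 0 < c) (hτ : 0 ≤ τ)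
    (U : Euc n →ₗ[ℝ] Euc d)
    (hU : ∀ x, (c - τ) * ‖x‖ ^ 2 ≤ c * ‖LinearMap.adjoint U x‖ ^ 2) :
    DriftStep c U fun t x =>
      c * Real.log (heatPotential l μ t x) - heatCorrection l c (π * τ * κ) U t := by
  have hpi := Real.pi_pos
  obtain ⟨C, hC, hstep⟩ := log_heatPotential_step hl μ hμ
  obtain ⟨C', hC', hcorr⟩ := heatCorrection_sub hl hc.le (ε := π * τ * κ) (by positivity) U
  set u : Fin d → Euc n := fun i => LinearMap.adjoint U (EuclideanSpace.single i 1) with hu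
  obtain ⟨N, hN0, hN⟩ : ∃ N : ℝ, 0 ≤ N ∧ ∀ w, ‖U w‖ ≤ N * ‖w‖ :=
    ⟨‖LinearMap.toContinuousLinearMap U‖, norm_nonneg _, fun w =>
      (LinearMap.toContinuousLinearMap U).le_opNorm w⟩
  set m3 : ℝ := ∫ w, ‖w‖ ^ 3 ∂piGaussian n with hm3
  have hm30 : 0 ≤ m3 := integral_nonneg fun w => by positivity
  refine ⟨C + c * C * (N ^ 3 * m3 + 1) + C', by positivity, fun t s ht hs hs1 x => ?_⟩
  obtain ⟨p, b, K, hp, hK, hKd, hmain⟩ := hstep t s ht hs x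
  have hss : √s * √s = s := Real.mul_self_sqrt hs.le
  have hs0 : 0 < √s := Real.sqrt_pos.2 hs
  set k0 : ℝ := c * (Real.log (heatPotential l μ (t + s) x) + π * s * ‖p‖ ^ 2
    - π * s * ∑ i, K i i - C * s ^ 2 * (1 + ‖x‖ ^ 2)) - heatCorrection l c (π * τ * κ) U t with hk0
  set L1 : Euc n → ℝ := fun w => c * √s * ⟪LinearMap.adjoint U b, w⟫ with hL1
  set L2 : Euc n → ℝ := fun w => ∑ i, c * π * s / (l i + t) * (⟪u i, w⟫ * ⟪u i, w⟫) with hL2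
  set L3 : Euc n → ℝ := fun w => ∑ i, ∑ k, 2 * c * π ^ 2 * s * K i k * (⟪u i, w⟫ * ⟪u k, w⟫)
    with hL3
  set L4 : Euc n → ℝ := fun w => c * C * (s * √s) * N ^ 3 * ‖w‖ ^ 3 with hL4
  have iL1 : Integrable L1 (piGaussian n) := (integrable_inner_piGaussian _).const_mul _
  have iL2 : Integrable L2 (piGaussian n) :=
    integrable_finsetSum _ fun i _ => (integrable_inner_mul_inner_piGaussian _ _).const_mul _
  have iL3' : ∀ i, Integrable (fun w => ∑ k, 2 * c * π ^ 2 * s * K i k * (⟪u i, w⟫ * ⟪u k, w⟫))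
      (piGaussian n) := fun i =>
    integrable_finsetSum _ fun k _ => (integrable_inner_mul_inner_piGaussian _ _).const_mul _
  have iL3 : Integrable L3 (piGaussian n) := integrable_finsetSum _ fun i _ => iL3' i
  have iL4 : Integrable L4 (piGaussian n) := (integrable_norm_pow_piGaussian n 3).const_mul _
  have i01 : Integrable (fun w => k0 + L1 w) (piGaussian n) := (integrable_const _).add iL1
  have i02 : Integrable (fun w => k0 + L1 w - L2 w) (piGaussian n) := i01.sub iL2
  have i03 : Integrable (fun w => k0 + L1 w - L2 w + L3 w) (piGaussian n) := i02.add iL3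
  have i04 : Integrable (fun w => k0 + L1 w - L2 w + L3 w - L4 w) (piGaussian n) := i03.sub iL4
  refine ⟨p, fun w => k0 + L1 w - L2 w + L3 w - L4 w, ?_, i04, fun w => ?_, ?_⟩
  · refine hp.trans ?_
    gcongr
    have : 0 ≤ c * C * (N ^ 3 * m3 + 1) := by positivity
    linarith
  · have h := mul_le_mul_of_nonneg_left (hmain (√s • U w)) hc.le
    have hco : ∀ i, (√s • U w) i = √s * ⟪u i, w⟫ := fun i => by
      rw [PiLp.smul_apply, smul_eq_mul, adjoint_apply_coord]
    have e2 : c * π * ∑ i, (√s • U w) i ^ 2 / (l i + t) = L2 w := by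
      rw [hL2, Finset.mul_sum]
      refine Finset.sum_congr rfl fun i _ => ?_
      rw [hco]
      linear_combination (c * π / (l i + t) * ⟪u i, w⟫ ^ 2) * hss
    have e3 : c * (2 * π ^ 2) * ∑ i, ∑ k, K i k * ((√s • U w) i * (√s • U w) k) = L3 w := by
      simp only [hL3, Finset.mul_sum]
      refine Finset.sum_congr rfl fun i _ => Finset.sum_congr rfl fun k _ => ?_
      rw [hco, hco]
      linear_combination (c * (2 * π ^ 2) * K i k * (⟪u i, w⟫ * ⟪u k, w⟫)) * hss
    have e1 : c * ⟪b, √s • U w⟫ = L1 w := by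
      rw [inner_smul_right, ← LinearMap.adjoint_inner_left]
      simp only [hL1]
      ring
    have e4 : c * C * ‖√s • U w‖ ^ 3 ≤ L4 w := by
      rw [norm_smul, Real.norm_of_nonneg hs0.le, mul_pow]
      have : √s ^ 3 = s * √s := by rw [pow_succ, sq, hss]
      rw [this]
      calc c * C * (s * √s * ‖U w‖ ^ 3) ≤ c * C * (s * √s * (N * ‖w‖) ^ 3) := by
            gcongr
            exact hN w
        _ = L4 w := by simp only [hL4]; ring
    linarith
  · have e1 : ∫ w, L1 w ∂piGaussian n = 0 := by
      rw [hL1, integral_const_mul, integral_inner_piGaussian, mul_zero]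
    have e2 : ∫ w, L2 w ∂piGaussian n = s / 2 * c * ∑ i, ‖u i‖ ^ 2 / (l i + t) := by
      simp only [hL2]
      rw [integral_finsetSum _ fun i _ => (integrable_inner_mul_inner_piGaussian _ _).const_mul _,
        Finset.mul_sum]
      refine Finset.sum_congr rfl fun i _ => ?_
      rw [integral_const_mul, integral_inner_mul_inner_piGaussian, real_inner_self_eq_norm_sq]
      field_simp
    have e3 : ∫ w, L3 w ∂piGaussian n = c * π * s * ∑ i, ∑ k, ⟪u i, u k⟫ * K i k := by
      simp only [hL3]
      rw [integral_finsetSum _ fun i _ => iL3' i, Finset.mul_sum]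
      refine Finset.sum_congr rfl fun i _ => ?_
      rw [integral_finsetSum _ fun k _ =>
        (integrable_inner_mul_inner_piGaussian _ _).const_mul _, Finset.mul_sum]
      refine Finset.sum_congr rfl fun k _ => ?_
      rw [integral_const_mul, integral_inner_mul_inner_piGaussian]
      field_simp
    have e4 : ∫ w, L4 w ∂piGaussian n = c * C * (s * √s) * N ^ 3 * m3 := by
      rw [hL4, integral_const_mul]
    -- Positivity of the pairing of `K` with the form `c U U^* - (c - τ)`, which is positive
    -- semidefinite by `hU`.
    have hpsd : (c - τ) * ∑ i, K i i ≤ c * ∑ i, ∑ k, ⟪u i, u k⟫ * K i k := by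
      have := hK (fun i k => c * ⟪u i, u k⟫ - (c - τ) * if i = k then 1 else 0) fun ξ => by
        have h1 := hU (WithLp.toLp 2 ξ)
        rw [adjoint_eq_sum, ← real_inner_self_eq_norm_sq (∑ i, _), sum_inner,
          EuclideanSpace.real_norm_sq_eq] at h1
        simp only [inner_sum, real_inner_smul_left, real_inner_smul_right] at h1
        simp only [sub_mul, Finset.sum_sub_distrib, mul_ite, ite_mul, mul_one, mul_zero, zero_mul,
          Finset.sum_ite_eq, Finset.mem_univ, if_true]
        rw [sub_nonneg]
        convert h1 using 1
        · rw [Finset.mul_sum, ← Finset.sum_sub_distrib]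
          exact Finset.sum_congr rfl fun i _ => by ring
        · simp only [Finset.mul_sum]
          exact Finset.sum_congr rfl fun i _ => Finset.sum_congr rfl fun k _ => by
            simp only [hu]; ring
      simp only [sub_mul, Finset.sum_sub_distrib, mul_ite, ite_mul, mul_one, mul_zero, zero_mul,
          Finset.sum_ite_eq, Finset.mem_univ, if_true, sub_nonneg] at this
      simp only [Finset.mul_sum, sub_mul, Finset.sum_sub_distrib]
      simp only [mul_assoc] at this ⊢
      exact this
    have hKs : ∑ i, K i i ≤ κ * ∑ i, l i / (l i + t) ^ 2 := by
      rw [Finset.mul_sum]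
      exact Finset.sum_le_sum fun i _ => (hKd i).trans_eq (by ring)
    have hco := hcorr t s ht hs
    rw [integral_sub i03 iL4, integral_add i02 iL3, integral_sub i01 iL2,
      integral_add (integrable_const _) iL1, e1, e2, e3, e4]
    simp only [integral_const, probReal_univ, one_smul, add_zero]
    have h5 := mul_le_mul_of_nonneg_left hpsd (show 0 ≤ π * s by positivity)
    have h6 := mul_le_mul_of_nonneg_left hKs (show 0 ≤ π * s * τ by positivity)
    have hs2 : s ^ 2 ≤ s * √s := by
      rw [sq]
      gcongr
      exact Real.le_sqrt_of_sq_le (by nlinarith)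
    have hx1 : 1 ≤ 1 + ‖x‖ ^ 2 := by nlinarith [sq_nonneg ‖x‖]
    have hss0 : 0 ≤ s * √s := by positivity
    have h7 : c * (C * s ^ 2 * (1 + ‖x‖ ^ 2)) ≤ c * C * (s * √s) * (1 + ‖x‖ ^ 2) := by
      have : c * C * (1 + ‖x‖ ^ 2) * s ^ 2 ≤ c * C * (1 + ‖x‖ ^ 2) * (s * √s) := by gcongr
      linarith
    have h8 : C' * s ^ 2 ≤ C' * (s * √s) * (1 + ‖x‖ ^ 2) := by
      calc C' * s ^ 2 ≤ C' * (s * √s) * 1 := by rw [mul_one]; gcongr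
        _ ≤ _ := by gcongr
    have h9 : c * C * (s * √s) * N ^ 3 * m3 * 1 ≤ c * C * (s * √s) * N ^ 3 * m3 * (1 + ‖x‖ ^ 2) := by
      gcongr
    have h10 : 0 ≤ C * (s * √s) * (1 + ‖x‖ ^ 2) := by positivity
    rw [hk0]
    have e : (C + c * C * (N ^ 3 * m3 + 1) + C') * (s * √s) * (1 + ‖x‖ ^ 2) =
      C * (s * √s) * (1 + ‖x‖ ^ 2) + c * C * (s * √s) * N ^ 3 * m3 * (1 + ‖x‖ ^ 2)
        + c * C * (s * √s) * (1 + ‖x‖ ^ 2) + C' * (s * √s) * (1 + ‖x‖ ^ 2) := by ring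
    rw [e]
    simp only [hu] at *
    linarith

/-! ### Propagation of the sup-convolution condition by the heat flow -/

/-- For the inner product weighted by `c`, `w ↦ (U_j w)_j` is an isometry by `hU`, and the map here
is its adjoint, hence a contraction. It serves twice: to bound the cost of the combined drift, and
to check the sup-convolution condition for gaussians. -/
theorem norm_sq_sum_adjoint_le {m n : ℕ} {d : Fin m → ℕ} {c : Fin m → ℝ} (hc : ∀ j, 0 < c j)
    {U : ∀ j, Euc n →ₗ[ℝ] Euc (d j)}
    (hU : ∀ w, ∑ j, c j • LinearMap.adjoint (U j) (U j w) = w) (p : ∀ j, Euc (d j)) :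
    ‖∑ j, c j • LinearMap.adjoint (U j) (p j)‖ ^ 2 ≤ ∑ j, c j * ‖p j‖ ^ 2 := by
  set u := ∑ j, c j • LinearMap.adjoint (U j) (p j) with hu
  have h1 : ∑ j, c j * ⟪p j, U j u⟫ = ‖u‖ ^ 2 := by
    rw [← real_inner_self_eq_norm_sq]
    conv_rhs => rw [hu, sum_inner]
    refine Finset.sum_congr rfl fun j _ => ?_
    rw [real_inner_smul_left, LinearMap.adjoint_inner_left]
  have h2 : ∑ j, c j * ‖U j u‖ ^ 2 = ‖u‖ ^ 2 := by
    rw [← real_inner_self_eq_norm_sq u]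
    conv_rhs => rw [← hU u, sum_inner, hU u]
    refine Finset.sum_congr rfl fun j _ => ?_
    rw [real_inner_smul_left, LinearMap.adjoint_inner_left, real_inner_self_eq_norm_sq]
  have h3 : ∀ j, c j * (2 * ⟪p j, U j u⟫) ≤ c j * (‖p j‖ ^ 2 + ‖U j u‖ ^ 2) := fun j => by
    refine mul_le_mul_of_nonneg_left ?_ (hc j).le
    have := norm_sub_sq_real (p j) (U j u)
    nlinarith [sq_nonneg ‖p j - U j u‖]
  have h4 := Finset.sum_le_sum fun j (_ : j ∈ Finset.univ) => h3 j
  simp only [mul_add, Finset.sum_add_distrib] at h4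
  have h5 : ∑ j, c j * (2 * ⟪p j, U j u⟫) = 2 * ∑ j, c j * ⟪p j, U j u⟫ := by
    rw [Finset.mul_sum]
    exact Finset.sum_congr rfl fun j _ => by ring
  linarith

/-- Translate the noise by `√s u` with `u = ∑ c_j U_j^* p_j`, bound `F` below pointwise by
hypothesis, and apply Jensen. The cost `π s |u|²` is at most the kinetic gain `π s ∑ c_j |p_j|²`.
The quadratic weight `1 + ∑ |x_j|²` carries the errors because the drifts grow linearly in `x_j`. -/
theorem heat_step {m n : ℕ} {d : Fin m → ℕ} {c : Fin m → ℝ} (hc : ∀ j, 0 < c j)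
    {U : ∀ j, Euc n →ₗ[ℝ] Euc (d j)}
    (hU : ∀ w, ∑ j, c j • LinearMap.adjoint (U j) (U j w) = w) {Φ : ∀ j, ℝ → Euc (d j) → ℝ}
    (hΦ : ∀ j, DriftStep (c j) (U j) (Φ j)) :
    ∃ C : ℝ, 0 ≤ C ∧ ∀ t s ε : ℝ, 0 ≤ t → 0 < s → s ≤ 1 → 0 ≤ ε → ∀ F : Euc n → ℝ≥0∞,
      (∀ x : ∀ j, Euc (d j),
        ENNReal.ofReal (rexp (∑ j, Φ j t (x j) - ε * (1 + ∑ j, ‖x j‖ ^ 2))) ≤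
          F (∑ j, c j • LinearMap.adjoint (U j) (x j))) →
      ∀ x : ∀ j, Euc (d j),
        ENNReal.ofReal (rexp (∑ j, Φ j (t + s) (x j)
          - ((1 + C * s) * ε + C * (s * √s)) * (1 + ∑ j, ‖x j‖ ^ 2))) ≤
          heat s F (∑ j, c j • LinearMap.adjoint (U j) (x j)) := by
  have hpi := Real.pi_pos
  choose C hC hstep using hΦ
  have hN : ∀ j, ∃ N : ℝ, 0 ≤ N ∧ ∀ w, ‖U j w‖ ≤ N * ‖w‖ := fun j =>
    ⟨‖LinearMap.toContinuousLinearMap (U j)‖, norm_nonneg _, fun w =>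
      (LinearMap.toContinuousLinearMap (U j)).le_opNorm w⟩
  choose N hN0 hN using hN
  set m2 : ℝ := ∫ w, ‖w‖ ^ 2 ∂piGaussian n with hm2
  have hm20 : 0 ≤ m2 := integral_nonneg fun w => by positivity
  set S1 : ℝ := ∑ j, C j with hS1
  have hS1j : ∀ j, C j ≤ S1 := fun j =>
    Finset.single_le_sum (f := C) (fun j _ => hC j) (Finset.mem_univ j)
  have hS10 : 0 ≤ S1 := Finset.sum_nonneg fun j _ => hC j
  set S2 : ℝ := ∑ j, N j ^ 2 * m2 with hS2
  have hS20 : 0 ≤ S2 := Finset.sum_nonneg fun j _ => by positivity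
  refine ⟨(S1 + (1 + 4 * S1 ^ 2)) * (m + 1) + S2, by positivity,
    fun t s ε ht hs hs1 hε F hF x => ?_⟩
  have hs0 : 0 < √s := Real.sqrt_pos.2 hs
  have hss : √s * √s = s := Real.mul_self_sqrt hs.le
  choose p L hp hLi hL hLint using fun j => hstep j t s ht hs hs1 (x j)
  set u : Euc n := ∑ j, c j • LinearMap.adjoint (U j) (p j) with hu
  set V : ℝ := 1 + ∑ j, ‖x j‖ ^ 2 with hV
  have hV1 : 1 ≤ V := by
    have : 0 ≤ ∑ j, ‖x j‖ ^ 2 := Finset.sum_nonneg fun j _ => sq_nonneg _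
    linarith
  have hmV : ∑ j, (1 + ‖x j‖ ^ 2) ≤ (m + 1) * V := by
    rw [Finset.sum_add_distrib]
    simp only [Finset.sum_const, Finset.card_univ, Fintype.card_fin, nsmul_eq_mul, mul_one]
    have : (m : ℝ) * 1 ≤ m * V := by gcongr
    linarith
  set q : ∀ j, Euc (d j) := fun j => x j + s • p j with hq
  set φ : Euc n → ℝ := fun w => -2 * π * √s * ⟪u, w⟫ - π * s * ‖u‖ ^ 2 + ∑ j, L j w
    - ε * (1 + ∑ j, (‖q j‖ ^ 2 + 2 * √s * ⟪LinearMap.adjoint (U j) (q j), w⟫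
      + s * N j ^ 2 * ‖w‖ ^ 2)) with hφ
  have i1 : Integrable (fun w => -2 * π * √s * ⟪u, w⟫) (piGaussian n) :=
    (integrable_inner_piGaussian u).const_mul _
  have i2 : Integrable (fun w => -2 * π * √s * ⟪u, w⟫ - π * s * ‖u‖ ^ 2) (piGaussian n) :=
    i1.sub (integrable_const _)
  have i3 : Integrable (fun w => ∑ j, L j w) (piGaussian n) :=
    integrable_finsetSum _ fun j _ => hLi j
  have i4 : Integrable (fun w => -2 * π * √s * ⟪u, w⟫ - π * s * ‖u‖ ^ 2 + ∑ j, L j w)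
      (piGaussian n) := i2.add i3
  have i5' : ∀ j, Integrable (fun w => ‖q j‖ ^ 2
      + 2 * √s * ⟪LinearMap.adjoint (U j) (q j), w⟫) (piGaussian n) := fun j =>
    (integrable_const _).add ((integrable_inner_piGaussian _).const_mul _)
  have i5'' : ∀ j, Integrable (fun w => s * N j ^ 2 * ‖w‖ ^ 2) (piGaussian n) := fun j =>
    (integrable_norm_pow_piGaussian n 2).const_mul _
  have i5 : ∀ j, Integrable (fun w => ‖q j‖ ^ 2
      + 2 * √s * ⟪LinearMap.adjoint (U j) (q j), w⟫ + s * N j ^ 2 * ‖w‖ ^ 2) (piGaussian n) :=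
    fun j => (i5' j).add (i5'' j)
  have i6 : Integrable (fun w => ∑ j, (‖q j‖ ^ 2
      + 2 * √s * ⟪LinearMap.adjoint (U j) (q j), w⟫ + s * N j ^ 2 * ‖w‖ ^ 2)) (piGaussian n) :=
    integrable_finsetSum _ fun j _ => i5 j
  have i7 : Integrable (fun w => ε * (1 + ∑ j, (‖q j‖ ^ 2
      + 2 * √s * ⟪LinearMap.adjoint (U j) (q j), w⟫ + s * N j ^ 2 * ‖w‖ ^ 2))) (piGaussian n) :=
    ((integrable_const _).add i6).const_mul _
  have hφi : Integrable φ (piGaussian n) := i4.sub i7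
  have hφint : ∫ w, φ w ∂piGaussian n = -(π * s * ‖u‖ ^ 2) + ∑ j, ∫ w, L j w ∂piGaussian n
      - ε * (1 + ∑ j, (‖q j‖ ^ 2 + s * N j ^ 2 * m2)) := by
    simp only [hφ]
    rw [integral_sub i4 i7, integral_add i2 i3, integral_sub i1 (integrable_const _),
      integral_const_mul, integral_inner_piGaussian, integral_const_mul ε,
      integral_add (integrable_const _) i6, integral_finsetSum _ fun j _ => hLi j,
      integral_finsetSum _ fun j _ => i5 j]
    have : ∀ j, ∫ w, (‖q j‖ ^ 2 + 2 * √s * ⟪LinearMap.adjoint (U j) (q j), w⟫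
        + s * N j ^ 2 * ‖w‖ ^ 2) ∂piGaussian n = ‖q j‖ ^ 2 + s * N j ^ 2 * m2 := fun j => by
      rw [integral_add (i5' j) (i5'' j), integral_add (integrable_const _)
        ((integrable_inner_piGaussian _).const_mul _), integral_const_mul,
        integral_inner_piGaussian, integral_const_mul]
      simp [hm2]
    simp only [this]
    simp
  have hq2 : ∀ j, ‖q j‖ ^ 2 ≤ ‖x j‖ ^ 2 + s * ((1 + 4 * S1 ^ 2) * (1 + ‖x j‖ ^ 2)) := fun j => by
    have h1 : ‖q j‖ ≤ ‖x j‖ + s * ‖p j‖ := by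
      refine (norm_add_le _ _).trans_eq ?_
      rw [norm_smul, Real.norm_of_nonneg hs.le]
    have h2 : ‖p j‖ ≤ S1 * (1 + ‖x j‖) := (hp j).trans (by gcongr; exact hS1j j)
    have h3 : ‖p j‖ ^ 2 ≤ S1 ^ 2 * (2 * (1 + ‖x j‖ ^ 2)) := by
      calc ‖p j‖ ^ 2 ≤ (S1 * (1 + ‖x j‖)) ^ 2 := by gcongr
        _ = S1 ^ 2 * (1 + ‖x j‖) ^ 2 := by ring
        _ ≤ _ := by gcongr; exact one_add_sq_le _
    have h4 : s ^ 2 * ‖p j‖ ^ 2 ≤ s * ‖p j‖ ^ 2 := by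
      gcongr
      nlinarith
    have h5 : 2 * (‖x j‖ * ‖p j‖) ≤ ‖x j‖ ^ 2 + ‖p j‖ ^ 2 := by
      nlinarith [sq_nonneg (‖x j‖ - ‖p j‖)]
    calc ‖q j‖ ^ 2 ≤ (‖x j‖ + s * ‖p j‖) ^ 2 := by gcongr
      _ = ‖x j‖ ^ 2 + s * (2 * (‖x j‖ * ‖p j‖)) + s ^ 2 * ‖p j‖ ^ 2 := by ring
      _ ≤ ‖x j‖ ^ 2 + s * (‖x j‖ ^ 2 + ‖p j‖ ^ 2) + s * ‖p j‖ ^ 2 := by gcongr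
      _ = ‖x j‖ ^ 2 + s * (‖x j‖ ^ 2 + 2 * ‖p j‖ ^ 2) := by ring
      _ ≤ ‖x j‖ ^ 2 + s * (‖x j‖ ^ 2 + 2 * (S1 ^ 2 * (2 * (1 + ‖x j‖ ^ 2)))) := by gcongr
      _ ≤ _ := by
        gcongr
        linarith
  have hmain : ∑ j, Φ j (t + s) (x j)
      - ((1 + ((S1 + (1 + 4 * S1 ^ 2)) * (m + 1) + S2) * s) * ε
        + ((S1 + (1 + 4 * S1 ^ 2)) * (m + 1) + S2) * (s * √s)) * V ≤
      ∫ w, φ w ∂piGaussian n := by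
    rw [hφint]
    have h1 := norm_sq_sum_adjoint_le hc hU p
    have h2 : ∑ j, Φ j (t + s) (x j) + π * s * ∑ j, c j * ‖p j‖ ^ 2
        - S1 * (s * √s) * ∑ j, (1 + ‖x j‖ ^ 2) ≤ ∑ j, ∫ w, L j w ∂piGaussian n := by
      rw [Finset.mul_sum, Finset.mul_sum, ← Finset.sum_add_distrib, ← Finset.sum_sub_distrib]
      refine Finset.sum_le_sum fun j _ => le_trans ?_ (hLint j)
      have : C j * (s * √s) * (1 + ‖x j‖ ^ 2) ≤ S1 * (s * √s) * (1 + ‖x j‖ ^ 2) := by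
        gcongr
        exact hS1j j
      linarith
    have h3 : ∑ j, (‖q j‖ ^ 2 + s * N j ^ 2 * m2) ≤ ∑ j, ‖x j‖ ^ 2
        + s * ((1 + 4 * S1 ^ 2) * ∑ j, (1 + ‖x j‖ ^ 2)) + s * S2 := by
      rw [hS2, Finset.mul_sum, Finset.mul_sum, Finset.mul_sum, ← Finset.sum_add_distrib,
        ← Finset.sum_add_distrib]
      exact Finset.sum_le_sum fun j _ => by linarith [hq2 j]
    have h4 : S1 * (s * √s) * ∑ j, (1 + ‖x j‖ ^ 2) ≤ S1 * (s * √s) * ((m + 1) * V) := by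
      gcongr
    have h5 : s * ((1 + 4 * S1 ^ 2) * ∑ j, (1 + ‖x j‖ ^ 2)) ≤
        s * ((1 + 4 * S1 ^ 2) * ((m + 1) * V)) := by
      gcongr
    have h6 : s * S2 * 1 ≤ s * S2 * V := by gcongr
    have h7 : ε * (1 + ∑ j, (‖q j‖ ^ 2 + s * N j ^ 2 * m2)) ≤
        ε * (V + s * ((1 + 4 * S1 ^ 2) * ((m + 1) * V)) + s * S2 * V) :=
      mul_le_mul_of_nonneg_left (by linarith) hε
    have h8 : π * s * ‖u‖ ^ 2 ≤ π * s * ∑ j, c j * ‖p j‖ ^ 2 := by gcongr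
    have h9 : 0 ≤ S1 * (m + 1) * s * ε * V := by positivity
    have h10 : 0 ≤ ((1 + 4 * S1 ^ 2) * (m + 1) + S2) * (s * √s) * V := by positivity
    linarith only [h2, h4, h7, h8, h9, h10]
  refine (ENNReal.ofReal_le_ofReal (Real.exp_le_exp.2 hmain)).trans ?_
  refine (ofReal_exp_integral_le_lintegral hφi).trans ?_
  rw [heat, lintegral_piGaussian_translate (fun w => F (_ + √s • w)) (√s • u)]
  refine lintegral_mono fun w => ?_
  -- Writing `w = ∑ c_j U_j^* U_j w` distributes one noise on `ℝⁿ` among the inputs: the `j`-th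
  -- point moves by `√s U_j w + s p_j`.
  have hpt : ∑ j, c j • LinearMap.adjoint (U j) (x j) + √s • (w + √s • u) =
      ∑ j, c j • LinearMap.adjoint (U j) (x j + √s • U j w + s • p j) := by
    simp only [map_add, map_smul, smul_add, Finset.sum_add_distrib]
    rw [smul_smul, hss, hu, Finset.smul_sum, ← add_assoc]
    congr 1
    · congr 1
      conv_lhs => rw [← hU w, Finset.smul_sum]
      exact Finset.sum_congr rfl fun j _ => smul_comm _ _ _
    · exact Finset.sum_congr rfl fun j _ => smul_comm _ _ _
  beta_reduce
  rw [hpt]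
  refine le_trans ?_ (mul_le_mul_right (hF fun j => x j + √s • U j w + s • p j) _)
  rw [← ENNReal.ofReal_mul (Real.exp_pos _).le, ← Real.exp_add]
  refine ENNReal.ofReal_le_ofReal (Real.exp_le_exp.2 ?_)
  have h1 : ‖√s • u‖ ^ 2 = s * ‖u‖ ^ 2 := by
    rw [norm_smul, Real.norm_of_nonneg hs0.le, mul_pow, sq (√s), hss]
  have h2 : ∑ j, L j w ≤ ∑ j, Φ j t (x j + √s • U j w + s • p j) :=
    Finset.sum_le_sum fun j _ => hL j w
  have h3 : ∑ j, ‖x j + √s • U j w + s • p j‖ ^ 2 ≤ ∑ j, (‖q j‖ ^ 2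
      + 2 * √s * ⟪LinearMap.adjoint (U j) (q j), w⟫ + s * N j ^ 2 * ‖w‖ ^ 2) := by
    refine Finset.sum_le_sum fun j _ => ?_
    have e : x j + √s • U j w + s • p j = q j + √s • U j w := by simp only [hq]; abel
    rw [e, norm_add_sq_real, inner_smul_right, LinearMap.adjoint_inner_left, norm_smul, mul_pow,
      Real.norm_of_nonneg hs0.le, sq (√s), hss]
    have : s * ‖U j w‖ ^ 2 ≤ s * (N j * ‖w‖) ^ 2 := by
      gcongr
      exact hN j w
    linarith
  have h4 := mul_le_mul_of_nonneg_left h3 hε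
  rw [h1, real_inner_smul_left]
  simp only [hφ]
  linarith

/-- Borell-type principle: the sup-convolution inequality is propagated by the heat flow. -/
theorem le_heat_of_driftStep {m n : ℕ} {d : Fin m → ℕ} {c : Fin m → ℝ} (hc : ∀ j, 0 < c j)
    {U : ∀ j, Euc n →ₗ[ℝ] Euc (d j)}
    (hU : ∀ w, ∑ j, c j • LinearMap.adjoint (U j) (U j w) = w) {Φ : ∀ j, ℝ → Euc (d j) → ℝ}
    (hΦ : ∀ j, DriftStep (c j) (U j) (Φ j)) {F : Euc n → ℝ≥0∞} (hFm : Measurable F)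
    (hF : ∀ x : ∀ j, Euc (d j), ENNReal.ofReal (rexp (∑ j, Φ j 0 (x j))) ≤
      F (∑ j, c j • LinearMap.adjoint (U j) (x j))) {T : ℝ} (hT : 0 < T) (x : ∀ j, Euc (d j)) :
    ENNReal.ofReal (rexp (∑ j, Φ j T (x j))) ≤
      heat T F (∑ j, c j • LinearMap.adjoint (U j) (x j)) := by
  obtain ⟨C, hC, hstep⟩ := heat_step hc hU hΦ
  -- Discrete Grönwall: the error coefficients satisfy `ε_{k+1} = (1 + C s) ε_k + C s^{3/2}` with
  -- `ε_0 = 0`. With `s = T / K` and `k = K` the bound is `C T √(T/K) exp(C T)`, which tends to `0`.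
  have hiter : ∀ s : ℝ, 0 < s → s ≤ 1 → ∀ k : ℕ, ∀ x : ∀ j, Euc (d j),
      ENNReal.ofReal (rexp (∑ j, Φ j (k * s) (x j)
        - (C * k * (s * √s) * rexp (C * s * k)) * (1 + ∑ j, ‖x j‖ ^ 2))) ≤
      heat (k * s) F (∑ j, c j • LinearMap.adjoint (U j) (x j)) := by
    intro s hs hs1 k
    induction k with
    | zero =>
      intro x
      simpa [heat_zero] using hF x
    | succ k ih =>
      intro x
      have h := hstep (k * s) s (C * k * (s * √s) * rexp (C * s * k)) (by positivity) hs hs1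
        (by positivity) _ ih x
      rw [← heat_add hFm hs.le (by positivity)] at h
      have e : ((k + 1 : ℕ) : ℝ) * s = k * s + s := by push_cast; ring
      rw [e, add_comm (k * s) s]
      rw [add_comm (k * s) s] at h
      refine le_trans (ENNReal.ofReal_le_ofReal (Real.exp_le_exp.2 ?_)) h
      have hV : 0 ≤ 1 + ∑ j, ‖x j‖ ^ 2 :=
        add_nonneg zero_le_one (Finset.sum_nonneg fun j _ => sq_nonneg _)
      refine sub_le_sub_left (mul_le_mul_of_nonneg_right ?_ hV) _
      have e2 : rexp (C * s * ((k + 1 : ℕ) : ℝ)) = rexp (C * s) * rexp (C * s * k) := by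
        rw [← Real.exp_add]; congr 1; push_cast; ring
      rw [e2]
      push_cast
      have h1 : 1 + C * s ≤ rexp (C * s) := by linarith [Real.add_one_le_exp (C * s)]
      have h2 : 1 ≤ rexp (C * s) * rexp (C * s * k) := by
        rw [← Real.exp_add]
        exact Real.one_le_exp (by positivity)
      have h3 : (1 + C * s) * (C * k * (s * √s) * rexp (C * s * k)) ≤
          rexp (C * s) * (C * k * (s * √s) * rexp (C * s * k)) := by gcongr
      have h4 : C * (s * √s) * 1 ≤ C * (s * √s) * (rexp (C * s) * rexp (C * s * k)) := by gcongr
      linarith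
  have hlim : Tendsto (fun K : ℕ => ENNReal.ofReal (rexp (∑ j, Φ j T (x j)
      - (C * T * √(T / K) * rexp (C * T)) * (1 + ∑ j, ‖x j‖ ^ 2)))) atTop
      (𝓝 (ENNReal.ofReal (rexp (∑ j, Φ j T (x j)
      - (C * T * √0 * rexp (C * T)) * (1 + ∑ j, ‖x j‖ ^ 2))))) := by
    have h0 : Tendsto (fun K : ℕ => T / (K : ℝ)) atTop (𝓝 0) :=
      tendsto_const_div_atTop_nhds_zero_nat T
    refine ENNReal.tendsto_ofReal ((Real.continuous_exp.tendsto _).comp ?_)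
    exact (((((Real.continuous_sqrt.tendsto 0).comp h0).const_mul _).mul_const _).mul_const
      _).const_sub _
  simp only [Real.sqrt_zero, mul_zero, zero_mul, sub_zero] at hlim
  refine le_of_tendsto hlim ?_
  obtain ⟨K0, hK0⟩ := exists_nat_ge T
  filter_upwards [eventually_ge_atTop (max K0 1)] with K hK
  have hK1 : (1 : ℝ) ≤ K := by exact_mod_cast le_trans (le_max_right _ _) hK
  have hKT : T ≤ K := hK0.trans (by exact_mod_cast le_trans (le_max_left _ _) hK)
  have hKpos : (0 : ℝ) < K := by linarith
  have h := hiter (T / K) (by positivity) ((div_le_one hKpos).2 hKT) K x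
  have e : (K : ℝ) * (T / K) = T := by field_simp
  have e3 : C * (K : ℝ) * (T / K * √(T / K)) * rexp (C * (T / K) * K) =
      C * T * √(T / K) * rexp (C * T) := by
    have : C * (T / K) * K = C * T := by field_simp
    rw [this]
    field_simp
  rw [e3, e] at h
  exact h

/-! ### The inequality in normal position, by letting time tend to infinity -/

theorem DriftStep.add_const {n d : ℕ} {c : ℝ} {U : Euc n →ₗ[ℝ] Euc d} {Φ : ℝ → Euc d → ℝ}
    (h : DriftStep c U Φ) (k : ℝ) : DriftStep c U fun t x => Φ t x + k := by
  obtain ⟨C, hC, h⟩ := h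
  refine ⟨C, hC, fun t s ht hs hs1 x => ?_⟩
  obtain ⟨p, L, hp, hLi, hL, hint⟩ := h t s ht hs hs1 x
  refine ⟨p, fun w => L w + k, hp, hLi.add (integrable_const k),
    fun w => by linarith [hL w], ?_⟩
  rw [integral_add hLi (integrable_const k)]
  simp only [integral_const, probReal_univ, one_smul]
  linarith

theorem sum_norm_sq_adjoint_single {n d : ℕ} (U : Euc n →ₗ[ℝ] Euc d) :
    ∑ i, ‖LinearMap.adjoint U (EuclideanSpace.single i 1)‖ ^ 2 =
      ∑ k, ‖U (EuclideanSpace.single k 1)‖ ^ 2 := by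
  simp only [EuclideanSpace.real_norm_sq_eq]
  rw [Finset.sum_comm]
  refine Finset.sum_congr rfl fun k _ => Finset.sum_congr rfl fun i _ => ?_
  rw [adjoint_apply_coord U, real_inner_comm, EuclideanSpace.inner_single_left]
  simp

/-- The trace of `∑ c_j U_j U_j^*`, summed over `j`, equals that of `∑ c_j U_j^* U_j = 1`. It makes
the corrections grow like `(n/2) log T`, which the factor `T^{-n/2}` of the heat kernel cancels. -/
theorem sum_trace_eq {m n : ℕ} {d : Fin m → ℕ} {c : Fin m → ℝ}
    {U : ∀ j, Euc n →ₗ[ℝ] Euc (d j)}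
    (hU : ∀ w, ∑ j, c j • LinearMap.adjoint (U j) (U j w) = w) :
    ∑ j, ∑ i, c j * ‖LinearMap.adjoint (U j) (EuclideanSpace.single i 1)‖ ^ 2 = n := by
  simp_rw [← Finset.mul_sum, sum_norm_sq_adjoint_single, Finset.mul_sum]
  rw [Finset.sum_comm]
  have : ∀ k : Fin n, ∑ j, c j * ‖U j (EuclideanSpace.single k 1)‖ ^ 2 = 1 := fun k => by
    have h : ⟪∑ j, c j • LinearMap.adjoint (U j) (U j (EuclideanSpace.single k 1)),
        (EuclideanSpace.single k 1 : Euc n)⟫ = 1 := by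
      rw [hU, EuclideanSpace.inner_single_left]
      simp
    refine Eq.trans ?_ h
    rw [sum_inner]
    refine Finset.sum_congr rfl fun j _ => ?_
    rw [real_inner_smul_left, LinearMap.adjoint_inner_left, real_inner_self_eq_norm_sq]
  simp [this]

theorem log_heatPotential_zero_ge {d : ℕ} {l : Fin d → ℝ} (hl : ∀ i, 0 < l i)
    (hl1 : ∀ i, l i ≤ 1) {κ : ℝ} (hκ : 0 ≤ κ) (μ : Measure (Euc d)) [IsFiniteMeasure μ] [NeZero μ]
    (hμ : ∀ᵐ y ∂μ, ∀ i, y i ^ 2 ≤ κ * l i) {T : ℝ} (hT : 0 < T) :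
    Real.log (μ.real Set.univ) - π * κ * d / T ≤ Real.log (heatPotential l μ T 0) := by
  have hM : 0 < μ.real Set.univ := measureReal_univ_pos
  have hpi := Real.pi_pos
  have h1 : rexp (-(π * κ * d / T)) * μ.real Set.univ ≤ heatPotential l μ T 0 := by
    calc rexp (-(π * κ * d / T)) * μ.real Set.univ = ∫ _, rexp (-(π * κ * d / T)) ∂μ := by
          simp [mul_comm]
      _ ≤ heatPotential l μ T 0 := by
          refine integral_mono_ae (integrable_const _) (integrable_exp_heatExponent hl hT.le μ 0) ?_
          filter_upwards [hμ] with y hy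
          refine Real.exp_le_exp.2 ?_
          have : ∑ i, ((0 : Euc d) i - y i) ^ 2 / (l i + T) ≤ ∑ _i : Fin d, κ / T := by
            refine Finset.sum_le_sum fun i _ => ?_
            have h0 := hl i
            have h2 : ((0 : Euc d) i - y i) ^ 2 ≤ κ := by
              have := hy i
              have : κ * l i ≤ κ * 1 := by gcongr; exact hl1 i
              simp only [PiLp.zero_apply, zero_sub, neg_sq]
              linarith
            gcongr
            linarith
          simp only [Finset.sum_const, Finset.card_univ, Fintype.card_fin, nsmul_eq_mul] at this
          have h3 := mul_le_mul_of_nonneg_left this hpi.le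
          have e : π * κ * d / T = π * (d * (κ / T)) := by ring
          rw [heatExponent, e]
          linarith
  have h2 := Real.log_le_log (by positivity) h1
  rw [Real.log_mul (Real.exp_pos _).ne' hM.ne', Real.log_exp] at h2
  linarith

/-- The regularised Barthe inequality for data in normal position. -/
theorem barthe_of_normal_position {m n : ℕ} {d : Fin m → ℕ} {c : Fin m → ℝ} (hc : ∀ j, 0 < c j)
    {U : ∀ j, Euc n →ₗ[ℝ] Euc (d j)}
    (hU : ∀ w, ∑ j, c j • LinearMap.adjoint (U j) (U j w) = w)
    {l : ∀ j, Fin (d j) → ℝ} (hl : ∀ j i, 0 < l j i) (hl1 : ∀ j i, l j i ≤ 1)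
    {τ : ℝ} (hτ : 0 ≤ τ)
    (hUτ : ∀ j x, (c j - τ) * ‖x‖ ^ 2 ≤ c j * ‖LinearMap.adjoint (U j) x‖ ^ 2)
    (hUl : ∀ j i, l j i < 1 → ‖LinearMap.adjoint (U j) (EuclideanSpace.single i 1)‖ ^ 2 ≤ 1)
    {κ : ℝ} (hκ : 0 ≤ κ) (μ : ∀ j, Measure (Euc (d j))) [∀ j, IsFiniteMeasure (μ j)]
    [∀ j, NeZero (μ j)] (hμ : ∀ j, ∀ᵐ y ∂μ j, ∀ i, y i ^ 2 ≤ κ * l j i)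
    {F : Euc n → ℝ≥0∞} (hFm : Measurable F)
    (hF : ∀ x : ∀ j, Euc (d j), ENNReal.ofReal (rexp (∑ j,
      (c j * Real.log (heatPotential (l j) (μ j) 0 (x j)) - c j / 2 * ∑ i, Real.log (l j i)))) ≤
      F (∑ j, c j • LinearMap.adjoint (U j) (x j))) :
    ENNReal.ofReal (rexp (∑ j, c j * Real.log ((μ j).real Set.univ) - π * τ * κ * ∑ j, (d j : ℝ)))
      ≤ ∫⁻ z, F z := by
  have hpi := Real.pi_pos
  set u : ∀ j, Fin (d j) → ℝ := fun j i =>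
    ‖LinearMap.adjoint (U j) (EuclideanSpace.single i 1)‖ ^ 2 with hu
  have hu0 : ∀ j i, 0 ≤ u j i := fun j i => sq_nonneg _
  -- The constant that makes the time-zero hypothesis of `le_heat_of_driftStep` coincide with `hF`.
  set k : Fin m → ℝ := fun j => heatCorrection (l j) (c j) (π * τ * κ) (U j) 0
    - c j / 2 * ∑ i, Real.log (l j i) with hk
  have hdrift : ∀ j, DriftStep (c j) (U j) fun t x =>
      c j * Real.log (heatPotential (l j) (μ j) t x)
        - heatCorrection (l j) (c j) (π * τ * κ) (U j) t + k j := fun j =>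
    (driftStep_log_heatPotential (hl j) hκ (μ j) (hμ j) (hc j) hτ (U j) (hUτ j)).add_const (k j)
  have hheat : ∀ T : ℝ, 0 < T → ENNReal.ofReal (rexp (∑ j,
      (c j * Real.log (heatPotential (l j) (μ j) T 0)
        - heatCorrection (l j) (c j) (π * τ * κ) (U j) T + k j))) ≤
      ENNReal.ofReal ((√T ^ n)⁻¹) * ∫⁻ z, F z := fun T hT => by
    have h := le_heat_of_driftStep hc hU hdrift hFm (fun x => ?_) hT (fun j => 0)
    · simp only [map_zero, smul_zero, Finset.sum_const_zero] at h
      exact h.trans (heat_apply_zero_le F hT)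
    · refine le_trans (le_of_eq ?_) (hF x)
      congr 2
      refine Finset.sum_congr rfl fun j _ => ?_
      simp only [hk]
      ring
  have hk0 : ∀ j, -(π * τ * κ * d j) ≤ k j := fun j => by
    have : k j = ∑ i, (c j / 2 * ((u j i - 1) * Real.log (l j i)) - π * τ * κ) := by
      simp only [hk, heatCorrection, add_zero, Finset.mul_sum, ← Finset.sum_sub_distrib]
      refine Finset.sum_congr rfl fun i _ => ?_
      rw [div_self (hl j i).ne']
      simp only [hu]
      ring
    rw [this]
    calc -(π * τ * κ * d j) = ∑ _i : Fin (d j), -(π * τ * κ) := by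
          simp
          ring
      _ ≤ _ := by
          refine Finset.sum_le_sum fun i _ => ?_
          -- Here the second stationarity condition enters: either `l j i < 1`, so that both factors
          -- are nonpositive, or `l j i = 1` and the logarithm vanishes.
          have h1 : 0 ≤ (u j i - 1) * Real.log (l j i) := by
            rcases (hl1 j i).lt_or_eq with h | h
            · exact mul_nonneg_of_nonpos_of_nonpos (by linarith [hUl j i h])
                (Real.log_nonpos (hl j i).le h.le)
            · rw [h, Real.log_one, mul_zero]
          have := mul_nonneg (half_pos (hc j)).le h1
          linarith
  have hcT : ∀ T : ℝ, 0 < T → ∑ j, heatCorrection (l j) (c j) (π * τ * κ) (U j) T ≤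
      n / 2 * Real.log (1 + T) := fun T hT => by
    rw [← sum_trace_eq hU]
    rw [Finset.sum_div, Finset.sum_mul]
    refine Finset.sum_le_sum fun j _ => ?_
    rw [Finset.sum_div, Finset.sum_mul]
    refine Finset.sum_le_sum fun i _ => ?_
    have h0 := hl j i
    have h1 : Real.log (l j i + T) ≤ Real.log (1 + T) :=
      Real.log_le_log (by linarith) (by linarith [hl1 j i])
    have h2 : 0 ≤ π * τ * κ * (l j i / (l j i + T)) := by positivity
    have h3 := mul_le_mul_of_nonneg_left h1
      (show 0 ≤ c j / 2 * u j i by have := hu0 j i; have := hc j; positivity)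
    simp only [hu] at h3
    linarith
  -- All dependence on `T` is collected in terms of `T⁻¹` that vanish in the limit; the surviving
  -- loss `π τ κ ∑ d_j` comes from the `ε` part of the correction at time `0`.
  have hlow : ∀ T : ℝ, 0 < T → ENNReal.ofReal (rexp (∑ j, c j * Real.log ((μ j).real Set.univ)
      - π * τ * κ * ∑ j, (d j : ℝ) - (∑ j, c j * (π * κ * d j)) * T⁻¹
      - n / 2 * Real.log (1 + T⁻¹))) ≤ ∫⁻ z, F z := fun T hT => by
    have h1 := hheat T hT
    have hsq : 0 < √T ^ n := pow_pos (Real.sqrt_pos.2 hT) n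
    have h2 : ENNReal.ofReal (√T ^ n) * ENNReal.ofReal (rexp (∑ j,
      (c j * Real.log (heatPotential (l j) (μ j) T 0)
        - heatCorrection (l j) (c j) (π * τ * κ) (U j) T + k j))) ≤ ∫⁻ z, F z := by
      refine (mul_le_mul_right h1 _).trans_eq ?_
      rw [← mul_assoc, ← ENNReal.ofReal_mul hsq.le, mul_inv_cancel₀ hsq.ne', ENNReal.ofReal_one,
        one_mul]
    refine le_trans ?_ h2
    rw [← ENNReal.ofReal_mul hsq.le]
    refine ENNReal.ofReal_le_ofReal ?_
    have h3 : √T ^ n = rexp (n / 2 * Real.log T) := by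
      rw [← Real.exp_log hsq, Real.log_pow, Real.log_sqrt hT.le]
      congr 1
      ring
    rw [h3, ← Real.exp_add]
    refine Real.exp_le_exp.2 ?_
    have h4 : Real.log (1 + T⁻¹) = Real.log (1 + T) - Real.log T := by
      rw [← Real.log_div (by linarith) hT.ne']
      congr 1
      field_simp
      ring
    rw [h4, Finset.sum_add_distrib, Finset.sum_sub_distrib]
    have h5 := hcT T hT
    have h6 : -(π * τ * κ * ∑ j, (d j : ℝ)) ≤ ∑ j, k j := by
      rw [Finset.mul_sum, ← Finset.sum_neg_distrib]
      exact Finset.sum_le_sum fun j _ => hk0 j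
    have h7 : ∑ j, c j * Real.log ((μ j).real Set.univ) - (∑ j, c j * (π * κ * d j)) * T⁻¹ ≤
        ∑ j, c j * Real.log (heatPotential (l j) (μ j) T 0) := by
      rw [Finset.sum_mul, ← Finset.sum_sub_distrib]
      refine Finset.sum_le_sum fun j _ => ?_
      have := mul_le_mul_of_nonneg_left
        (log_heatPotential_zero_ge (hl j) (hl1 j) hκ (μ j) (hμ j) hT) (hc j).le
      rw [div_eq_mul_inv] at this
      linarith
    linarith
  have hlim : Tendsto (fun T : ℝ => ENNReal.ofReal (rexp (∑ j, c j * Real.log ((μ j).real Set.univ)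
      - π * τ * κ * ∑ j, (d j : ℝ) - (∑ j, c j * (π * κ * d j)) * T⁻¹
      - n / 2 * Real.log (1 + T⁻¹)))) atTop
      (𝓝 (ENNReal.ofReal (rexp (∑ j, c j * Real.log ((μ j).real Set.univ)
      - π * τ * κ * ∑ j, (d j : ℝ) - (∑ j, c j * (π * κ * d j)) * 0
      - n / 2 * Real.log (1 + 0))))) := by
    have h0 : Tendsto (fun T : ℝ => T⁻¹) atTop (𝓝 0) := tendsto_inv_atTop_zero
    refine ENNReal.tendsto_ofReal ((Real.continuous_exp.tendsto _).comp ?_)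
    refine ((h0.const_mul _).const_sub _).sub (Tendsto.const_mul _ ?_)
    exact (h0.const_add 1).log (by norm_num)
  simp only [mul_zero, add_zero, Real.log_one, sub_zero] at hlim
  refine le_of_tendsto hlim ?_
  filter_upwards [eventually_gt_atTop 0] with T hT using hlow T hT

/-! ### Positive operators as `N^* N`, and gaussian integrals -/

theorem det_adjoint {n : ℕ} (A : Euc n →ₗ[ℝ] Euc n) :
    LinearMap.det (LinearMap.adjoint A) = LinearMap.det A := by
  let b := EuclideanSpace.basisFun (Fin n) ℝ
  rw [← LinearMap.det_toMatrix b.toBasis, ← LinearMap.det_toMatrix b.toBasis A,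
    LinearMap.toMatrix_adjoint, Matrix.det_conjTranspose]
  simp

theorem adjoint_injective_of_surjective {n d : ℕ} {U : Euc n →ₗ[ℝ] Euc d}
    (hU : Function.Surjective U) : Function.Injective (LinearMap.adjoint U) := by
  rw [injective_iff_map_eq_zero]
  intro x hx
  obtain ⟨w, rfl⟩ := hU x
  rw [← inner_self_eq_zero (𝕜 := ℝ), ← LinearMap.adjoint_inner_right, hx, inner_zero_right]

/-- The adjoint of a linear automorphism, as a linear automorphism. -/
def adjointEquiv {n : ℕ} (N : Euc n ≃ₗ[ℝ] Euc n) : Euc n ≃ₗ[ℝ] Euc n :=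
  LinearEquiv.ofInjectiveEndo (LinearMap.adjoint (N : Euc n →ₗ[ℝ] Euc n))
    (adjoint_injective_of_surjective N.surjective)

theorem coe_adjointEquiv {n : ℕ} (N : Euc n ≃ₗ[ℝ] Euc n) :
    (adjointEquiv N : Euc n →ₗ[ℝ] Euc n) = LinearMap.adjoint (N : Euc n →ₗ[ℝ] Euc n) :=
  LinearMap.ext fun _ => rfl

theorem adjointEquiv_apply {n : ℕ} (N : Euc n ≃ₗ[ℝ] Euc n) (x : Euc n) :
    adjointEquiv N x = LinearMap.adjoint (N : Euc n →ₗ[ℝ] Euc n) x := by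
  rw [← coe_adjointEquiv]; rfl

/-- The positive operator `N^* N`. -/
def gram {n d : ℕ} (N : Euc n →ₗ[ℝ] Euc d) : Euc n →ₗ[ℝ] Euc n := LinearMap.adjoint N ∘ₗ N

theorem inner_gram {n d : ℕ} (N : Euc n →ₗ[ℝ] Euc d) (x y : Euc n) :
    ⟪x, gram N y⟫ = ⟪N x, N y⟫ := by
  rw [gram, LinearMap.comp_apply, LinearMap.adjoint_inner_right]

theorem inner_gram_self {n d : ℕ} (N : Euc n →ₗ[ℝ] Euc d) (x : Euc n) :
    ⟪x, gram N x⟫ = ‖N x‖ ^ 2 := by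
  rw [inner_gram, real_inner_self_eq_norm_sq]

theorem isSymmetric_gram {n d : ℕ} (N : Euc n →ₗ[ℝ] Euc d) : (gram N).IsSymmetric := fun x y => by
  rw [inner_gram, real_inner_comm, inner_gram, real_inner_comm]

theorem gram_mem_SPlus {n d : ℕ} {N : Euc n →ₗ[ℝ] Euc d} (hN : Function.Injective N) :
    gram N ∈ SPlus n := by
  refine ⟨isSymmetric_gram N, fun x hx => ?_⟩
  rw [inner_gram_self]
  have : N x ≠ 0 := fun h => hx (hN (by rw [h, map_zero]))
  positivity

theorem det_gram {n : ℕ} (N : Euc n →ₗ[ℝ] Euc n) :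
    LinearMap.det (gram N) = LinearMap.det N ^ 2 := by
  rw [gram, LinearMap.det_comp, det_adjoint, sq]

theorem eq_of_inner_eq {n : ℕ} {A B : Euc n →ₗ[ℝ] Euc n}
    (h : ∀ x y, ⟪x, A y⟫ = ⟪x, B y⟫) : A = B := by
  ext1 y
  exact ext_inner_left ℝ fun x => h x y

theorem SPlus.exists_eigenbasis {n : ℕ} {A : Euc n →ₗ[ℝ] Euc n} (hA : A ∈ SPlus n) :
    ∃ (b : OrthonormalBasis (Fin n) ℝ (Euc n)) (g : Fin n → ℝ), (∀ i, 0 < g i) ∧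
      (∀ i, A (b i) = g i • b i) ∧ LinearMap.det A = ∏ i, g i := by
  have hn : Module.finrank ℝ (Euc n) = n := by simp
  have h : ∀ i, A (hA.1.eigenvectorBasis hn i) =
      hA.1.eigenvalues hn i • hA.1.eigenvectorBasis hn i := fun i => by
    exact hA.1.apply_eigenvectorBasis hn i
  refine ⟨hA.1.eigenvectorBasis hn, hA.1.eigenvalues hn, fun i => ?_, h, ?_⟩
  · have h1 := hA.2 (hA.1.eigenvectorBasis hn i)
      (by rw [← norm_ne_zero_iff, OrthonormalBasis.norm_eq_one]; exact one_ne_zero)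
    rwa [h, inner_smul_right, real_inner_self_eq_norm_sq, OrthonormalBasis.norm_eq_one, one_pow,
      mul_one] at h1
  · simpa using hA.1.det_eq_prod_eigenvalues hn

theorem inner_apply_of_eigenbasis {n : ℕ} {A : Euc n →ₗ[ℝ] Euc n} (hA : A.IsSymmetric)
    {b : OrthonormalBasis (Fin n) ℝ (Euc n)} {g : Fin n → ℝ} (h : ∀ i, A (b i) = g i • b i)
    (x y : Euc n) : ⟪x, A y⟫ = ∑ i, g i * (⟪b i, x⟫ * ⟪b i, y⟫) := by
  rw [← b.sum_inner_mul_inner x (A y)]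
  refine Finset.sum_congr rfl fun i _ => ?_
  rw [← hA, h, real_inner_smul_left, real_inner_comm]
  ring

/-- `N` sends `x` to its eigenbasis coordinates scaled by the roots of the eigenvalues. It need not
be symmetric: only `N^* N` matters. -/
theorem SPlus.exists_gram {n : ℕ} {A : Euc n →ₗ[ℝ] Euc n} (hA : A ∈ SPlus n) :
    ∃ N : Euc n ≃ₗ[ℝ] Euc n, A = gram (N : Euc n →ₗ[ℝ] Euc n) := by
  obtain ⟨b, g, hg, hb, -⟩ := SPlus.exists_eigenbasis hA
  let N0 : Euc n →ₗ[ℝ] Euc n :=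
    { toFun := fun x => WithLp.toLp 2 fun i => √(g i) * ⟪b i, x⟫
      map_add' := fun x y => by ext i; simp [inner_add_right, mul_add]
      map_smul' := fun r x => by ext i; simp [inner_smul_right]; ring }
  have hN : ∀ x y, ⟪N0 x, N0 y⟫ = ⟪x, A y⟫ := fun x y => by
    rw [inner_apply_of_eigenbasis hA.1 hb, PiLp.inner_apply]
    refine Finset.sum_congr rfl fun i _ => ?_
    simp only [N0, LinearMap.coe_mk, AddHom.coe_mk, RCLike.inner_apply, conj_trivial]
    have := Real.mul_self_sqrt (hg i).le
    linear_combination (⟪b i, x⟫ * ⟪b i, y⟫) * this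
  have hinj : Function.Injective N0 := by
    rw [injective_iff_map_eq_zero]
    intro x hx
    by_contra h
    have := hA.2 x h
    rw [← hN, hx, inner_zero_left] at this
    exact lt_irrefl _ this
  refine ⟨LinearEquiv.ofInjectiveEndo N0 hinj, eq_of_inner_eq fun x y => ?_⟩
  rw [inner_gram]
  exact (hN x y).symm

theorem SPlus.det_pos {n : ℕ} {A : Euc n →ₗ[ℝ] Euc n} (hA : A ∈ SPlus n) :
    0 < LinearMap.det A := by
  obtain ⟨N, rfl⟩ := SPlus.exists_gram hA
  rw [det_gram]
  have : LinearMap.det (N : Euc n →ₗ[ℝ] Euc n) ≠ 0 := (LinearEquiv.isUnit_det' N).ne_zero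
  positivity

theorem gaussian_gram {n : ℕ} (N : Euc n →ₗ[ℝ] Euc n) (x : Euc n) :
    gaussian (gram N) x = ENNReal.ofReal (|LinearMap.det N| * rexp (-π * ‖N x‖ ^ 2)) := by
  rw [gaussian, det_gram, Real.sqrt_sq_eq_abs, inner_gram_self]

theorem lintegral_gaussian {n : ℕ} {A : Euc n →ₗ[ℝ] Euc n} (hA : A ∈ SPlus n) :
    ∫⁻ x, gaussian A x = 1 := by
  obtain ⟨N, rfl⟩ := SPlus.exists_gram hA
  have hdet : LinearMap.det (N : Euc n →ₗ[ℝ] Euc n) ≠ 0 := (LinearEquiv.isUnit_det' N).ne_zero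
  have h1 : ∫⁻ w : Euc n, ENNReal.ofReal (rexp (-π * ‖w‖ ^ 2)) = 1 := by
    have := lintegral_piGaussian (n := n) fun _ => 1
    simpa using this.symm
  simp_rw [gaussian_gram, ENNReal.ofReal_mul (abs_nonneg _)]
  rw [lintegral_const_mul _ (by
    refine ENNReal.measurable_ofReal.comp (Real.measurable_exp.comp (Measurable.const_mul ?_ _))
    exact ((LinearMap.continuous_of_finiteDimensional (N : Euc n →ₗ[ℝ] Euc n)).norm.pow 2).measurable)]
  have := lintegral_comp_linear (fun w : Euc n => ENNReal.ofReal (rexp (-π * ‖w‖ ^ 2))) N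
  rw [h1, mul_one] at this
  simp only [LinearEquiv.coe_coe]
  rw [this, ← ENNReal.ofReal_mul (abs_nonneg _), ← abs_mul, mul_inv_cancel₀ hdet, abs_one,
    ENNReal.ofReal_one]

theorem continuous_gaussian {n : ℕ} (A : Euc n →ₗ[ℝ] Euc n) : Continuous (gaussian A) := by
  have := LinearMap.continuous_of_finiteDimensional A
  unfold gaussian
  exact ENNReal.continuous_ofReal.comp (by fun_prop)

theorem measurable_gaussian_sub {n : ℕ} (A : Euc n →ₗ[ℝ] Euc n) :
    Measurable fun z : Euc n × Euc n => gaussian A (z.1 - z.2) :=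
  ((continuous_gaussian A).comp (continuous_fst.sub continuous_snd)).measurable

theorem lintegral_gaussian_conv {n : ℕ} {A : Euc n →ₗ[ℝ] Euc n} (hA : A ∈ SPlus n)
    (μ : Measure (Euc n)) [SFinite μ] :
    ∫⁻ x, ∫⁻ y, gaussian A (x - y) ∂μ = μ Set.univ := by
  rw [lintegral_lintegral_swap (measurable_gaussian_sub A).aemeasurable]
  have : ∀ y, ∫⁻ x, gaussian A (x - y) = 1 := fun y => by
    rw [lintegral_sub_right_eq_self (gaussian A) y, lintegral_gaussian hA]
  simp [this]

/-! ### The regularised constant is at most the gaussian one -/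

/-- The convolving measure is the gaussian with inverse covariance `G (G - A)⁻¹ G - G = (A⁻¹ -
G⁻¹)⁻¹`. Strict positivity of `G - A` is what gives it a density; the identity `hid` is the
completion of the square in `y`. -/
theorem gaussian_mem_typeClass {n : ℕ} {A G : Euc n →ₗ[ℝ] Euc n} (hA : A ∈ SPlus n)
    (hG : G ∈ SPlus n) (hAG : G - A ∈ SPlus n) : gaussian A ∈ typeClass G := by
  have hpi := Real.pi_pos
  obtain ⟨N, hN⟩ := SPlus.exists_gram hAG
  have hDinj : Function.Injective (G - A) := by
    rw [injective_iff_map_eq_zero]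
    intro x hx
    by_contra h
    have := hAG.2 x h
    rw [hx, inner_zero_right] at this
    exact lt_irrefl _ this
  have hGinj : Function.Injective G := by
    rw [injective_iff_map_eq_zero]
    intro x hx
    by_contra h
    have := hG.2 x h
    rw [hx, inner_zero_right] at this
    exact lt_irrefl _ this
  set E : Euc n ≃ₗ[ℝ] Euc n := (LinearEquiv.ofInjectiveEndo G hGinj).trans
    (LinearEquiv.ofInjectiveEndo (G - A) hDinj).symm with hE
  have hDE : ∀ y, (G - A) (E y) = G y := fun y => by
    have := (LinearEquiv.ofInjectiveEndo (G - A) hDinj).apply_symm_apply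
      (LinearEquiv.ofInjectiveEndo G hGinj y)
    exact this
  -- With `E = (G - A)⁻¹ G` and `N^* N = G - A`, this gives `W^* W = G (G - A)⁻¹ G`.
  set W : Euc n ≃ₗ[ℝ] Euc n := E.trans N with hW
  have hWd : LinearMap.det (W : Euc n →ₗ[ℝ] Euc n) ≠ 0 := (LinearEquiv.isUnit_det' W).ne_zero
  have hid : ∀ x y, ⟪x - y, G (x - y)⟫ + (‖W y‖ ^ 2 - ⟪y, G y⟫) =
      ⟪x, A x⟫ + ‖W (E.symm x - y)‖ ^ 2 := fun x y => by
    have e1 : ∀ v, ‖N v‖ ^ 2 = ⟪v, (G - A) v⟫ := fun v => by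
      rw [hN, inner_gram_self]; rfl
    have e2 : W (E.symm x - y) = N (x - E y) := by simp [hW]
    have e3 : W y = N (E y) := rfl
    have e4 : ⟪y, G x⟫ = ⟪x, G y⟫ := by rw [← hG.1, real_inner_comm]
    have e5 : ⟪E y, (G - A) x⟫ = ⟪x, G y⟫ := by
      rw [← hAG.1, hDE, real_inner_comm]
    rw [e2, e3, e1, e1, map_sub, map_sub, hDE, inner_sub_left, inner_sub_left, inner_sub_right,
      inner_sub_right, inner_sub_right, inner_sub_right, e4, e5, LinearMap.sub_apply,
      inner_sub_right]
    ring
  have hdA : 0 < √(LinearMap.det A) := Real.sqrt_pos.2 (SPlus.det_pos hA)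
  have hdG : 0 < √(LinearMap.det G) := Real.sqrt_pos.2 (SPlus.det_pos hG)
  set k : ℝ := √(LinearMap.det A) / √(LinearMap.det G) * |LinearMap.det (W : Euc n →ₗ[ℝ] Euc n)|
    with hk
  have hk0 : 0 ≤ k := by positivity
  have hGc := LinearMap.continuous_of_finiteDimensional G
  have hWc := LinearMap.continuous_of_finiteDimensional (W : Euc n →ₗ[ℝ] Euc n)
  simp only [LinearEquiv.coe_coe] at hWc
  have hdens : Measurable fun y : Euc n =>
      ENNReal.ofReal (k * rexp (-π * (‖W y‖ ^ 2 - ⟪y, G y⟫))) := by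
    refine ENNReal.measurable_ofReal.comp (Continuous.measurable ?_)
    fun_prop
  set μ : Measure (Euc n) := volume.withDensity fun y =>
    ENNReal.ofReal (k * rexp (-π * (‖W y‖ ^ 2 - ⟪y, G y⟫))) with hμ
  have hconv : ∀ x, gaussian A x = ∫⁻ y, gaussian G (x - y) ∂μ := fun x => by
    rw [hμ, lintegral_withDensity_eq_lintegral_mul_non_measurable _ hdens
      (by filter_upwards with y using ENNReal.ofReal_lt_top)]
    have : ∀ y, ENNReal.ofReal (k * rexp (-π * (‖W y‖ ^ 2 - ⟪y, G y⟫))) * gaussian G (x - y) =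
        ENNReal.ofReal (√(LinearMap.det A) * rexp (-π * ⟪x, A x⟫)) *
          gaussian (gram (W : Euc n →ₗ[ℝ] Euc n)) (E.symm x - y) := fun y => by
      rw [gaussian_gram, gaussian, ← ENNReal.ofReal_mul (by positivity),
        ← ENNReal.ofReal_mul (by positivity)]
      congr 1
      have e := congrArg (fun r => rexp (-π * r)) (hid x y)
      simp only [mul_add, Real.exp_add] at e
      simp only [LinearEquiv.coe_coe]
      calc k * rexp (-π * (‖W y‖ ^ 2 - ⟪y, G y⟫))
            * (√(LinearMap.det G) * rexp (-π * ⟪x - y, G (x - y)⟫))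
          = k * √(LinearMap.det G) * (rexp (-π * ⟪x - y, G (x - y)⟫)
            * rexp (-π * (‖W y‖ ^ 2 - ⟪y, G y⟫))) := by ring
        _ = √(LinearMap.det A) * |LinearMap.det (W : Euc n →ₗ[ℝ] Euc n)| *
            (rexp (-π * ⟪x, A x⟫) * rexp (-π * ‖W (E.symm x - y)‖ ^ 2)) := by
          rw [e, hk]
          field_simp
        _ = _ := by ring
    simp only [Pi.mul_apply, this]
    have hm : Measurable fun y => gaussian (gram (W : Euc n →ₗ[ℝ] Euc n)) (E.symm x - y) :=
      (continuous_gaussian _).measurable.comp (by fun_prop)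
    rw [lintegral_const_mul _ hm,
      lintegral_sub_left_eq_self (gaussian (gram (W : Euc n →ₗ[ℝ] Euc n))),
      lintegral_gaussian (gram_mem_SPlus W.injective), mul_one, gaussian]
  have hmass : μ Set.univ = 1 := by
    rw [← lintegral_gaussian_conv hG μ, ← lintegral_gaussian hA]
    exact lintegral_congr fun x => (hconv x).symm
  exact ⟨μ, ⟨by rw [hmass]; exact ENNReal.one_lt_top⟩, fun h => by simp [h] at hmass, hconv⟩

theorem SPlus.smul {n : ℕ} {A : Euc n →ₗ[ℝ] Euc n} (hA : A ∈ SPlus n) {r : ℝ} (hr : 0 < r) :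
    r • A ∈ SPlus n := by
  refine ⟨fun x y => ?_, fun x hx => ?_⟩
  · simp only [LinearMap.smul_apply, real_inner_smul_left, real_inner_smul_right]
    rw [hA.1 x y]
  · simp only [LinearMap.smul_apply, real_inner_smul_right]
    exact mul_pos hr (hA.2 x hx)

theorem SPlus.sub_smul_mem {n : ℕ} {A G : Euc n →ₗ[ℝ] Euc n} (hA : A ∈ SPlus n)
    (hG : G ∈ SPlus n) (hAG : (G - A).IsPositive) {r : ℝ} (hr1 : r < 1) :
    G - r • A ∈ SPlus n := by
  refine ⟨fun x y => ?_, fun x hx => ?_⟩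
  · simp only [LinearMap.sub_apply, LinearMap.smul_apply, inner_sub_left, inner_sub_right,
      real_inner_smul_left, real_inner_smul_right]
    rw [hA.1 x y, hG.1 x y]
  · have h1 := hAG.2 x
    have h2 := hA.2 x hx
    simp only [LinearMap.sub_apply, inner_sub_left, RCLike.re_to_real] at h1
    rw [real_inner_comm, real_inner_comm x (A x)] at h1
    simp only [LinearMap.sub_apply, LinearMap.smul_apply, inner_sub_right, real_inner_smul_right]
    nlinarith

theorem gaussian_smul {n : ℕ} (A : Euc n →ₗ[ℝ] Euc n) {r : ℝ} (hr : 0 < r) (x : Euc n) :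
    gaussian (r • A) x = ENNReal.ofReal (√r ^ n) * gaussian A (√r • x) := by
  have hpow : √(r ^ n) = √r ^ n := by
    rw [← Real.sqrt_sq (pow_nonneg (Real.sqrt_nonneg r) n), ← pow_mul, mul_comm n 2, pow_mul,
      Real.sq_sqrt hr.le]
  rw [gaussian, gaussian, ← ENNReal.ofReal_mul (by positivity), LinearMap.det_smul]
  simp only [LinearMap.smul_apply, map_smul, real_inner_smul_left, real_inner_smul_right]
  rw [← mul_assoc √r √r, Real.mul_self_sqrt hr.le, Real.sqrt_mul (by positivity), finrank_euclideanSpace,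
    Fintype.card_fin, hpow, mul_assoc]

/-- An input with `A_j ≤ G_j` may lie on the boundary, where `g_{A_j} = g_{G_j} * μ` would force `μ`
to be singular. Dilating all functions by `√r` replaces `A_j` with `r A_j < G_j` and changes the
functional by a factor tending to `1` as `r ↑ 1`. -/
theorem regularizedBartheConst_le_gaussianBartheConst {m n : ℕ} {d : Fin m → ℕ}
    (B : ∀ j, EuclideanSpace ℝ (Fin n) →ₗ[ℝ] EuclideanSpace ℝ (Fin (d j))) {c : Fin m → ℝ}
    (hc : ∀ j, 0 < c j)
    {G : ∀ j, EuclideanSpace ℝ (Fin (d j)) →ₗ[ℝ] EuclideanSpace ℝ (Fin (d j))}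
    (hG : ∀ j, G j ∈ SPlus (d j)) :
    regularizedBartheConst B c G ≤ gaussianBartheConst B c G := by
  refine le_sInf ?_
  rintro _ ⟨A, Astar, α, hA, hAs, hα, hcond, rfl⟩
  have hint1 : ∀ j, ∫⁻ x, gaussian (A j) x = 1 := fun j => lintegral_gaussian (hA j).1
  have hval : bartheFunctional c (fun j => gaussian (A j))
      (fun z => ENNReal.ofReal α * gaussian Astar z) = ENNReal.ofReal α := by
    rw [bartheFunctional, lintegral_const_mul _ (continuous_gaussian _).measurable,
      lintegral_gaussian hAs]
    simp [hint1]
  rw [hval]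
  have key : ∀ r : ℝ, 0 < r → r < 1 → regularizedBartheConst B c G ≤
      (∏ j, ENNReal.ofReal (√r ^ d j) ^ c j) * ENNReal.ofReal ((√r ^ n)⁻¹) * ENNReal.ofReal α := by
    intro r hr hr1
    have hsr : 0 < √r := Real.sqrt_pos.2 hr
    have hint2 : ∀ j, ∫⁻ x, gaussian (r • A j) x = 1 := fun j =>
      lintegral_gaussian (SPlus.smul (hA j).1 hr)
    have hprod : (∏ j, ENNReal.ofReal (√r ^ d j) ^ c j) ≠ ∞ := by
      refine ENNReal.prod_ne_top fun j _ => ENNReal.rpow_ne_top_of_nonneg (hc j).le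
        ENNReal.ofReal_ne_top
    have hint : ∫⁻ z, (∏ j, ENNReal.ofReal (√r ^ d j) ^ c j) *
        (ENNReal.ofReal α * gaussian Astar (√r • z)) =
        (∏ j, ENNReal.ofReal (√r ^ d j) ^ c j) * ENNReal.ofReal ((√r ^ n)⁻¹)
          * ENNReal.ofReal α := by
      have hm : Measurable fun z : Euc n => gaussian Astar (√r • z) :=
        (continuous_gaussian Astar).measurable.comp (measurable_const_smul _)
      rw [lintegral_const_mul _ (hm.const_mul _), lintegral_const_mul _ hm,
        lintegral_comp_smul (gaussian Astar) hsr, lintegral_gaussian hAs]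
      ring
    refine sInf_le ⟨fun j => gaussian (r • A j), fun z =>
      (∏ j, ENNReal.ofReal (√r ^ d j) ^ c j) * (ENNReal.ofReal α * gaussian Astar (√r • z)),
      fun j => gaussian_mem_typeClass (SPlus.smul (hA j).1 hr) (hG j)
        (SPlus.sub_smul_mem (hA j).1 (hG j) (hA j).2 hr1), ⟨?_, ?_⟩, fun x => ?_, ?_⟩
    · exact ((((continuous_gaussian Astar).measurable.comp
        (measurable_const_smul _)).const_mul _).const_mul _).aemeasurable
    · rw [hint]
      exact (ENNReal.mul_ne_top (ENNReal.mul_ne_top hprod ENNReal.ofReal_ne_top)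
        ENNReal.ofReal_ne_top).lt_top
    · have h := hcond fun j => √r • x j
      simp only [map_smul] at h
      have e : ∑ j, c j • √r • LinearMap.adjoint (B j) (x j) =
          √r • ∑ j, c j • LinearMap.adjoint (B j) (x j) := by
        rw [Finset.smul_sum]
        exact Finset.sum_congr rfl fun j _ => smul_comm _ _ _
      rw [e] at h
      simp only [gaussian_smul _ hr, ENNReal.mul_rpow_of_nonneg _ _ (hc _).le,
        Finset.prod_mul_distrib]
      exact mul_le_mul_right h _
    · rw [bartheFunctional, hint]
      simp [hint2]
  have hlim : Tendsto (fun r : ℝ => (∏ j, ENNReal.ofReal (√r ^ d j) ^ c j)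
      * ENNReal.ofReal ((√r ^ n)⁻¹) * ENNReal.ofReal α) (𝓝[<] 1) (𝓝 ((1 : ℝ≥0∞) * 1
      * ENNReal.ofReal α)) := by
    have hs : Tendsto (fun r : ℝ => √r) (𝓝[<] 1) (𝓝 1) := by
      have := Real.continuous_sqrt.tendsto 1
      rw [Real.sqrt_one] at this
      exact this.mono_left nhdsWithin_le_nhds
    refine ENNReal.Tendsto.mul_const (ENNReal.Tendsto.mul ?_ (by simp) ?_ (by simp)) (by simp)
    · have : (1 : ℝ≥0∞) = ∏ j : Fin m, 1 := by simp
      rw [this]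
      refine ENNReal.tendsto_finsetProd_of_ne_top _ (fun j _ => ?_) (by simp)
      have h1 := ENNReal.tendsto_ofReal (hs.pow (d j))
      rw [one_pow, ENNReal.ofReal_one] at h1
      have h2 := ((ENNReal.continuous_rpow_const (y := c j)).tendsto 1).comp h1
      rwa [ENNReal.one_rpow] at h2
    · have h1 := ENNReal.tendsto_ofReal ((hs.pow n).inv₀ (by simp))
      rwa [one_pow, inv_one, ENNReal.ofReal_one] at h1
  rw [one_mul, one_mul] at hlim
  refine ge_of_tendsto hlim ?_
  filter_upwards [Ioo_mem_nhdsLT (show (0 : ℝ) < 1 by norm_num)] with r hr using key r hr.1 hr.2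

/-! ### Gaussian inputs parametrised by `Q`, and normal position -/

/-- The operator `∑ c_j B_j^* Q_j Q_j^* B_j`. -/
def blOperator {m n : ℕ} {d : Fin m → ℕ} (B : ∀ j, Euc n →ₗ[ℝ] Euc (d j)) (c : Fin m → ℝ)
    (Q : ∀ j, Euc (d j) →ₗ[ℝ] Euc (d j)) : Euc n →ₗ[ℝ] Euc n :=
  ∑ j, c j • gram (LinearMap.adjoint (Q j) ∘ₗ B j)

theorem inner_blOperator {m n : ℕ} {d : Fin m → ℕ} (B : ∀ j, Euc n →ₗ[ℝ] Euc (d j))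
    (c : Fin m → ℝ) (Q : ∀ j, Euc (d j) →ₗ[ℝ] Euc (d j)) (x y : Euc n) :
    ⟪x, blOperator B c Q y⟫ =
      ∑ j, c j * ⟪LinearMap.adjoint (Q j) (B j x), LinearMap.adjoint (Q j) (B j y)⟫ := by
  rw [blOperator, LinearMap.sum_apply, inner_sum]
  refine Finset.sum_congr rfl fun j _ => ?_
  rw [LinearMap.smul_apply, real_inner_smul_right, inner_gram]
  rfl

theorem blOperator_mem_SPlus {m n : ℕ} {d : Fin m → ℕ} {B : ∀ j, Euc n →ₗ[ℝ] Euc (d j)}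
    {c : Fin m → ℝ} (hBc : NondegenerateDatum B c) {Q : ∀ j, Euc (d j) →ₗ[ℝ] Euc (d j)}
    (hQ : ∀ j, Function.Surjective (Q j)) : blOperator B c Q ∈ SPlus n := by
  refine ⟨fun x y => ?_, fun x hx => ?_⟩
  · rw [inner_blOperator, real_inner_comm, inner_blOperator]
    exact Finset.sum_congr rfl fun j _ => by rw [real_inner_comm]
  · rw [inner_blOperator]
    have h0 : ∀ j, 0 ≤ c j * ⟪LinearMap.adjoint (Q j) (B j x),
        LinearMap.adjoint (Q j) (B j x)⟫ := fun j =>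
      mul_nonneg (hBc.exponent_pos j).le real_inner_self_nonneg
    refine (Finset.sum_nonneg fun j _ => h0 j).lt_of_ne' fun h => hx ?_
    rw [Finset.sum_eq_zero_iff_of_nonneg fun j _ => h0 j] at h
    have hker : x ∈ ⨅ j, LinearMap.ker (B j) := by
      rw [Submodule.mem_iInf]
      intro j
      have h1 := h j (Finset.mem_univ j)
      rw [mul_eq_zero, inner_self_eq_zero] at h1
      have h2 := h1.resolve_left (hBc.exponent_pos j).ne'
      exact adjoint_injective_of_surjective (hQ j) (by rw [h2, map_zero])
    rw [hBc.ker_inf] at hker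
    exact (Submodule.mem_bot ℝ).1 hker

/-- The datum in normal position determined by `Q` and a square root `N` of `blOperator B c Q`. -/
def normalMap {m n : ℕ} {d : Fin m → ℕ} (B : ∀ j, Euc n →ₗ[ℝ] Euc (d j))
    (Q : ∀ j, Euc (d j) →ₗ[ℝ] Euc (d j)) (N : Euc n ≃ₗ[ℝ] Euc n) (j : Fin m) :
    Euc n →ₗ[ℝ] Euc (d j) :=
  LinearMap.adjoint (Q j) ∘ₗ B j ∘ₗ (N.symm : Euc n →ₗ[ℝ] Euc n)

/-- That is, `N^* U_j^* = B_j^* Q_j`: substituting `x_j = Q_j y_j` in the inputs corresponds to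
substituting `N^*` in `f_*`. -/
theorem adjoint_normalMap {m n : ℕ} {d : Fin m → ℕ} (B : ∀ j, Euc n →ₗ[ℝ] Euc (d j))
    (Q : ∀ j, Euc (d j) →ₗ[ℝ] Euc (d j)) (N : Euc n ≃ₗ[ℝ] Euc n) (j : Fin m) (y : Euc (d j)) :
    LinearMap.adjoint (N : Euc n →ₗ[ℝ] Euc n) (LinearMap.adjoint (normalMap B Q N j) y) =
      LinearMap.adjoint (B j) (Q j y) := by
  refine ext_inner_left ℝ fun x => ?_
  rw [LinearMap.adjoint_inner_right, LinearMap.adjoint_inner_right, LinearMap.adjoint_inner_right]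
  simp only [normalMap, LinearMap.comp_apply, LinearEquiv.coe_coe, LinearEquiv.symm_apply_apply]
  rw [LinearMap.adjoint_inner_left]

theorem sum_adjoint_normalMap {m n : ℕ} {d : Fin m → ℕ} {B : ∀ j, Euc n →ₗ[ℝ] Euc (d j)}
    {c : Fin m → ℝ} {Q : ∀ j, Euc (d j) →ₗ[ℝ] Euc (d j)} {N : Euc n ≃ₗ[ℝ] Euc n}
    (hN : blOperator B c Q = gram (N : Euc n →ₗ[ℝ] Euc n)) (w : Euc n) :
    ∑ j, c j • LinearMap.adjoint (normalMap B Q N j) (normalMap B Q N j w) = w := by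
  refine ext_inner_left ℝ fun x => ?_
  obtain ⟨x, rfl⟩ := N.surjective x
  obtain ⟨w, rfl⟩ := N.surjective w
  have h := inner_gram (N : Euc n →ₗ[ℝ] Euc n) x w
  rw [← hN, inner_blOperator] at h
  simp only [LinearEquiv.coe_coe] at h
  rw [← h, inner_sum]
  refine Finset.sum_congr rfl fun j _ => ?_
  rw [real_inner_smul_right, LinearMap.adjoint_inner_right]
  simp [normalMap]

/-- The value of the Barthe functional at the gaussian input given by `A_j = (Q_j Q_j^*)⁻¹`. -/
def gaussianValue {m n : ℕ} {d : Fin m → ℕ} (B : ∀ j, Euc n →ₗ[ℝ] Euc (d j)) (c : Fin m → ℝ)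
    (Q : ∀ j, Euc (d j) →ₗ[ℝ] Euc (d j)) : ℝ :=
  √(LinearMap.det (blOperator B c Q)) * ∏ j, |LinearMap.det (Q j)| ^ (-c j)

/-- The input `A_j = (Q_j Q_j^*)⁻¹`, `A_* = (N^* N)⁻¹`, with `α` equal to the gaussian value, is
feasible. In normal position its sup-convolution condition is the contraction
`norm_sq_sum_adjoint_le`. -/
theorem gaussianBartheConst_le_gaussianValue {m n : ℕ} {d : Fin m → ℕ}
    {B : ∀ j, Euc n →ₗ[ℝ] Euc (d j)} {c : Fin m → ℝ} (hBc : NondegenerateDatum B c)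
    {G : ∀ j, Euc (d j) →ₗ[ℝ] Euc (d j)} (hG : ∀ j, G j ∈ SPlus (d j))
    (Q : ∀ j, Euc (d j) ≃ₗ[ℝ] Euc (d j)) (hQ : ∀ j x, ‖x‖ ^ 2 ≤ ⟪Q j x, G j (Q j x)⟫) :
    gaussianBartheConst B c G ≤
      ENNReal.ofReal (gaussianValue B c fun j => (Q j : Euc (d j) →ₗ[ℝ] Euc (d j))) := by
  have hc := hBc.exponent_pos
  obtain ⟨N, hN⟩ := SPlus.exists_gram (blOperator_mem_SPlus hBc
    (Q := fun j => (Q j : Euc (d j) →ₗ[ℝ] Euc (d j))) fun j => (Q j).surjective)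
  have hU := sum_adjoint_normalMap hN
  set U := normalMap B (fun j => (Q j : Euc (d j) →ₗ[ℝ] Euc (d j))) N with hUd
  set K : Euc n ≃ₗ[ℝ] Euc n := (adjointEquiv N).symm with hK
  have hdN : LinearMap.det (N : Euc n →ₗ[ℝ] Euc n) ≠ 0 := (LinearEquiv.isUnit_det' N).ne_zero
  have hdQ : ∀ j, LinearMap.det (Q j : Euc (d j) →ₗ[ℝ] Euc (d j)) ≠ 0 := fun j =>
    (LinearEquiv.isUnit_det' (Q j)).ne_zero
  have hdK : LinearMap.det (K : Euc n →ₗ[ℝ] Euc n) =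
      (LinearMap.det (N : Euc n →ₗ[ℝ] Euc n))⁻¹ := by
    have := LinearEquiv.det_symm_mul_det (adjointEquiv N)
    rw [coe_adjointEquiv, det_adjoint] at this
    exact eq_inv_of_mul_eq_one_left this
  have hdQs : ∀ j, LinearMap.det ((Q j).symm : Euc (d j) →ₗ[ℝ] Euc (d j)) =
      (LinearMap.det (Q j : Euc (d j) →ₗ[ℝ] Euc (d j)))⁻¹ := fun j =>
    eq_inv_of_mul_eq_one_left (LinearEquiv.det_symm_mul_det (Q j))
  set v : ℝ := gaussianValue B c fun j => (Q j : Euc (d j) →ₗ[ℝ] Euc (d j)) with hv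
  have hv' : v = |LinearMap.det (N : Euc n →ₗ[ℝ] Euc n)|
      * ∏ j, |LinearMap.det (Q j : Euc (d j) →ₗ[ℝ] Euc (d j))| ^ (-c j) := by
    rw [hv, gaussianValue, hN, det_gram, Real.sqrt_sq_eq_abs]
  have hv0 : 0 < v := by
    rw [hv']
    exact mul_pos (abs_pos.2 hdN)
      (Finset.prod_pos fun j _ => Real.rpow_pos_of_pos (abs_pos.2 (hdQ j)) _)
  set A : ∀ j, Euc (d j) →ₗ[ℝ] Euc (d j) := fun j =>
    gram ((Q j).symm : Euc (d j) →ₗ[ℝ] Euc (d j)) with hA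
  have hAS : ∀ j, A j ∈ SPlus (d j) := fun j => gram_mem_SPlus (Q j).symm.injective
  have hAs : gram (K : Euc n →ₗ[ℝ] Euc n) ∈ SPlus n := gram_mem_SPlus K.injective
  refine sInf_le ⟨A, gram (K : Euc n →ₗ[ℝ] Euc n), v, fun j => ⟨hAS j, ?_, fun x => ?_⟩, hAs, hv0,
    fun x => ?_, ?_⟩
  · exact (hG j).1.sub (hAS j).1
  · rw [RCLike.re_to_real, real_inner_comm, LinearMap.sub_apply, inner_sub_right, inner_gram_self]
    have := hQ j ((Q j).symm x)
    rw [LinearEquiv.apply_symm_apply] at this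
    simpa using this
  · set y : ∀ j, Euc (d j) := fun j => (Q j).symm (x j) with hy
    have hKz : K (∑ j, c j • LinearMap.adjoint (B j) (x j)) =
        ∑ j, c j • LinearMap.adjoint (U j) (y j) := by
      rw [hK, LinearEquiv.symm_apply_eq, adjointEquiv_apply, map_sum]
      refine Finset.sum_congr rfl fun j _ => ?_
      rw [map_smul, hUd, adjoint_normalMap]
      simp [hy]
    have hle := norm_sq_sum_adjoint_le hc hU y
    rw [← hKz] at hle
    have hL : ∀ j, gaussian (A j) (x j) ^ c j =
        ENNReal.ofReal (|LinearMap.det (Q j : Euc (d j) →ₗ[ℝ] Euc (d j))| ^ (-c j)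
          * rexp (-π * (c j * ‖y j‖ ^ 2))) := fun j => by
      rw [hA, gaussian_gram, ENNReal.ofReal_rpow_of_nonneg (by positivity) (hc j).le,
        Real.mul_rpow (abs_nonneg _) (Real.exp_pos _).le, hdQs, abs_inv,
        Real.inv_rpow (abs_nonneg _), Real.rpow_neg (abs_nonneg _), ← Real.exp_mul]
      congr 3
      simp only [hy, LinearEquiv.coe_coe]
      ring
    simp only [hL]
    rw [← ENNReal.ofReal_prod_of_nonneg fun j _ => by positivity, gaussian_gram,
      ← ENNReal.ofReal_mul hv0.le]
    refine ENNReal.ofReal_le_ofReal ?_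
    have e : v * |LinearMap.det (N : Euc n →ₗ[ℝ] Euc n)|⁻¹ =
        ∏ j, |LinearMap.det (Q j : Euc (d j) →ₗ[ℝ] Euc (d j))| ^ (-c j) := by
      rw [hv', mul_right_comm, mul_inv_cancel₀ (abs_pos.2 hdN).ne', one_mul]
    rw [Finset.prod_mul_distrib, ← Real.exp_sum, ← mul_assoc, hdK, abs_inv, e]
    refine mul_le_mul_of_nonneg_left (Real.exp_le_exp.2 ?_)
      (Finset.prod_nonneg fun j _ => by positivity)
    rw [← Finset.mul_sum]
    simp only [LinearEquiv.coe_coe]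
    nlinarith [Real.pi_pos]
  · rw [bartheFunctional, lintegral_const_mul _ (continuous_gaussian _).measurable,
      lintegral_gaussian hAs]
    simp [lintegral_gaussian (hAS _)]

/-! ### Rank-one perturbations and first-order conditions -/

/-- The map `1 + ε x xᵀ`. -/
def shear {n : ℕ} (x : Euc n) (ε : ℝ) : Euc n →ₗ[ℝ] Euc n :=
  LinearMap.transvection (innerₛₗ ℝ x) (ε • x)

theorem shear_apply {n : ℕ} (x : Euc n) (ε : ℝ) (y : Euc n) :
    shear x ε y = y + (ε * ⟪x, y⟫) • x := by
  rw [shear, LinearMap.transvection.apply, innerₛₗ_apply_apply, smul_smul, mul_comm]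

theorem inner_shear_left {n : ℕ} (x : Euc n) (ε : ℝ) (y z : Euc n) :
    ⟪shear x ε y, z⟫ = ⟪y, shear x ε z⟫ := by
  rw [shear_apply, shear_apply, inner_add_left, inner_add_right, real_inner_smul_left,
    real_inner_smul_right, real_inner_comm x y]
  ring

theorem adjoint_shear {n : ℕ} (x : Euc n) (ε : ℝ) :
    LinearMap.adjoint (shear x ε) = shear x ε := by
  refine eq_of_inner_eq fun y z => ?_
  rw [LinearMap.adjoint_inner_right, inner_shear_left]

/-- The quotient by `‖x‖ ^ 2` is meant to be `0` for `x = 0`, so the formula also covers the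
components left unperturbed. -/
theorem inner_shear_shear {n : ℕ} (x : Euc n) (ε : ℝ) (y z : Euc n) :
    ⟪shear x ε y, shear x ε z⟫ =
      ⟪y, z⟫ + ((1 + ε * ‖x‖ ^ 2) ^ 2 - 1) / ‖x‖ ^ 2 * (⟪y, x⟫ * ⟪x, z⟫) := by
  rcases eq_or_ne x 0 with rfl | hx
  · simp [shear_apply]
  have hx : ‖x‖ ≠ 0 := norm_ne_zero_iff.2 hx
  rw [shear_apply, shear_apply, inner_add_left, inner_add_right, inner_add_right,
    real_inner_smul_left, real_inner_smul_left, real_inner_smul_right, real_inner_smul_right,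
    real_inner_self_eq_norm_sq, real_inner_comm x y]
  field_simp
  ring

theorem det_shear {n : ℕ} (x : Euc n) (ε : ℝ) :
    LinearMap.det (shear x ε) = 1 + ε * ‖x‖ ^ 2 := by
  rw [shear, LinearMap.transvection.det, innerₛₗ_apply_apply, real_inner_smul_right,
    real_inner_self_eq_norm_sq]

/-- The square of the Hilbert–Schmidt norm. -/
def hilbertSchmidtSq {n : ℕ} (Q : Euc n →ₗ[ℝ] Euc n) : ℝ :=
  ∑ i, ‖LinearMap.adjoint Q (EuclideanSpace.single i 1)‖ ^ 2

theorem hilbertSchmidtSq_nonneg {n : ℕ} (Q : Euc n →ₗ[ℝ] Euc n) : 0 ≤ hilbertSchmidtSq Q :=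
  Finset.sum_nonneg fun _ _ => sq_nonneg _

theorem norm_sq_apply_le_hilbertSchmidtSq {n : ℕ} (Q : Euc n →ₗ[ℝ] Euc n) (x : Euc n) :
    ‖Q x‖ ^ 2 ≤ hilbertSchmidtSq Q * ‖x‖ ^ 2 := by
  rw [EuclideanSpace.real_norm_sq_eq, hilbertSchmidtSq, Finset.sum_mul]
  refine Finset.sum_le_sum fun i _ => ?_
  rw [adjoint_apply_coord, ← mul_pow]
  exact sq_le_sq' (neg_le_of_abs_le (abs_real_inner_le_norm _ _)) (real_inner_le_norm _ _)

theorem hilbertSchmidtSq_comp_shear {n : ℕ} (Q : Euc n →ₗ[ℝ] Euc n) (x : Euc n) (ε : ℝ) :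
    hilbertSchmidtSq (Q ∘ₗ shear x ε) = hilbertSchmidtSq Q
      + ((1 + ε * ‖x‖ ^ 2) ^ 2 - 1) / ‖x‖ ^ 2 * ‖Q x‖ ^ 2 := by
  rw [EuclideanSpace.real_norm_sq_eq (Q x), hilbertSchmidtSq, hilbertSchmidtSq, Finset.mul_sum,
    ← Finset.sum_add_distrib]
  refine Finset.sum_congr rfl fun i _ => ?_
  rw [LinearMap.adjoint_comp, LinearMap.comp_apply, adjoint_shear, ← real_inner_self_eq_norm_sq,
    inner_shear_shear, real_inner_self_eq_norm_sq, adjoint_apply_coord, real_inner_comm _ x]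
  ring

/-- The inputs `Q` for which the gaussians given by `A_j = (Q_j Q_j^*)⁻¹` satisfy `A_j ≤ G_j`. -/
def IsAdmissible {m : ℕ} {d : Fin m → ℕ} (G Q : ∀ j, Euc (d j) →ₗ[ℝ] Euc (d j)) : Prop :=
  ∀ j x, ‖x‖ ^ 2 ≤ ⟪Q j x, G j (Q j x)⟫

theorem IsAdmissible.injective {m : ℕ} {d : Fin m → ℕ} {G Q : ∀ j, Euc (d j) →ₗ[ℝ] Euc (d j)}
    (h : IsAdmissible G Q) (j : Fin m) : Function.Injective (Q j) := by
  rw [injective_iff_map_eq_zero]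
  intro x hx
  have := h j x
  rw [hx, inner_zero_left] at this
  exact norm_eq_zero.1 (pow_eq_zero_iff two_ne_zero |>.1 (le_antisymm this (sq_nonneg _)))

theorem IsAdmissible.det_ne_zero {m : ℕ} {d : Fin m → ℕ}
    {G Q : ∀ j, Euc (d j) →ₗ[ℝ] Euc (d j)} (h : IsAdmissible G Q) (j : Fin m) :
    LinearMap.det (Q j) ≠ 0 :=
  (LinearEquiv.isUnit_det' (LinearEquiv.ofInjectiveEndo (Q j) (h.injective j))).ne_zero

theorem IsAdmissible.surjective {m : ℕ} {d : Fin m → ℕ} {G Q : ∀ j, Euc (d j) →ₗ[ℝ] Euc (d j)}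
    (h : IsAdmissible G Q) (j : Fin m) : Function.Surjective (Q j) :=
  LinearMap.surjective_of_injective (h.injective j)

theorem exists_isAdmissible {m : ℕ} {d : Fin m → ℕ} {G : ∀ j, Euc (d j) →ₗ[ℝ] Euc (d j)}
    (hG : ∀ j, G j ∈ SPlus (d j)) : ∃ Q, IsAdmissible G Q := by
  choose N hN using fun j => SPlus.exists_gram (hG j)
  refine ⟨fun j => ((N j).symm : Euc (d j) →ₗ[ℝ] Euc (d j)), fun j x => ?_⟩
  rw [hN j, inner_gram_self]
  simp

theorem gaussianValue_sq {m n : ℕ} {d : Fin m → ℕ} (B : ∀ j, Euc n →ₗ[ℝ] Euc (d j))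
    (c : Fin m → ℝ) (Q : ∀ j, Euc (d j) →ₗ[ℝ] Euc (d j))
    (h : 0 ≤ LinearMap.det (blOperator B c Q)) :
    gaussianValue B c Q ^ 2 =
      LinearMap.det (blOperator B c Q) * ∏ j, (LinearMap.det (Q j) ^ 2) ^ (-c j) := by
  rw [gaussianValue, mul_pow, Real.sq_sqrt h, ← Finset.prod_pow]
  refine congrArg _ (Finset.prod_congr rfl fun j _ => ?_)
  rw [← sq_abs (LinearMap.det (Q j)), ← Real.rpow_natCast, ← Real.rpow_mul (abs_nonneg _), mul_comm,
    Real.rpow_mul (abs_nonneg _), Real.rpow_natCast]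

/-- Stretching `Q_j` along `x` changes the operator to `N^* (1 + ((1 + ε)² - 1) c_j a aᵀ) N` with `a
= U_j^* x`, and a rank-one perturbation of the identity has an explicit determinant. `Pi.single`
leaves the other `Q_k` untouched, a shear along `0` being the identity. -/
theorem det_blOperator_comp_shear {m n : ℕ} {d : Fin m → ℕ} {B : ∀ j, Euc n →ₗ[ℝ] Euc (d j)}
    {c : Fin m → ℝ} {Q : ∀ j, Euc (d j) →ₗ[ℝ] Euc (d j)} {N : Euc n ≃ₗ[ℝ] Euc n}
    (hN : blOperator B c Q = gram (N : Euc n →ₗ[ℝ] Euc n)) (j : Fin m) {x : Euc (d j)}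
    (hx : ‖x‖ = 1) (ε : ℝ) :
    LinearMap.det (blOperator B c fun k => Q k ∘ₗ shear (Pi.single (M := fun k => Euc (d k)) j x k) ε) =
      LinearMap.det (blOperator B c Q) *
        (1 + ((1 + ε) ^ 2 - 1) * (c j * ‖LinearMap.adjoint (normalMap B Q N j) x‖ ^ 2)) := by
  set a := LinearMap.adjoint (normalMap B Q N j) x with ha
  have h : blOperator B c (fun k => Q k ∘ₗ shear (Pi.single (M := fun k => Euc (d k)) j x k) ε) =
      LinearMap.adjoint (N : Euc n →ₗ[ℝ] Euc n) ∘ₗ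
        LinearMap.transvection (innerₛₗ ℝ a) ((((1 + ε) ^ 2 - 1) * c j) • a) ∘ₗ
          (N : Euc n →ₗ[ℝ] Euc n) := by
    refine eq_of_inner_eq fun u w => ?_
    have e1 : ∀ w, ⟪x, LinearMap.adjoint (Q j) (B j w)⟫ = ⟪a, N w⟫ := fun w => by
      rw [ha, LinearMap.adjoint_inner_left]
      simp [normalMap]
    rw [LinearMap.comp_apply, LinearMap.adjoint_inner_right, LinearMap.comp_apply,
      LinearMap.transvection.apply, innerₛₗ_apply_apply, inner_add_right, ← inner_gram, ← hN,
      inner_blOperator, inner_blOperator]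
    simp only [LinearMap.adjoint_comp, LinearMap.comp_apply, adjoint_shear, inner_shear_shear,
      mul_add, Finset.sum_add_distrib]
    congr 1
    rw [Finset.sum_eq_single j]
    · rw [Pi.single_eq_same, hx, real_inner_comm x, e1, e1, real_inner_smul_right,
        real_inner_smul_right, LinearEquiv.coe_coe, real_inner_comm a]
      ring
    · intro k _ hk
      rw [Pi.single_eq_of_ne hk]
      simp
    · simp
  rw [h, LinearMap.det_comp, LinearMap.det_comp, det_adjoint, LinearMap.transvection.det, hN,
    det_gram, innerₛₗ_apply_apply, real_inner_smul_right, real_inner_self_eq_norm_sq]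
  ring

/-- The square of the Barthe functional at a gaussian input, with a Hilbert–Schmidt penalty. -/
def penalizedValue {m n : ℕ} {d : Fin m → ℕ} (B : ∀ j, Euc n →ₗ[ℝ] Euc (d j)) (c : Fin m → ℝ)
    (δ : ℝ) (Q : ∀ j, Euc (d j) →ₗ[ℝ] Euc (d j)) : ℝ :=
  gaussianValue B c Q ^ 2 * rexp (δ * ∑ j, hilbertSchmidtSq (Q j))

theorem IsAdmissible.det_blOperator_pos {m n : ℕ} {d : Fin m → ℕ}
    {B : ∀ j, Euc n →ₗ[ℝ] Euc (d j)} {c : Fin m → ℝ} (hBc : NondegenerateDatum B c)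
    {G Q : ∀ j, Euc (d j) →ₗ[ℝ] Euc (d j)} (h : IsAdmissible G Q) :
    0 < LinearMap.det (blOperator B c Q) :=
  SPlus.det_pos (blOperator_mem_SPlus hBc h.surjective)

theorem IsAdmissible.gaussianValue_pos {m n : ℕ} {d : Fin m → ℕ}
    {B : ∀ j, Euc n →ₗ[ℝ] Euc (d j)} {c : Fin m → ℝ} (hBc : NondegenerateDatum B c)
    {G Q : ∀ j, Euc (d j) →ₗ[ℝ] Euc (d j)} (h : IsAdmissible G Q) :
    0 < gaussianValue B c Q :=
  mul_pos (Real.sqrt_pos.2 (h.det_blOperator_pos hBc))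
    (Finset.prod_pos fun j _ => Real.rpow_pos_of_pos (abs_pos.2 (h.det_ne_zero j)) _)

/-- The first-order condition at a minimiser, for stretching `Q_j` in the direction `x`. -/
theorem one_le_of_penalizedValue_le {m n : ℕ} {d : Fin m → ℕ} {B : ∀ j, Euc n →ₗ[ℝ] Euc (d j)}
    {c : Fin m → ℝ} (hBc : NondegenerateDatum B c) {G Q : ∀ j, Euc (d j) →ₗ[ℝ] Euc (d j)}
    (hQ : IsAdmissible G Q) {N : Euc n ≃ₗ[ℝ] Euc n}
    (hN : blOperator B c Q = gram (N : Euc n →ₗ[ℝ] Euc n)) {δ : ℝ}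
    (hmin : ∀ P, IsAdmissible G P → penalizedValue B c δ Q ≤ penalizedValue B c δ P)
    (j : Fin m) {x : Euc (d j)} (hx : ‖x‖ = 1) {t : ℝ} (ht : 0 < t)
    (hadm : ∀ y : Euc (d j), ‖y‖ ^ 2 ≤
      ⟪Q j (shear x (√t - 1) y), G j (Q j (shear x (√t - 1) y))⟫) :
    1 ≤ (1 + (t - 1) * (c j * ‖LinearMap.adjoint (normalMap B Q N j) x‖ ^ 2)) * t ^ (-c j)
      * rexp (δ * ((t - 1) * ‖Q j x‖ ^ 2)) := by
  -- The parameter `√t - 1` makes the squared stretching factor equal to `t`, so that `t = 1` is the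
  -- unperturbed point.
  set P : ∀ k, Euc (d k) →ₗ[ℝ] Euc (d k) := fun k =>
    Q k ∘ₗ shear (Pi.single (M := fun k => Euc (d k)) j x k) (√t - 1) with hP
  have hε : (1 + (√t - 1)) ^ 2 = t := by rw [add_sub_cancel, Real.sq_sqrt ht.le]
  have hPadm : IsAdmissible G P := fun k y => by
    rcases eq_or_ne k j with rfl | hk
    · simp only [hP, LinearMap.comp_apply, Pi.single_eq_same]
      exact hadm y
    · simp only [hP, LinearMap.comp_apply, Pi.single_eq_of_ne hk]
      simpa [shear_apply] using hQ k y
  have h := hmin P hPadm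
  have hdet := det_blOperator_comp_shear hN j hx (√t - 1)
  rw [hε] at hdet
  have hHS : ∑ k, hilbertSchmidtSq (P k) =
      ∑ k, hilbertSchmidtSq (Q k) + (t - 1) * ‖Q j x‖ ^ 2 := by
    simp only [hP, hilbertSchmidtSq_comp_shear, Finset.sum_add_distrib]
    congr 1
    rw [Finset.sum_eq_single j (fun k _ hk => by rw [Pi.single_eq_of_ne hk]; simp) (by simp),
      Pi.single_eq_same, hx, one_pow, mul_one, hε, div_one]
  have hprod : ∏ k, (LinearMap.det (P k) ^ 2) ^ (-c k) =
      (∏ k, (LinearMap.det (Q k) ^ 2) ^ (-c k)) * t ^ (-c j) := by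
    have e : ∀ k, (LinearMap.det (P k) ^ 2) ^ (-c k) = (LinearMap.det (Q k) ^ 2) ^ (-c k) *
        ((1 + (√t - 1) * ‖(Pi.single (M := fun k => Euc (d k)) j x k)‖ ^ 2) ^ 2) ^ (-c k) := fun k => by
      rw [hP, LinearMap.det_comp, det_shear, mul_pow,
        Real.mul_rpow (sq_nonneg _) (sq_nonneg _)]
    simp only [e, Finset.prod_mul_distrib]
    congr 1
    rw [Finset.prod_eq_single j (fun k _ hk => by rw [Pi.single_eq_of_ne hk]; simp) (by simp),
      Pi.single_eq_same, hx, one_pow, mul_one, hε]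
  rw [penalizedValue, penalizedValue, gaussianValue_sq B c P (hPadm.det_blOperator_pos hBc).le,
    hprod, hHS, hdet, mul_add δ, Real.exp_add, gaussianValue_sq B c Q
    (hQ.det_blOperator_pos hBc).le] at h
  have hpos : 0 < LinearMap.det (blOperator B c Q) * (∏ j, (LinearMap.det (Q j) ^ 2) ^ (-c j))
      * rexp (δ * ∑ j, hilbertSchmidtSq (Q j)) :=
    mul_pos (mul_pos (hQ.det_blOperator_pos hBc) (Finset.prod_pos fun k _ =>
      Real.rpow_pos_of_pos (by have := hQ.det_ne_zero k; positivity) _)) (Real.exp_pos _)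
  refine le_of_mul_le_mul_left ?_ hpos
  rw [mul_one]
  refine h.trans_eq ?_
  ring

/-- The right derivative at `t = 1` of the logarithm of the right side is `c a - c + q`, which must
be nonnegative. -/
theorem le_of_first_order_pos {c a q : ℝ} (hc : 0 < c) (ha : 0 ≤ a)
    (h : ∀ t, 1 < t → 1 ≤ (1 + (t - 1) * (c * a)) * t ^ (-c) * rexp ((t - 1) * q)) :
    c ≤ c * a + q := by
  refine le_of_forall_pos_le_add fun e he => ?_
  -- Chosen so that `c (2 - t) = c - e`; the factor `2 - t` comes from the elementary lower bound
  -- `(t - 1)(2 - t)` for `log t`.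
  set t := 1 + e / c with ht
  have he' : 0 < e / c := by positivity
  have ht1 : 1 < t := by linarith
  have ht0 : 0 < t := by linarith
  have h1 := Real.log_nonneg (h t ht1)
  have hp : 0 < 1 + (t - 1) * (c * a) := by
    have : 0 ≤ (t - 1) * (c * a) := mul_nonneg (by linarith) (by positivity)
    linarith
  rw [Real.log_mul (by positivity) (Real.exp_ne_zero _), Real.log_mul hp.ne' (by positivity),
    Real.log_exp, Real.log_rpow ht0] at h1
  have h2 := Real.log_le_sub_one_of_pos hp
  have h3 := Real.one_sub_inv_le_log_of_pos ht0
  have h4 : (t - 1) * (2 - t) ≤ 1 - t⁻¹ := by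
    rw [← sub_nonneg]
    have : 1 - t⁻¹ - (t - 1) * (2 - t) = (t - 1) ^ 3 / t + (t - 1) ^ 2 * 0 := by
      field_simp; ring
    rw [this]
    have : 0 < t - 1 := by linarith
    positivity
  have h5 : c * ((t - 1) * (2 - t)) ≤ (t - 1) * (c * a) + (t - 1) * q := by nlinarith
  have h6 : c * (2 - t) ≤ c * a + q := by
    refine le_of_mul_le_mul_left ?_ (show 0 < t - 1 by linarith)
    nlinarith
  have h7 : c * (2 - t) = c - e := by rw [ht]; field_simp; ring
  linarith

/-- The left derivative at `t = 1` gives `c a + q ≤ c`. Shrinking lowers the penalty, so `q ≥ 0` can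
be dropped and no error survives, unlike for stretching. -/
theorem le_of_first_order_neg {c a q s : ℝ} (hc : 0 < c) (hq : 0 ≤ q) (hs : 0 < s) (hs1 : s < 1)
    (h : ∀ t, s ≤ t → t < 1 → 1 ≤ (1 + (t - 1) * (c * a)) * t ^ (-c) * rexp ((t - 1) * q)) :
    a ≤ 1 := by
  have key : ∀ t, s ≤ t → t < 1 → t * a ≤ 1 := by
    intro t hst ht1
    have ht0 : 0 < t := by linarith
    have hr := Real.rpow_pos_of_pos ht0 (-c)
    have he := Real.exp_pos ((t - 1) * q)
    have h0 := h t hst ht1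
    have hp : 0 < 1 + (t - 1) * (c * a) := by
      by_contra hn
      have := mul_nonpos_of_nonpos_of_nonneg (mul_nonpos_of_nonpos_of_nonneg (not_lt.1 hn) hr.le)
        he.le
      linarith
    have h1 := Real.log_nonneg h0
    rw [Real.log_mul (by positivity) (Real.exp_ne_zero _), Real.log_mul hp.ne' (by positivity),
      Real.log_exp, Real.log_rpow ht0] at h1
    have h2 := Real.log_le_sub_one_of_pos hp
    have h3 := Real.one_sub_inv_le_log_of_pos ht0
    have h4 : (t - 1) * q ≤ 0 := mul_nonpos_of_nonpos_of_nonneg (by linarith) hq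
    have h5 : c * (1 - t⁻¹) ≤ c * ((t - 1) * a) := by nlinarith
    have h6 := le_of_mul_le_mul_left h5 hc
    have h7 : 1 - t⁻¹ = (t - 1) * t⁻¹ := by field_simp
    rw [h7] at h6
    have h8 : a ≤ t⁻¹ := not_lt.1 fun hlt => by nlinarith
    rw [inv_eq_one_div, le_div_iff₀ ht0] at h8
    linarith
  have hlim : Tendsto (fun t : ℝ => t * a) (𝓝[<] 1) (𝓝 (1 * a)) :=
    ((continuous_id.mul continuous_const).tendsto 1).mono_left nhdsWithin_le_nhds
  rw [one_mul] at hlim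
  refine le_of_tendsto hlim ?_
  filter_upwards [Ioo_mem_nhdsLT hs1] with t ht using key t ht.1.le ht.2

/-! ### Existence of minimisers of the penalised gaussian functional -/

theorem det_eq_det_of_inner {n : ℕ} (A : Euc n →ₗ[ℝ] Euc n) :
    LinearMap.det A = (Matrix.of fun i k =>
      ⟪(EuclideanSpace.single i 1 : Euc n), A (EuclideanSpace.single k 1)⟫).det := by
  rw [← LinearMap.det_toMatrix (EuclideanSpace.basisFun (Fin n) ℝ).toBasis]
  congr 1
  ext i k
  simp [LinearMap.toMatrix_apply, EuclideanSpace.inner_single_left]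

theorem continuous_adjoint_apply {m : ℕ} {d : Fin m → ℕ} (j : Fin m) (v : Euc (d j)) :
    Continuous fun P : ∀ j, Euc (d j) →L[ℝ] Euc (d j) =>
      LinearMap.adjoint (P j : Euc (d j) →ₗ[ℝ] Euc (d j)) v := by
  have h : ∀ P : ∀ j, Euc (d j) →L[ℝ] Euc (d j),
      LinearMap.adjoint (P j : Euc (d j) →ₗ[ℝ] Euc (d j)) v = ContinuousLinearMap.adjoint (P j) v :=
    fun P => ext_inner_left ℝ fun x => by
      rw [LinearMap.adjoint_inner_right, ContinuousLinearMap.adjoint_inner_right]; rfl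
  simp only [h]
  have h2 : Continuous fun P : ∀ j, Euc (d j) →L[ℝ] Euc (d j) => ContinuousLinearMap.adjoint (P j) :=
    ContinuousLinearMap.adjoint.continuous.comp (continuous_apply j)
  exact h2.clm_apply continuous_const

theorem continuous_hilbertSchmidtSq {m : ℕ} {d : Fin m → ℕ} (j : Fin m) :
    Continuous fun P : ∀ j, Euc (d j) →L[ℝ] Euc (d j) =>
      hilbertSchmidtSq (P j : Euc (d j) →ₗ[ℝ] Euc (d j)) :=
  continuous_finsetSum _ fun _ _ => (continuous_adjoint_apply j _).norm.pow 2

theorem continuous_det_blOperator {m n : ℕ} {d : Fin m → ℕ} (B : ∀ j, Euc n →ₗ[ℝ] Euc (d j))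
    (c : Fin m → ℝ) : Continuous fun P : ∀ j, Euc (d j) →L[ℝ] Euc (d j) =>
      LinearMap.det (blOperator B c fun j => (P j : Euc (d j) →ₗ[ℝ] Euc (d j))) := by
  simp only [det_eq_det_of_inner, inner_blOperator]
  refine Continuous.matrix_det (continuous_matrix fun i k => ?_)
  simp only [Matrix.of_apply]
  exact continuous_finsetSum _ fun j _ => continuous_const.mul
    ((continuous_adjoint_apply j _).inner (continuous_adjoint_apply j _))

theorem isCompact_isAdmissible {m : ℕ} {d : Fin m → ℕ} (G : ∀ j, Euc (d j) →ₗ[ℝ] Euc (d j))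
    (K : ℝ) : IsCompact {P : ∀ j, Euc (d j) →L[ℝ] Euc (d j) |
      IsAdmissible G (fun j => (P j : Euc (d j) →ₗ[ℝ] Euc (d j))) ∧
        ∑ j, hilbertSchmidtSq (P j : Euc (d j) →ₗ[ℝ] Euc (d j)) ≤ K} := by
  have : ProperSpace (∀ j, Euc (d j) →L[ℝ] Euc (d j)) := FiniteDimensional.proper ℝ _
  refine Metric.isCompact_of_isClosed_isBounded (IsClosed.inter ?_ ?_) ?_
  · have : {P : ∀ j, Euc (d j) →L[ℝ] Euc (d j) |
        IsAdmissible G (fun j => (P j : Euc (d j) →ₗ[ℝ] Euc (d j)))} =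
        ⋂ j, ⋂ x : Euc (d j), {P | ‖x‖ ^ 2 ≤ ⟪P j x, G j (P j x)⟫} := by
      ext P
      simp [IsAdmissible]
    refine (this ▸ isClosed_iInter fun j => isClosed_iInter fun x =>
      isClosed_le continuous_const ?_ :)
    have h1 : Continuous fun P : ∀ j, Euc (d j) →L[ℝ] Euc (d j) => P j x :=
      (continuous_apply j).clm_apply continuous_const
    exact h1.inner ((LinearMap.continuous_of_finiteDimensional (G j)).comp h1)
  · exact isClosed_le (continuous_finsetSum _ fun j _ => continuous_hilbertSchmidtSq j)
      continuous_const
  · refine (isBounded_iff_forall_norm_le).2 ⟨√(max K 0), fun P hP => ?_⟩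
    refine (pi_norm_le_iff_of_nonneg (Real.sqrt_nonneg _)).2 fun j =>
      ContinuousLinearMap.opNorm_le_bound _ (Real.sqrt_nonneg _) fun x => ?_
    refine le_of_sq_le_sq ?_ (by positivity)
    rw [mul_pow, Real.sq_sqrt (le_max_right _ _)]
    refine (norm_sq_apply_le_hilbertSchmidtSq (P j : Euc (d j) →ₗ[ℝ] Euc (d j)) x).trans ?_
    refine mul_le_mul_of_nonneg_right ?_ (sq_nonneg _)
    refine le_trans ?_ (hP.2.trans (le_max_left _ _))
    exact Finset.single_le_sum (f := fun j => hilbertSchmidtSq (P j : Euc (d j) →ₗ[ℝ] Euc (d j)))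
      (fun j _ => hilbertSchmidtSq_nonneg _) (Finset.mem_univ j)

/-- Since the gaussian value is at least `C > 0`, the penalty forces sublevel sets to be bounded.
Admissibility is a closed condition and implies `det Q_j ≠ 0`, so the functional is continuous on
the resulting compact set. -/
theorem exists_penalizedValue_minimizer {m n : ℕ} {d : Fin m → ℕ}
    {B : ∀ j, Euc n →ₗ[ℝ] Euc (d j)} {c : Fin m → ℝ} (hBc : NondegenerateDatum B c)
    {G : ∀ j, Euc (d j) →ₗ[ℝ] Euc (d j)} {C : ℝ} (hC : 0 < C)
    (hval : ∀ Q, IsAdmissible G Q → C ≤ gaussianValue B c Q) {δ : ℝ} (hδ : 0 < δ)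
    {Q₁ : ∀ j, Euc (d j) →ₗ[ℝ] Euc (d j)} (hQ₁ : IsAdmissible G Q₁) :
    ∃ Q, IsAdmissible G Q ∧
      ∀ P, IsAdmissible G P → penalizedValue B c δ Q ≤ penalizedValue B c δ P := by
  set K : ℝ := Real.log (penalizedValue B c δ Q₁ / C ^ 2) / δ with hK
  have hsub : ∀ P, IsAdmissible G P → penalizedValue B c δ P ≤ penalizedValue B c δ Q₁ →
      ∑ j, hilbertSchmidtSq (P j) ≤ K := fun P hP hle => by
    rw [hK, le_div_iff₀ hδ]
    have h1 : C ^ 2 ≤ gaussianValue B c P ^ 2 := pow_le_pow_left₀ hC.le (hval P hP) 2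
    have h2 : rexp (δ * ∑ j, hilbertSchmidtSq (P j)) ≤ penalizedValue B c δ Q₁ / C ^ 2 := by
      rw [le_div_iff₀ (by positivity), mul_comm]
      exact (mul_le_mul_of_nonneg_right h1 (Real.exp_pos _).le).trans hle
    rw [mul_comm, ← Real.log_exp (δ * _)]
    exact Real.log_le_log (Real.exp_pos _) h2
  let S := {P : ∀ j, Euc (d j) →L[ℝ] Euc (d j) |
      IsAdmissible G (fun j => (P j : Euc (d j) →ₗ[ℝ] Euc (d j))) ∧
        ∑ j, hilbertSchmidtSq (P j : Euc (d j) →ₗ[ℝ] Euc (d j)) ≤ K}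
  have hS : IsCompact S := isCompact_isAdmissible G K
  have hcoe : ∀ P : ∀ j, Euc (d j) →ₗ[ℝ] Euc (d j),
      (fun j => ((LinearMap.toContinuousLinearMap (P j) : Euc (d j) →L[ℝ] Euc (d j)) :
        Euc (d j) →ₗ[ℝ] Euc (d j))) = P := fun P => funext fun j => by ext; rfl
  have hmem : ∀ P, IsAdmissible G P → penalizedValue B c δ P ≤ penalizedValue B c δ Q₁ →
      (fun j => (LinearMap.toContinuousLinearMap (P j) : Euc (d j) →L[ℝ] Euc (d j))) ∈ S :=
    fun P hP hle => by
      refine ⟨(hcoe P).symm ▸ hP, ?_⟩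
      exact hsub P hP hle
  have hcont : ContinuousOn (fun P : ∀ j, Euc (d j) →L[ℝ] Euc (d j) =>
      penalizedValue B c δ fun j => (P j : Euc (d j) →ₗ[ℝ] Euc (d j))) S := by
    have h1 : ContinuousOn (fun P : ∀ j, Euc (d j) →L[ℝ] Euc (d j) =>
        (LinearMap.det (blOperator B c fun j => (P j : Euc (d j) →ₗ[ℝ] Euc (d j))) *
          ∏ j, (LinearMap.det (P j : Euc (d j) →ₗ[ℝ] Euc (d j)) ^ 2) ^ (-c j)) *
          rexp (δ * ∑ j, hilbertSchmidtSq (P j : Euc (d j) →ₗ[ℝ] Euc (d j)))) S := by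
      refine ((continuous_det_blOperator B c).continuousOn.mul
        (continuousOn_finsetProd _ fun j _ => ?_)).mul ?_
      · refine ContinuousOn.rpow_const ?_ fun P hP => Or.inl (pow_ne_zero 2 (hP.1.det_ne_zero j))
        exact ((ContinuousLinearMap.continuous_det.comp (continuous_apply j)).pow 2).continuousOn
      · exact (Real.continuous_exp.comp (continuous_const.mul
          (continuous_finsetSum _ fun j _ => continuous_hilbertSchmidtSq j))).continuousOn
    refine h1.congr fun P hP => ?_
    simp only [penalizedValue]
    rw [gaussianValue_sq _ _ _ (hP.1.det_blOperator_pos hBc).le]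
  obtain ⟨P, hP, hmin⟩ := hS.exists_isMinOn ⟨_, hmem Q₁ hQ₁ le_rfl⟩ hcont
  refine ⟨_, hP.1, fun P' hP' => ?_⟩
  have h1 := hmin (hmem Q₁ hQ₁ le_rfl)
  simp only [Set.mem_ofPred_eq, hcoe] at h1
  -- Only competitors no worse than `Q₁` are known to lie in `S`; the others lose to `Q₁` itself.
  rcases le_total (penalizedValue B c δ P') (penalizedValue B c δ Q₁) with h | h
  · have h2 := hmin (hmem P' hP' h)
    simp only [Set.mem_ofPred_eq, hcoe] at h2
    exact h2
  · exact h1.trans h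

/-- A minimiser of the penalised functional for which the penalty is small. -/
theorem exists_penalizedValue_minimizer_small {m n : ℕ} {d : Fin m → ℕ}
    {B : ∀ j, Euc n →ₗ[ℝ] Euc (d j)} {c : Fin m → ℝ} (hBc : NondegenerateDatum B c)
    {G : ∀ j, Euc (d j) →ₗ[ℝ] Euc (d j)} (hG : ∀ j, G j ∈ SPlus (d j)) {C : ℝ} (hC : 0 < C)
    (hval : ∀ Q, IsAdmissible G Q → C ≤ gaussianValue B c Q) {η : ℝ} (hη : 0 < η) :
    ∃ δ Q, 0 ≤ δ ∧ IsAdmissible G Q ∧ δ * ∑ j, hilbertSchmidtSq (Q j) ≤ η ∧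
      ∀ P, IsAdmissible G P → penalizedValue B c δ Q ≤ penalizedValue B c δ P := by
  obtain ⟨Q₀, hQ₀⟩ := exists_isAdmissible hG
  set V : Set ℝ := (fun Q => gaussianValue B c Q ^ 2) '' {Q | IsAdmissible G Q} with hV
  have hVb : ∀ v ∈ V, C ^ 2 ≤ v := by
    rintro _ ⟨Q, hQ, rfl⟩
    exact pow_le_pow_left₀ hC.le (hval Q hQ) 2
  have hVne : V.Nonempty := ⟨_, Q₀, hQ₀, rfl⟩
  have hI : 0 < sInf V := (by positivity : 0 < C ^ 2).trans_le (le_csInf hVne hVb)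
  have hlt : sInf V < sInf V * rexp (η / 2) :=
    lt_mul_of_one_lt_right hI (Real.one_lt_exp_iff.2 (by positivity))
  obtain ⟨_, ⟨Q₁, hQ₁, rfl⟩, hQ₁v⟩ := exists_lt_of_csInf_lt hVne hlt
  have hH : 0 ≤ ∑ j, hilbertSchmidtSq (Q₁ j) :=
    Finset.sum_nonneg fun j _ => hilbertSchmidtSq_nonneg _
  -- `Q₁` is optimal up to a factor `exp(η/2)`, and this `δ` makes its penalty at most another
  -- `exp(η/2)`. Comparing with the infimum bounds the penalty at the minimiser by `exp η`, however
  -- large its norm.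
  set δ : ℝ := η / (2 * (∑ j, hilbertSchmidtSq (Q₁ j) + 1)) with hδ
  have hδ0 : 0 < δ := by positivity
  have hδ1 : δ * ∑ j, hilbertSchmidtSq (Q₁ j) ≤ η / 2 := by
    rw [hδ, div_mul_eq_mul_div, div_le_div_iff₀ (by positivity) (by positivity)]
    nlinarith
  obtain ⟨Q, hQ, hmin⟩ := exists_penalizedValue_minimizer hBc hC hval hδ0 hQ₁
  refine ⟨δ, Q, hδ0.le, hQ, ?_, hmin⟩
  have h1 := hmin Q₁ hQ₁
  have h2 : sInf V ≤ gaussianValue B c Q ^ 2 := csInf_le ⟨_, hVb⟩ ⟨Q, hQ, rfl⟩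
  have h3 : sInf V * rexp (δ * ∑ j, hilbertSchmidtSq (Q j)) ≤ sInf V * rexp η := by
    calc _ ≤ penalizedValue B c δ Q := mul_le_mul_of_nonneg_right h2 (Real.exp_pos _).le
      _ ≤ penalizedValue B c δ Q₁ := h1
      _ ≤ sInf V * rexp (η / 2) * rexp (η / 2) :=
        mul_le_mul hQ₁v.le (Real.exp_le_exp.2 hδ1) (Real.exp_pos _).le (by positivity)
      _ = sInf V * rexp η := by rw [mul_assoc, ← Real.exp_add, add_halves]
  exact Real.exp_le_exp.1 (le_of_mul_le_mul_left h3 hI)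

/-! ### Stationarity conditions in normal position -/

/-- Stretching `Q_j` in any direction preserves `Q_j^* G_j Q_j ≥ 1`, so the one-sided condition for
`t > 1` holds for every unit vector; the penalty contributes at most `δ ∑ ‖Q_k‖²`. -/
theorem sub_mul_norm_sq_le_of_minimizer {m n : ℕ} {d : Fin m → ℕ}
    {B : ∀ j, Euc n →ₗ[ℝ] Euc (d j)} {c : Fin m → ℝ} (hBc : NondegenerateDatum B c)
    {G Q : ∀ j, Euc (d j) →ₗ[ℝ] Euc (d j)} (hQ : IsAdmissible G Q) {N : Euc n ≃ₗ[ℝ] Euc n}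
    (hN : blOperator B c Q = gram (N : Euc n →ₗ[ℝ] Euc n)) {δ : ℝ} (hδ : 0 ≤ δ)
    (hmin : ∀ P, IsAdmissible G P → penalizedValue B c δ Q ≤ penalizedValue B c δ P)
    (j : Fin m) (x : Euc (d j)) :
    (c j - δ * ∑ k, hilbertSchmidtSq (Q k)) * ‖x‖ ^ 2 ≤
      c j * ‖LinearMap.adjoint (normalMap B Q N j) x‖ ^ 2 := by
  have unit : ∀ x : Euc (d j), ‖x‖ = 1 → c j - δ * ∑ k, hilbertSchmidtSq (Q k) ≤
      c j * ‖LinearMap.adjoint (normalMap B Q N j) x‖ ^ 2 := by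
    intro x hx
    have h := le_of_first_order_pos (q := δ * ‖Q j x‖ ^ 2) (hBc.exponent_pos j)
      (sq_nonneg ‖LinearMap.adjoint (normalMap B Q N j) x‖) fun t ht => by
        have := one_le_of_penalizedValue_le hBc hQ hN hmin j hx (show 0 < t by linarith) fun y => by
          refine le_trans ?_ (hQ j _)
          rw [← real_inner_self_eq_norm_sq, ← real_inner_self_eq_norm_sq, inner_shear_shear, hx,
            one_pow, mul_one, add_sub_cancel, Real.sq_sqrt (by linarith), real_inner_comm x y]
          have : 0 ≤ (t - 1) / 1 * (⟪x, y⟫ * ⟪x, y⟫) :=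
            mul_nonneg (by linarith) (mul_self_nonneg _)
          linarith
        rwa [mul_left_comm (t - 1) δ]
    have h1 := norm_sq_apply_le_hilbertSchmidtSq (Q j) x
    rw [hx, one_pow, mul_one] at h1
    have h2 : hilbertSchmidtSq (Q j) ≤ ∑ k, hilbertSchmidtSq (Q k) :=
      Finset.single_le_sum (f := fun k => hilbertSchmidtSq (Q k))
        (fun k _ => hilbertSchmidtSq_nonneg _) (Finset.mem_univ j)
    have h3 := mul_le_mul_of_nonneg_left (h1.trans h2) hδ
    linarith
  rcases eq_or_ne x 0 with rfl | hx
  · simp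
  have hx : 0 < ‖x‖ := norm_pos_iff.2 hx
  have h := unit (‖x‖⁻¹ • x) (by rw [norm_smul, norm_inv, norm_norm, inv_mul_cancel₀ hx.ne'])
  rw [map_smul, norm_smul, norm_inv, norm_norm, mul_pow, inv_pow] at h
  have h2 := mul_le_mul_of_nonneg_right h (sq_nonneg ‖x‖)
  refine h2.trans_eq ?_
  field_simp

/-- Along an eigenvector of `Q_j^* G_j Q_j` with eigenvalue `g > 1` the constraint is slack.
Shrinking multiplies this eigenvalue by `t` and leaves the orthogonal complement alone, so it is
admissible down to `t = 1 / g`. -/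
theorem norm_sq_le_one_of_minimizer {m n : ℕ} {d : Fin m → ℕ}
    {B : ∀ j, Euc n →ₗ[ℝ] Euc (d j)} {c : Fin m → ℝ} (hBc : NondegenerateDatum B c)
    {G Q : ∀ j, Euc (d j) →ₗ[ℝ] Euc (d j)} (hQ : IsAdmissible G Q)
    {N : Euc n ≃ₗ[ℝ] Euc n}
    (hN : blOperator B c Q = gram (N : Euc n →ₗ[ℝ] Euc n)) {δ : ℝ} (hδ : 0 ≤ δ)
    (hmin : ∀ P, IsAdmissible G P → penalizedValue B c δ Q ≤ penalizedValue B c δ P)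
    (j : Fin m) {b : Euc (d j)} (hb : ‖b‖ = 1) {g : ℝ} (hg : 1 < g)
    (hHs : ∀ y z, ⟪Q j y, G j (Q j z)⟫ = ⟪Q j z, G j (Q j y)⟫)
    (hHb : ∀ y, ⟪Q j y, G j (Q j b)⟫ = g * ⟪y, b⟫) :
    ‖LinearMap.adjoint (normalMap B Q N j) b‖ ^ 2 ≤ 1 := by
  refine le_of_first_order_neg (q := δ * ‖Q j b‖ ^ 2) (hBc.exponent_pos j) (by positivity)
    (inv_pos.2 (by linarith : 0 < g)) (inv_lt_one_of_one_lt₀ hg) fun t hst ht1 => ?_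
  have ht0 : 0 < t := (inv_pos.2 (by linarith : 0 < g)).trans_le hst
  have := one_le_of_penalizedValue_le hBc hQ hN hmin j hb ht0 fun y => by
    have hgt : 1 ≤ t * g := by
      rw [inv_eq_one_div, div_le_iff₀ (by linarith)] at hst
      exact hst
    set s := ⟪b, y⟫ with hs
    set z := y - s • b with hz
    have hy : y = z + s • b := by rw [hz, sub_add_cancel]
    have hzb : ⟪z, b⟫ = 0 := by
      rw [hz, inner_sub_left, real_inner_smul_left, real_inner_self_eq_norm_sq, hb, hs,
        real_inner_comm y b]
      ring
    have hS : shear b (√t - 1) y = z + (√t * s) • b := by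
      rw [shear_apply, ← hs, hz]
      module
    have hny : ‖y‖ ^ 2 = ‖z‖ ^ 2 + s ^ 2 := by
      rw [← real_inner_self_eq_norm_sq, hy, inner_add_left, inner_add_right, inner_add_right,
        real_inner_smul_left, real_inner_smul_left, real_inner_smul_right, real_inner_smul_right,
        real_inner_comm z b, hzb, real_inner_self_eq_norm_sq, real_inner_self_eq_norm_sq, hb]
      ring
    have hz' := hQ j z
    rw [hS, hny, map_add, map_smul, map_add, map_smul, inner_add_left, inner_add_right,
      inner_add_right, real_inner_smul_left, real_inner_smul_left, real_inner_smul_right,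
      real_inner_smul_right, hHs b z, hHb z, hHb b, hzb, real_inner_self_eq_norm_sq, hb]
    have hst2 := Real.mul_self_sqrt ht0.le
    nlinarith [mul_le_mul_of_nonneg_right hgt (sq_nonneg s), sq_nonneg s,
      show √t * s * (√t * s * (g * 1 ^ 2)) = (√t * √t) * g * s ^ 2 by ring]
  rwa [mul_left_comm (t - 1) δ]

/-- A nearly optimal gaussian input, rotated so that `Q_j^* G_j Q_j` is diagonal. -/
theorem exists_normal_position {m n : ℕ} {d : Fin m → ℕ}
    {B : ∀ j, Euc n →ₗ[ℝ] Euc (d j)} {c : Fin m → ℝ} (hBc : NondegenerateDatum B c)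
    {G : ∀ j, Euc (d j) →ₗ[ℝ] Euc (d j)} (hG : ∀ j, G j ∈ SPlus (d j)) {C : ℝ} (hC : 0 < C)
    (hval : ∀ Q, IsAdmissible G Q → C ≤ gaussianValue B c Q) {η : ℝ} (hη : 0 < η) :
    ∃ (Q : ∀ j, Euc (d j) →ₗ[ℝ] Euc (d j)) (N : Euc n ≃ₗ[ℝ] Euc n) (l : ∀ j, Fin (d j) → ℝ)
      (τ : ℝ), IsAdmissible G Q ∧ blOperator B c Q = gram (N : Euc n →ₗ[ℝ] Euc n) ∧
      (∀ j i, 0 < l j i) ∧ (∀ j i, l j i ≤ 1) ∧ 0 ≤ τ ∧ τ ≤ η ∧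
      (∀ j x, ⟪Q j x, G j (Q j x)⟫ = ∑ i, x i ^ 2 / l j i) ∧
      (∀ j, LinearMap.det (G j) * LinearMap.det (Q j) ^ 2 = ∏ i, (l j i)⁻¹) ∧
      (∀ j x, (c j - τ) * ‖x‖ ^ 2 ≤ c j * ‖LinearMap.adjoint (normalMap B Q N j) x‖ ^ 2) ∧
      ∀ j i, l j i < 1 →
        ‖LinearMap.adjoint (normalMap B Q N j) (EuclideanSpace.single i 1)‖ ^ 2 ≤ 1 := by
  obtain ⟨δ, P, hδ, hP, hτ, hmin⟩ := exists_penalizedValue_minimizer_small hBc hG hC hval hη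
  set H : ∀ j, Euc (d j) →ₗ[ℝ] Euc (d j) := fun j => LinearMap.adjoint (P j) ∘ₗ G j ∘ₗ P j with hH
  have hin : ∀ j y z, ⟪y, H j z⟫ = ⟪P j y, G j (P j z)⟫ := fun j y z => by
    rw [hH, LinearMap.comp_apply, LinearMap.adjoint_inner_right, LinearMap.comp_apply]
  have hsymm : ∀ j y z, ⟪P j y, G j (P j z)⟫ = ⟪P j z, G j (P j y)⟫ := fun j y z => by
    rw [← (hG j).1, real_inner_comm]
  have hHS : ∀ j, H j ∈ SPlus (d j) := fun j => by
    refine ⟨fun y z => ?_, fun x hx => ?_⟩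
    · rw [real_inner_comm, hin, hin, hsymm]
    · rw [hin]
      have := hP j x
      have hx : 0 < ‖x‖ := norm_pos_iff.2 hx
      have : 0 < ‖x‖ ^ 2 := by positivity
      linarith [hP j x]
  choose b g hg hb hdet using fun j => SPlus.exists_eigenbasis (hHS j)
  have hHb : ∀ j i y, ⟪P j y, G j (P j (b j i))⟫ = g j i * ⟪y, b j i⟫ := fun j i y => by
    rw [← hin, hb, real_inner_smul_right]
  have hg1 : ∀ j i, 1 ≤ g j i := fun j i => by
    have h := hP j (b j i)
    rw [hHb, real_inner_self_eq_norm_sq, OrthonormalBasis.norm_eq_one] at h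
    linarith
  -- Rotating `P_j` on the right changes neither `P_j P_j^*` nor the gaussian it encodes, and brings
  -- the eigenbasis to the coordinate axes, as the axis-parallel kernels require.
  set O : ∀ j, Euc (d j) ≃ₗᵢ[ℝ] Euc (d j) := fun j => (b j).repr.symm with hO
  have hOs : ∀ j i, O j (EuclideanSpace.single i 1) = b j i := fun j i => by simp [hO]
  set R : ∀ j, Euc (d j) →ₗ[ℝ] Euc (d j) := fun j => (O j).toLinearEquiv with hR
  have hRO : ∀ j x, R j x = O j x := fun j x => rfl
  set Q : ∀ j, Euc (d j) →ₗ[ℝ] Euc (d j) := fun j => P j ∘ₗ R j with hQ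
  have hQP : ∀ j x, Q j x = P j (O j x) := fun j x => rfl
  have hnorm : ∀ j x, ‖O j x‖ = ‖x‖ := fun j x => (O j).norm_map x
  have hRR : ∀ j u w, ⟪LinearMap.adjoint (R j) u, LinearMap.adjoint (R j) w⟫ = ⟪u, w⟫ :=
    fun j u w => by
    obtain ⟨u, rfl⟩ := (O j).surjective u
    obtain ⟨w, rfl⟩ := (O j).surjective w
    have : ∀ v, LinearMap.adjoint (R j) (O j v) = v := fun v => ext_inner_left ℝ fun x => by
      rw [LinearMap.adjoint_inner_right, hRO, (O j).inner_map_map]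
    rw [this, this, (O j).inner_map_map]
  have hbl : blOperator B c Q = blOperator B c P := eq_of_inner_eq fun u w => by
    rw [inner_blOperator, inner_blOperator]
    refine Finset.sum_congr rfl fun j _ => ?_
    rw [hQ, LinearMap.adjoint_comp, LinearMap.comp_apply, LinearMap.comp_apply, hRR]
  obtain ⟨N, hN⟩ := SPlus.exists_gram (blOperator_mem_SPlus hBc (Q := P) hP.surjective)
  have hU : ∀ j y, LinearMap.adjoint (normalMap B Q N j) y =
      LinearMap.adjoint (normalMap B P N j) (O j y) := fun j y => by
    refine adjoint_injective_of_surjective N.surjective ?_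
    rw [adjoint_normalMap, adjoint_normalMap, hQP]
  have hquad : ∀ j x, ⟪Q j x, G j (Q j x)⟫ = ∑ i, x i ^ 2 / (g j i)⁻¹ := fun j x => by
    rw [hQP, ← hin, inner_apply_of_eigenbasis (hHS j).1 (hb j)]
    refine Finset.sum_congr rfl fun i _ => ?_
    have : ⟪b j i, O j x⟫ = x i := by
      rw [← hOs, (O j).inner_map_map, EuclideanSpace.inner_single_left]
      simp
    rw [this, div_inv_eq_mul]
    ring
  refine ⟨Q, N, fun j i => (g j i)⁻¹, δ * ∑ k, hilbertSchmidtSq (P k), fun j x => ?_,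
    hbl.trans hN, fun j i => inv_pos.2 (hg j i), fun j i => inv_le_one_of_one_le₀ (hg1 j i),
    mul_nonneg hδ (Finset.sum_nonneg fun j _ => hilbertSchmidtSq_nonneg _), hτ, hquad,
    fun j => ?_, fun j x => ?_, fun j i hl => ?_⟩
  · rw [hQP, ← hnorm j x]
    exact hP j _
  · simp only [inv_inv]
    rw [← hdet, hH, LinearMap.det_comp, LinearMap.det_comp, det_adjoint, LinearMap.det_comp]
    have h1 : LinearMap.det (R j) ^ 2 = 1 := by
      rw [← det_gram]
      have : gram (R j) = LinearMap.id := eq_of_inner_eq fun u w => by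
        rw [inner_gram, hRO, hRO, (O j).inner_map_map, LinearMap.id_apply]
      rw [this, LinearMap.det_id]
    linear_combination (LinearMap.det (G j) * LinearMap.det (P j) ^ 2) * h1
  · rw [hU, ← hnorm j x]
    exact sub_mul_norm_sq_le_of_minimizer hBc hP hN hδ hmin j _
  · rw [hU, hOs]
    exact norm_sq_le_one_of_minimizer hBc hP hN hδ hmin j ((b j).norm_eq_one i)
      (lt_of_not_ge fun h => hl.not_ge ((one_le_inv₀ (hg j i)).2 h)) (hsymm j) (hHb j i)

/-! ### The gaussian constant is at most the regularised one -/

/-- The sup-convolution condition holds at every point, so an arbitrary almost-everywhere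
modification could break it. Raising the function to `∞` on a measurable null set cannot. -/
theorem exists_measurable_ge_lintegral_eq {α : Type*} [MeasurableSpace α] {μ : Measure α}
    {f : α → ℝ≥0∞} (hf : AEMeasurable f μ) :
    ∃ g, Measurable g ∧ (∀ x, f x ≤ g x) ∧ ∫⁻ x, g x ∂μ = ∫⁻ x, f x ∂μ := by
  classical
  set t := toMeasurable μ {x | f x ≠ hf.mk f x} with ht
  have ht0 : μ t = 0 := by
    rw [ht, measure_toMeasurable]
    exact hf.ae_eq_mk
  refine ⟨fun x => if x ∈ t then ∞ else hf.mk f x,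
    Measurable.ite (measurableSet_toMeasurable _ _) measurable_const hf.measurable_mk,
    fun x => ?_, lintegral_congr_ae ?_⟩
  · dsimp only
    split_ifs with h
    · exact le_top
    · exact (not_not.1 fun hne => h (subset_toMeasurable μ _ hne)).le
  · have h1 : ∀ᵐ x ∂μ, x ∉ t := measure_eq_zero_iff_ae_notMem.1 ht0
    filter_upwards [h1, hf.ae_eq_mk] with x hx hx2
    rw [if_neg hx, hx2]

/-- In the coordinates `Q` the kernel `g_G` is axis-parallel with widths `l_i`, so a function of
type `G` becomes a heat potential at time `0`. -/
theorem lintegral_gaussian_eq_heatPotential {n : ℕ} {G Q : Euc n →ₗ[ℝ] Euc n}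
    (E : Euc n ≃ₗ[ℝ] Euc n) (hE : ∀ x, E x = Q x) {l : Fin n → ℝ} (hl : ∀ i, 0 < l i)
    (hquad : ∀ x, ⟪Q x, G (Q x)⟫ = ∑ i, x i ^ 2 / l i) (ν : Measure (Euc n)) [IsFiniteMeasure ν]
    (x : Euc n) :
    ∫⁻ y, gaussian G (Q x - y) ∂ν =
      ENNReal.ofReal (√(LinearMap.det G) * heatPotential l (ν.map E.symm) 0 x) := by
  have hemb : MeasurableEmbedding E.symm :=
    E.symm.toContinuousLinearEquiv.toHomeomorph.measurableEmbedding
  have : IsFiniteMeasure (ν.map E.symm) := Measure.isFiniteMeasure_map ν _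
  have h1 : ∫⁻ y, gaussian G (Q x - y) ∂ν = ∫⁻ y, gaussian G (Q x - Q y) ∂(ν.map E.symm) := by
    rw [hemb.lintegral_map]
    simp only [← hE, LinearEquiv.apply_symm_apply]
  rw [h1, heatPotential, ENNReal.ofReal_mul (Real.sqrt_nonneg _),
    ofReal_integral_eq_lintegral_ofReal (integrable_exp_heatExponent hl le_rfl _ x)
      (by filter_upwards with y using (Real.exp_pos _).le),
    ← lintegral_const_mul _ (show Measurable fun y => ENNReal.ofReal (rexp (heatExponent l 0 x y))
      from ENNReal.measurable_ofReal.comp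
        (Real.continuous_exp.comp (continuous_heatExponent l 0 x)).measurable)]
  refine lintegral_congr fun y => ?_
  rw [gaussian, ← map_sub, hquad, heatExponent, ENNReal.ofReal_mul (Real.sqrt_nonneg _)]
  simp

/-- Near-minimisers may degenerate as `η → 0`, with `Q` unbounded and `l` tending to `0`, so a loss
depending on them would be fatal. The support is therefore measured by `⟪y, G_j y⟫ ≤ κ`, which pulls
back under any `Q` to `y_i² ≤ κ l_i` with the same `κ`. -/
theorem barthe_of_bounded_support {m n : ℕ} {d : Fin m → ℕ} {B : ∀ j, Euc n →ₗ[ℝ] Euc (d j)}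
    {c : Fin m → ℝ} (hBc : NondegenerateDatum B c) {G : ∀ j, Euc (d j) →ₗ[ℝ] Euc (d j)}
    (hG : ∀ j, G j ∈ SPlus (d j)) {C : ℝ} (hC : 0 < C)
    (hval : ∀ Q, IsAdmissible G Q → C ≤ gaussianValue B c Q) {κ : ℝ} (hκ : 0 ≤ κ)
    (ν : ∀ j, Measure (Euc (d j))) [∀ j, IsFiniteMeasure (ν j)] [∀ j, NeZero (ν j)]
    (hν : ∀ j, ∀ᵐ y ∂ν j, ⟪y, G j y⟫ ≤ κ) {F : Euc n → ℝ≥0∞} (hFm : Measurable F)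
    (hF : BartheCondition B c (fun j x => ∫⁻ y, gaussian (G j) (x - y) ∂ν j) F) :
    ENNReal.ofReal C * ∏ j, ν j Set.univ ^ c j ≤ ∫⁻ z, F z := by
  have hc := hBc.exponent_pos
  have key : ∀ η : ℝ, 0 < η → ENNReal.ofReal (C * rexp (∑ j, c j * Real.log ((ν j).real Set.univ)
      - π * η * κ * ∑ j, (d j : ℝ))) ≤ ∫⁻ z, F z := by
    intro η hη
    obtain ⟨Q, N, l, τ, hQ, hN, hl, hl1, hτ, hτη, hquad, hdet, hUτ, hUl⟩ :=
      exists_normal_position hBc hG hC hval hη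
    set E : ∀ j, Euc (d j) ≃ₗ[ℝ] Euc (d j) := fun j =>
      LinearEquiv.ofInjectiveEndo (Q j) (hQ.injective j) with hE
    have hEQ : ∀ j x, E j x = Q j x := fun j x => rfl
    have hemb : ∀ j, MeasurableEmbedding (E j).symm := fun j =>
      (E j).symm.toContinuousLinearEquiv.toHomeomorph.measurableEmbedding
    set ν' : ∀ j, Measure (Euc (d j)) := fun j => (ν j).map (E j).symm with hν'
    have hfin : ∀ j, IsFiniteMeasure (ν' j) := fun j => Measure.isFiniteMeasure_map _ _
    have huniv : ∀ j, ν' j Set.univ = ν j Set.univ := fun j => by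
      rw [hν', Measure.map_apply (hemb j).measurable MeasurableSet.univ, Set.preimage_univ]
    have hne : ∀ j, NeZero (ν' j) := fun j => ⟨fun h => by
      have h1 := huniv j
      rw [h] at h1
      exact NeZero.ne (ν j) (Measure.measure_univ_eq_zero.1 h1.symm)⟩
    have hsupp : ∀ j, ∀ᵐ y ∂ν' j, ∀ i, y i ^ 2 ≤ κ * l j i := fun j => by
      rw [hν', (hemb j).ae_map_iff]
      filter_upwards [hν j] with y hy i
      have h1 := hquad j ((E j).symm y)
      rw [← hEQ, LinearEquiv.apply_symm_apply] at h1
      rw [h1] at hy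
      rw [← div_le_iff₀ (hl j i)]
      exact (Finset.single_le_sum (f := fun i => (E j).symm y i ^ 2 / l j i)
        (fun i _ => div_nonneg (sq_nonneg _) (hl j i).le) (Finset.mem_univ i)).trans hy
    have hdQ : ∀ j, 0 < |LinearMap.det (Q j)| := fun j => abs_pos.2 (hQ.det_ne_zero j)
    have hdN : 0 < |LinearMap.det (N : Euc n →ₗ[ℝ] Euc n)| :=
      abs_pos.2 (LinearEquiv.isUnit_det' N).ne_zero
    have hdG : ∀ j, 0 < √(LinearMap.det (G j)) := fun j => Real.sqrt_pos.2 (SPlus.det_pos (hG j))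
    have hlog : ∀ j, Real.log (√(LinearMap.det (G j)) * |LinearMap.det (Q j)|) =
        -(1 / 2) * ∑ i, Real.log (l j i) := fun j => by
      have h1 : √(LinearMap.det (G j)) * |LinearMap.det (Q j)| = √(∏ i, (l j i)⁻¹) := by
        rw [← hdet, Real.sqrt_mul (SPlus.det_pos (hG j)).le, Real.sqrt_sq_eq_abs]
      rw [h1, Real.log_sqrt (Finset.prod_nonneg fun i _ => (inv_pos.2 (hl j i)).le),
        Real.log_prod fun i _ => (inv_pos.2 (hl j i)).ne']
      simp only [Real.log_inv, Finset.sum_neg_distrib]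
      ring
    set p : ℝ := ∏ j, |LinearMap.det (Q j)| ^ c j with hp
    have hp0 : 0 < p := Finset.prod_pos fun j _ => Real.rpow_pos_of_pos (hdQ j) _
    have hNmeas : Measurable (adjointEquiv N) :=
      (adjointEquiv N).toContinuousLinearEquiv.continuous.measurable
    -- The factor `p = ∏ |det Q_j|^{c_j}` combines with `√(det G_j)` to give `∏ (l j i)^{-c_j/2}`,
    -- the normalisation expected at time `0`.
    have hnp := barthe_of_normal_position hc (sum_adjoint_normalMap hN) hl hl1 hτ hUτ hUl hκ ν'
      hsupp (F := fun z => ENNReal.ofReal p * F (adjointEquiv N z))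
      ((hFm.comp hNmeas).const_mul _) fun x => by
        have h1 := hF fun j => Q j (x j)
        have h2 : adjointEquiv N (∑ j, c j • LinearMap.adjoint (normalMap B Q N j) (x j)) =
            ∑ j, c j • LinearMap.adjoint (B j) (Q j (x j)) := by
          rw [map_sum]
          refine Finset.sum_congr rfl fun j _ => ?_
          rw [map_smul, adjointEquiv_apply, adjoint_normalMap]
        rw [h2]
        refine le_trans (le_of_eq ?_) (mul_le_mul_right h1 _)
        have hpos : ∀ j, 0 < heatPotential (l j) (ν' j) 0 (x j) := fun j =>
          heatPotential_pos (hl j) le_rfl (ν' j) (x j)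
        have h3 : ∀ j, (∫⁻ y, gaussian (G j) (Q j (x j) - y) ∂ν j) ^ c j =
            ENNReal.ofReal ((√(LinearMap.det (G j)) * heatPotential (l j) (ν' j) 0 (x j)) ^ c j) :=
          fun j => by
            rw [lintegral_gaussian_eq_heatPotential (E j) (hEQ j) (hl j) (hquad j),
              ENNReal.ofReal_rpow_of_nonneg (mul_pos (hdG j) (hpos j)).le (hc j).le]
        simp only [h3]
        rw [← ENNReal.ofReal_prod_of_nonneg fun j _ =>
            Real.rpow_nonneg (mul_pos (hdG j) (hpos j)).le _, ← ENNReal.ofReal_mul hp0.le, hp,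
          ← Finset.prod_mul_distrib, Real.exp_sum]
        refine congrArg _ (Finset.prod_congr rfl fun j _ => ?_)
        rw [← Real.mul_rpow (hdQ j).le (mul_pos (hdG j) (hpos j)).le,
          show |LinearMap.det (Q j)| * (√(LinearMap.det (G j)) * heatPotential (l j) (ν' j) 0 (x j))
            = (√(LinearMap.det (G j)) * |LinearMap.det (Q j)|)
              * heatPotential (l j) (ν' j) 0 (x j) by ring,
          Real.rpow_def_of_pos (mul_pos (mul_pos (hdG j) (hdQ j)) (hpos j)),
          Real.log_mul (mul_pos (hdG j) (hdQ j)).ne' (hpos j).ne', hlog]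
        congr 1
        ring
    rw [lintegral_const_mul _ (show Measurable fun z => F (adjointEquiv N z) from hFm.comp hNmeas),
      lintegral_comp_linear, coe_adjointEquiv,
      det_adjoint, abs_inv, ← mul_assoc, ← ENNReal.ofReal_mul hp0.le] at hnp
    simp only [Measure.real, huniv] at hnp
    -- The Jacobians of the change of variables multiply to the inverse of the gaussian value at
    -- `Q`, and this is where `C` enters the inequality.
    have hv : gaussianValue B c Q * (p * |LinearMap.det (N : Euc n →ₗ[ℝ] Euc n)|⁻¹) = 1 := by
      have : ∏ j, |LinearMap.det (Q j)| ^ (-c j) = p⁻¹ := by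
        rw [hp, ← Finset.prod_inv_distrib]
        exact Finset.prod_congr rfl fun j _ => Real.rpow_neg (hdQ j).le _
      rw [gaussianValue, hN, det_gram, Real.sqrt_sq_eq_abs, this]
      field_simp
    have hv0 := hQ.gaussianValue_pos hBc
    calc _ ≤ ENNReal.ofReal (gaussianValue B c Q *
          rexp (∑ j, c j * Real.log ((ν j Set.univ).toReal) - π * τ * κ * ∑ j, (d j : ℝ))) := by
          refine ENNReal.ofReal_le_ofReal (mul_le_mul (hval Q hQ) (Real.exp_le_exp.2 ?_)
            (Real.exp_pos _).le hv0.le)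
          refine sub_le_sub_left ?_ _
          have hpi := Real.pi_pos
          have hd : 0 ≤ ∑ j, (d j : ℝ) := Finset.sum_nonneg fun j _ => Nat.cast_nonneg _
          gcongr
      _ ≤ ENNReal.ofReal (gaussianValue B c Q) * (ENNReal.ofReal
          (p * |LinearMap.det (N : Euc n →ₗ[ℝ] Euc n)|⁻¹) * ∫⁻ z, F z) := by
          rw [ENNReal.ofReal_mul hv0.le]
          exact mul_le_mul_right hnp _
      _ = ∫⁻ z, F z := by
          rw [← mul_assoc, ← ENNReal.ofReal_mul hv0.le, hv, ENNReal.ofReal_one, one_mul]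
  have hM : ∀ j, 0 < (ν j).real Set.univ := fun j => measureReal_univ_pos
  have hlhs : ENNReal.ofReal C * ∏ j, ν j Set.univ ^ c j =
      ENNReal.ofReal (C * rexp (∑ j, c j * Real.log ((ν j).real Set.univ))) := by
    rw [ENNReal.ofReal_mul hC.le, Real.exp_sum,
      ENNReal.ofReal_prod_of_nonneg fun j _ => (Real.exp_pos _).le]
    refine congrArg _ (Finset.prod_congr rfl fun j _ => ?_)
    rw [mul_comm (c j), ← Real.rpow_def_of_pos (hM j), ← ENNReal.ofReal_rpow_of_nonneg (hM j).le
      (hc j).le, ofReal_measureReal]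
  rw [hlhs]
  have hlim : Tendsto (fun η : ℝ => ENNReal.ofReal (C * rexp (∑ j, c j *
      Real.log ((ν j).real Set.univ) - π * η * κ * ∑ j, (d j : ℝ)))) (𝓝[>] 0) (𝓝 (ENNReal.ofReal
      (C * rexp (∑ j, c j * Real.log ((ν j).real Set.univ) - π * 0 * κ * ∑ j, (d j : ℝ))))) := by
    refine (Continuous.tendsto ?_ 0).mono_left nhdsWithin_le_nhds
    exact ENNReal.continuous_ofReal.comp (by fun_prop)
  rw [mul_zero, zero_mul, zero_mul, sub_zero] at hlim
  refine le_of_tendsto hlim ?_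
  filter_upwards [self_mem_nhdsWithin] with η hη using key η hη

theorem gaussianBartheConst_le_regularizedBartheConst {m n : ℕ} {d : Fin m → ℕ}
    {B : ∀ j, Euc n →ₗ[ℝ] Euc (d j)} {c : Fin m → ℝ} (hBc : NondegenerateDatum B c)
    {G : ∀ j, Euc (d j) →ₗ[ℝ] Euc (d j)} (hG : ∀ j, G j ∈ SPlus (d j)) :
    gaussianBartheConst B c G ≤ regularizedBartheConst B c G := by
  have hc := hBc.exponent_pos
  refine le_sInf ?_
  rintro _ ⟨f, fstar, hf, hfs, hcond, rfl⟩
  -- Positivity of the constant is what makes the penalised problem coercive; if it is zero there is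
  -- nothing to prove.
  rcases eq_or_ne (gaussianBartheConst B c G) 0 with h0 | h0
  · rw [h0]; exact zero_le
  have hle : ∀ Q, IsAdmissible G Q →
      gaussianBartheConst B c G ≤ ENNReal.ofReal (gaussianValue B c Q) := fun Q hQ =>
    gaussianBartheConst_le_gaussianValue hBc hG
      (fun j => LinearEquiv.ofInjectiveEndo (Q j) (hQ.injective j)) hQ
  obtain ⟨Q₀, hQ₀⟩ := exists_isAdmissible hG
  have htop : gaussianBartheConst B c G ≠ ∞ :=
    ((hle Q₀ hQ₀).trans_lt ENNReal.ofReal_lt_top).ne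
  set C : ℝ := (gaussianBartheConst B c G).toReal with hCd
  have hC : 0 < C := ENNReal.toReal_pos h0 htop
  have hCe : ENNReal.ofReal C = gaussianBartheConst B c G := ENNReal.ofReal_toReal htop
  have hval : ∀ Q, IsAdmissible G Q → C ≤ gaussianValue B c Q := fun Q hQ => by
    have := hle Q hQ
    rw [← hCe] at this
    exact (ENNReal.ofReal_le_ofReal_iff (hQ.gaussianValue_pos hBc).le).1 this
  obtain ⟨F, hFm, hFge, hFint⟩ := exists_measurable_ge_lintegral_eq hfs.1
  choose μ hμfin hμ0 hμf using hf
  have hint : ∀ j, ∫⁻ x, f j x = μ j Set.univ := fun j => by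
    simp only [hμf]
    exact lintegral_gaussian_conv (hG j) (μ j)
  have hu0 : ∀ j, μ j Set.univ ≠ 0 := fun j => Measure.measure_univ_ne_zero.2 (hμ0 j)
  have hut : ∀ j, μ j Set.univ ≠ ∞ := fun j => measure_ne_top _ _
  rw [bartheFunctional]
  simp only [hint]
  have hprod0 : ∏ j, μ j Set.univ ^ c j ≠ 0 :=
    Finset.prod_ne_zero_iff.2 fun j _ => (ENNReal.rpow_pos (pos_iff_ne_zero.2 (hu0 j)) (hut j)).ne'
  have hprodt : ∏ j, μ j Set.univ ^ c j ≠ ∞ :=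
    ENNReal.prod_ne_top fun j _ => ENNReal.rpow_ne_top_of_nonneg (hc j).le (hut j)
  rw [ENNReal.le_div_iff_mul_le (Or.inl hprod0) (Or.inl hprodt), ← hFint, ← hCe]
  have key : ∀ k : ℕ, ENNReal.ofReal C * ∏ j, μ j (Metric.closedBall 0 k) ^ c j ≤ ∫⁻ z, F z := by
    intro k
    -- Small balls may carry no mass. The left side is then zero because `c j > 0`; otherwise every
    -- truncated measure is nonzero, as the bounded-support case requires.
    by_cases hz : ∃ j, μ j (Metric.closedBall 0 k) = 0
    · obtain ⟨j, hj⟩ := hz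
      rw [Finset.prod_eq_zero (Finset.mem_univ j) (by rw [hj, ENNReal.zero_rpow_of_pos (hc j)]),
        mul_zero]
      exact zero_le
    push Not at hz
    set ν : ∀ j, Measure (Euc (d j)) := fun j => (μ j).restrict (Metric.closedBall 0 k) with hν
    have hνu : ∀ j, ν j Set.univ = μ j (Metric.closedBall 0 k) := fun j => by
      rw [hν, Measure.restrict_apply_univ]
    have hνne : ∀ j, NeZero (ν j) := fun j => ⟨fun h => hz j (by rw [← hνu, h]; rfl)⟩
    set g : Fin m → ℝ := fun j => ‖LinearMap.toContinuousLinearMap (G j)‖ with hg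
    have hκ : 0 ≤ (∑ j, g j) * (k : ℝ) ^ 2 :=
      mul_nonneg (Finset.sum_nonneg fun j _ => norm_nonneg _) (sq_nonneg _)
    have := barthe_of_bounded_support hBc hG hC hval hκ ν (fun j => by
      rw [hν, ae_restrict_iff' Metric.isClosed_closedBall.measurableSet]
      filter_upwards with y hy
      rw [mem_closedBall_zero_iff] at hy
      have h1 : ‖G j y‖ ≤ g j * ‖y‖ := (LinearMap.toContinuousLinearMap (G j)).le_opNorm y
      have h2 : g j ≤ ∑ j, g j :=
        Finset.single_le_sum (f := g) (fun j _ => norm_nonneg _) (Finset.mem_univ j)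
      calc ⟪y, G j y⟫ ≤ ‖y‖ * ‖G j y‖ := real_inner_le_norm _ _
        _ ≤ ‖y‖ * (g j * ‖y‖) := mul_le_mul_of_nonneg_left h1 (norm_nonneg _)
        _ = g j * ‖y‖ ^ 2 := by ring
        _ ≤ (∑ j, g j) * (k : ℝ) ^ 2 := mul_le_mul h2 (pow_le_pow_left₀ (norm_nonneg _) hy 2)
            (sq_nonneg _) (Finset.sum_nonneg fun j _ => norm_nonneg _)) hFm fun x => by
      refine le_trans ?_ ((hcond x).trans (hFge _))
      refine Finset.prod_le_prod' fun j _ => ENNReal.rpow_le_rpow ?_ (hc j).le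
      rw [hμf]
      exact lintegral_mono' Measure.restrict_le_self le_rfl
    simpa only [hνu] using this
  have hlim : Tendsto (fun k : ℕ => ENNReal.ofReal C * ∏ j, μ j (Metric.closedBall 0 k) ^ c j) atTop
      (𝓝 (ENNReal.ofReal C * ∏ j, μ j Set.univ ^ c j)) := by
    refine ENNReal.Tendsto.const_mul ?_ (Or.inr ENNReal.ofReal_ne_top)
    refine ENNReal.tendsto_finsetProd_of_ne_top _ (fun j _ => ?_)
      fun j _ => ENNReal.rpow_ne_top_of_nonneg (hc j).le (hut j)
    have h1 : Tendsto (fun k : ℕ => μ j (Metric.closedBall 0 k)) atTop (𝓝 (μ j Set.univ)) := by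
      rw [← Metric.iUnion_closedBall_nat (0 : Euc (d j))]
      exact tendsto_measure_iUnion_atTop fun a b hab =>
        Metric.closedBall_subset_closedBall (Nat.cast_le.2 hab)
    exact ((ENNReal.continuous_rpow_const (y := c j)).tendsto _).comp h1
  exact le_of_tendsto' hlim key

end

theorem theoremt (m n : ℕ) (d : Fin m → ℕ)
    (B : ∀ j, EuclideanSpace ℝ (Fin n) →ₗ[ℝ] EuclideanSpace ℝ (Fin (d j))) (c : Fin m → ℝ)
    (G : ∀ j, EuclideanSpace ℝ (Fin (d j)) →ₗ[ℝ] EuclideanSpace ℝ (Fin (d j)))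
    (hBc : NondegenerateDatum B c) (hG : ∀ j, G j ∈ SPlus (d j)) :
    regularizedBartheConst B c G = gaussianBartheConst B c G := by
  exact le_antisymm (regularizedBartheConst_le_gaussianBartheConst B hBc.exponent_pos hG)
    (gaussianBartheConst_le_regularizedBartheConst hBc hG)
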